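/- Let $n\ge 1$, let $E$ be a complex Banach space with $\mathcal L(E)$ its bounded linear operators, and let $s\in\mathbb R$, $1<p<\infty$, $1\le q\le\infty$. Then the following are equivalent: (i) every function $M:\mathbb Z^n\to\mathcal L(E)$ of bounded variation with respect to the coarse decomposition of $\mathbb Z^n$ is a Fourier multiplier on $B^s_{p,q}(\mathbb T^n,E)$; (ii) $E$ is a UMD space. The notions are as follows. Put $e_k(x)=e^{ik\cdot x}$. *Distributions.* $\mathcal D'(\mathbb T^n,E)$ is the space of continuous linear maps $f:C^\infty(\mathbb T^n)\to E$, where $C^\infty(\mathbb T^n)$ is the space of smooth complex functions on $\mathbb R^n$ that are $2\pi$-periodic in each variable, with the topology of uniform convergence of all derivatives; $\hat f(k)=f(e_{-k})$ for $k\in\mathbb Z^n$. The norm of $L^p(\mathbb T^n,E)$ is taken on $[0,2\pi]^n$ with respect to $(2\pi)^{-n}dx$. *Besov spaces.* Let $(\phi_j)_{j\ge0}$ be any sequence of Schwartz functions on $\mathbb R^n$ with $\operatorname{supp}\phi_0\subset\Omega_0=\{|x|\le 2\}$, $\operatorname{supp}\phi_j\subset\Omega_j=\{2^{j-1}\le|x|\le2^{j+1}\}$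 for $j\ge1$, $\sum_j\phi_j=1$ on $\mathbb R^n$, and $|\partial^\alpha\phi_j|\le C_\alpha2^{-j|\alpha|}\chi_{\Omega_j}$ for all $j$ and all multi-indices $\alpha$. Then $B^s_{p,q}(\mathbb T^n,E)$ is the set of all $f\in\mathcal D'(\mathbb T^n,E)$ for which the sequence $$\Big(2^{sj}\Big\|\sum_{k\in\mathbb Z^n}\phi_j(k)\,e_k\,\hat f(k)\Big\|_{L^p(\mathbb T^n,E)}\Big)_{j\ge0}$$ belongs to $\ell^q$. The equivalence of (i) and (ii) holds for every such choice of $(\phi_j)$. $M$ is a Fourier multiplier on $B^s_{p,q}(\mathbb T^n,E)$ if for each $f\in B^s_{p,q}(\mathbb T^n,E)$ there is $g\in B^s_{p,q}(\mathbb T^n,E)$ with $\hat g(k)=M(k)\hat f(k)$ for all $k\in\mathbb Z^n$. *UMD.* $E$ is a UMD space if for some $r\in(1,\infty)$ there is $C$ such that $\big\|\sum_{k\ge0}e_kx_k\big\|_{L^r(\mathbb T^n,E)}\le C\big\|\sum_{k}e_kx_k\big\|_{L^r(\mathbb T^n,E)}$ for all finitely supported families $(x_k)_{k\in\mathbb Z^n}$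 in $E$, where $k\ge0$ is meant componentwise. *Bounded variation.* For $\alpha\le\beta$ in $\mathbb Z^n$ (componentwise) let $[\alpha,\beta]=\{k\in\mathbb Z^n:\alpha\le k\le\beta\}$ and $$\operatorname{Var}_{[\alpha,\beta]}M=\sum_{\xi\in[\alpha,\beta]}\Big\|\Big(\prod_{j:\,\xi_j\ne\alpha_j}\Delta_j\Big)M(\xi)\Big\|,\qquad \Delta_jM(\xi)=M(\xi)-M(\xi-\delta_j),$$ where $\delta_1,\dots,\delta_n$ is the standard basis. Let $D_0=\{0\}$, and for $d=nr+l$ with $r\ge0$ and $1\le l\le n$ let $$D_d=\{k\in\mathbb Z^n:\ |k_i|<2^{r+1}\ (i<l),\quad 2^r\le|k_l|<2^{r+1},\quad |k_i|<2^r\ (i>l)\},$$ which is the disjoint union of the two boxes $D_{d^\pm}=\{k\in D_d:\pm k_l>0\}$. Put $\operatorname{Var}_{D_0}M=\|M(0)\|$ and $\operatorname{Var}_{D_d}M=\operatorname{Var}_{D_{d^+}}M+\operatorname{Var}_{D_{d^-}}M$ for $d\ge1$. $M$ is of bounded variation with respect to the coarse decomposition $(D_d)_{d\ge0}$ if $\sup_k\|M(k)\|<\infty$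 and $\sup_{d\ge0}\operatorname{Var}_{D_d}M<\infty$. -/

import Mathlib

open scoped ENNReal NNReal SchwartzMap

noncomputable section

namespace TorusBesov

/-! ### Periodic test functions and periodic distributions -/

/-- `C^∞(𝕋ⁿ)`: smooth complex functions on `ℝⁿ` that are `2π`-periodic in each variable. -/
def TestFunction (n : ℕ) : Submodule ℂ ((Fin n → ℝ) → ℂ) where
  carrier := {φ | ContDiff ℝ ((⊤ : ℕ∞) : WithTop ℕ∞) φ ∧
    ∀ (x : Fin n → ℝ) (j : Fin n), φ (x + Pi.single j (2 * Real.pi)) = φ x}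
  add_mem' := by
    rintro φ ψ ⟨hφ, pφ⟩ ⟨hψ, pψ⟩
    exact ⟨hφ.add hψ, fun x j => by simp [pφ x j, pψ x j]⟩
  zero_mem' := ⟨contDiff_const, fun _ _ => rfl⟩
  smul_mem' := by
    rintro c φ ⟨hφ, pφ⟩
    exact ⟨hφ.const_smul c, fun x j => by simp [pφ x j]⟩

/-- The seminorm `q_N(φ) = max_{m ≤ N} sup_x ‖D^m φ(x)‖` (finite on periodic smooth functions). -/
def testSeminorm {n : ℕ} (N : ℕ) (φ : TestFunction n) : ℝ≥0∞ :=
  ⨆ (m : ℕ) (_ : m ≤ N) (x : Fin n → ℝ),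
    ‖iteratedFDeriv ℝ m (φ : (Fin n → ℝ) → ℂ) x‖ₑ

/-- `𝒟'(𝕋ⁿ, E)`: linear maps `C^∞(𝕋ⁿ) → E` that are continuous for the topology given by the
increasing family of seminorms `q_N`. -/
structure PeriodicDistribution (n : ℕ) (E : Type*) [NormedAddCommGroup E] [NormedSpace ℂ E] where
  toLinearMap : TestFunction n →ₗ[ℂ] E
  continuous_bound : ∃ (N : ℕ) (C : ℝ≥0), ∀ φ : TestFunction n,
    ‖toLinearMap φ‖ₑ ≤ C * testSeminorm N φ

/-- The character `e_k(x) = e^{i k·x}`. -/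
def expChar {n : ℕ} (k : Fin n → ℤ) (x : Fin n → ℝ) : ℂ :=
  Complex.exp (Complex.I * ((∑ i, (k i : ℝ) * x i : ℝ) : ℂ))

theorem expChar_mem {n : ℕ} (k : Fin n → ℤ) : expChar k ∈ TestFunction n := by
  refine ⟨?_, fun x j => ?_⟩
  · unfold expChar
    have h0 : ContDiff ℝ ((⊤ : ℕ∞) : WithTop ℕ∞) (fun x : Fin n → ℝ => ∑ i, (k i : ℝ) * x i) :=
      ContDiff.sum fun i _ => contDiff_const.mul (contDiff_apply ℝ ℝ i)
    exact (contDiff_const.mul (Complex.ofRealCLM.contDiff.comp h0)).cexp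
  · have h : (∑ i, (k i : ℝ) * (x + (Pi.single j (2 * Real.pi) : Fin n → ℝ)) i)
        = (∑ i, (k i : ℝ) * x i) + k j * (2 * Real.pi) := by
      simp [mul_add, Finset.sum_add_distrib, Pi.single_apply]
    unfold expChar
    rw [h, Complex.exp_eq_exp_iff_exists_int]
    exact ⟨k j, by push_cast; ring⟩

/-- `e_k` as a test function. -/
def charTest {n : ℕ} (k : Fin n → ℤ) : TestFunction n := ⟨expChar k, expChar_mem k⟩

section Spaces

variable {n : ℕ} {E : Type*} [NormedAddCommGroup E] [NormedSpace ℂ E]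

/-- The Fourier coefficient `f̂(k) = f(e_{-k})`. -/
def PeriodicDistribution.coeff (f : PeriodicDistribution n E) (k : Fin n → ℤ) : E :=
  f.toLinearMap (charTest (-k))

/-- Normalized Lebesgue measure `(2π)^{-n} dx` on `[0,2π]ⁿ`. -/
def torusMeasure (n : ℕ) : MeasureTheory.Measure (Fin n → ℝ) :=
  (ENNReal.ofReal ((2 * Real.pi) ^ n))⁻¹ •
    MeasureTheory.volume.restrict (Set.Icc 0 (fun _ => 2 * Real.pi))

/-- The norm of `L^p(𝕋ⁿ, E)`. -/
def torusNorm (p : ℝ≥0∞) (f : (Fin n → ℝ) → E) : ℝ≥0∞ :=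
  MeasureTheory.eLpNorm f p (torusMeasure n)

/-! ### Besov spaces -/

/-- The sets `Ω_j`. -/
def annulus (n : ℕ) : ℕ → Set (EuclideanSpace ℝ (Fin n))
  | 0 => Metric.closedBall 0 2
  | j + 1 => {x | (2 : ℝ) ^ j ≤ ‖x‖ ∧ ‖x‖ ≤ (2 : ℝ) ^ (j + 2)}

/-- Dyadic resolutions of unity `(φ_j)` in `𝓢(ℝⁿ)`. The bounds on all partial derivatives of order
`m` are written as a bound on the norm of the `m`-th Fréchet derivative. -/
structure IsResolutionOfUnity (φ : ℕ → 𝓢(EuclideanSpace ℝ (Fin n), ℂ)) : Prop where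
  support_subset : ∀ j, tsupport (φ j) ⊆ annulus n j
  sum_eq_one : ∀ ξ, HasSum (fun j => φ j ξ) 1
  deriv_bound : ∀ m : ℕ, ∃ C : ℝ, 0 < C ∧ ∀ (j : ℕ) (ξ : EuclideanSpace ℝ (Fin n)),
    ‖iteratedFDeriv ℝ m (φ j) ξ‖
      ≤ C * ((2 : ℝ) ^ (j * m))⁻¹ * (annulus n j).indicator (fun _ => (1 : ℝ)) ξ

/-- A lattice point as a point of Euclidean space. -/
def latticePoint (k : Fin n → ℤ) : EuclideanSpace ℝ (Fin n) :=
  WithLp.toLp 2 (fun i => (k i : ℝ))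

/-- The trigonometric polynomial `∑ₖ e_k ⊗ φ(k) f̂(k)`; the sum is finite when `φ` has compact
support. -/
def littlewoodPaley (φ : 𝓢(EuclideanSpace ℝ (Fin n), ℂ)) (f : PeriodicDistribution n E)
    (x : Fin n → ℝ) : E :=
  ∑' k : Fin n → ℤ, expChar k x • (φ (latticePoint k) • f.coeff k)

/-- The norm of `B^{s,φ}_{p,q}(𝕋ⁿ, E)`, with values in `[0,∞]`. -/
def besovNorm (φ : ℕ → 𝓢(EuclideanSpace ℝ (Fin n), ℂ)) (s : ℝ) (p q : ℝ≥0∞)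
    (f : PeriodicDistribution n E) : ℝ≥0∞ :=
  if q = ∞ then
    ⨆ j : ℕ, ENNReal.ofReal ((2 : ℝ) ^ (s * j)) * torusNorm p (littlewoodPaley (φ j) f)
  else
    (∑' j : ℕ, (ENNReal.ofReal ((2 : ℝ) ^ (s * j)) *
      torusNorm p (littlewoodPaley (φ j) f)) ^ q.toReal) ^ (1 / q.toReal)

/-- `f ∈ B^{s,φ}_{p,q}(𝕋ⁿ, E)`. -/
def MemBesov (φ : ℕ → 𝓢(EuclideanSpace ℝ (Fin n), ℂ)) (s : ℝ) (p q : ℝ≥0∞)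
    (f : PeriodicDistribution n E) : Prop :=
  besovNorm φ s p q f < ∞

/-- `M` is a Fourier multiplier on `B^{s,φ}_{p,q}(𝕋ⁿ, E)`. -/
def IsBesovMultiplier (φ : ℕ → 𝓢(EuclideanSpace ℝ (Fin n), ℂ)) (s : ℝ) (p q : ℝ≥0∞)
    (M : (Fin n → ℤ) → (E →L[ℂ] E)) : Prop :=
  ∀ f : PeriodicDistribution n E, MemBesov φ s p q f →
    ∃ g : PeriodicDistribution n E, MemBesov φ s p q g ∧ ∀ k, g.coeff k = M k (f.coeff k)

/-! ### `L^p`-multipliers and UMD spaces -/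

/-- The trigonometric polynomial `∑ₖ e_k ⊗ c_k`. -/
def trigPoly (c : (Fin n → ℤ) →₀ E) (x : Fin n → ℝ) : E :=
  c.sum fun k v => expChar k x • v

/-- `S_M f = ∑ₖ e_k ⊗ M(k) c_k` for the trigonometric polynomial `f` with coefficients `c`. -/
def multiplierPoly (M : (Fin n → ℤ) → (E →L[ℂ] E)) (c : (Fin n → ℤ) →₀ E)
    (x : Fin n → ℝ) : E :=
  c.sum fun k v => expChar k x • M k v

/-- `M` is uniformly bounded and a discrete `L^p`-Fourier multiplier. -/
def IsLpMultiplier (p : ℝ≥0∞) (M : (Fin n → ℤ) → (E →L[ℂ] E)) : Prop :=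
  (∃ B : ℝ, ∀ k, ‖M k‖ ≤ B) ∧
    ∃ C : ℝ≥0, ∀ c : (Fin n → ℤ) →₀ E,
      torusNorm p (multiplierPoly M c) ≤ C * torusNorm p (trigPoly c)

variable (n E) in
/-- The symbol of the Riesz projection: identity at `k ≥ 0` (all components), zero elsewhere. -/
def rieszSymbol (k : Fin n → ℤ) : E →L[ℂ] E :=
  open Classical in if 0 ≤ k then ContinuousLinearMap.id ℂ E else 0

variable (n E) in
/-- `E` is a UMD space: the `n`-dimensional `E`-valued Riesz projection is bounded on
`L^p(𝕋ⁿ, E)` for some `p ∈ (1,∞)`. -/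
def IsUMD : Prop :=
  ∃ p : ℝ≥0∞, 1 < p ∧ p < ∞ ∧ IsLpMultiplier p (rieszSymbol n E)

end Spaces

/-! ### Bounded variation with respect to the coarse decomposition -/

section Variation

variable {n : ℕ} {V : Type*} [NormedAddCommGroup V]

/-- The difference operator in direction `j` for boxes with lower corner `α`. -/
def diffOp (α : Fin n → ℤ) (j : Fin n) (g : (Fin n → ℤ) → V) (x : Fin n → ℤ) : V :=
  if x j = α j then 0 else g x - g (x - Pi.single j 1)

/-- `Δ^γ = Δ^{γ₁δ₁} ⋯ Δ^{γₙδₙ}`, with `γ ∈ {0,1}ⁿ` given as the set of `j` with `γ_j = 1`. -/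
def diffIter (α : Fin n → ℤ) (γ : Finset (Fin n)) (g : (Fin n → ℤ) → V) : (Fin n → ℤ) → V :=
  (List.finRange n).foldr (fun j h => if j ∈ γ then diffOp α j h else h) g

/-- The variation of `M` on the box `[α, β]`. -/
def boxVar (α β : Fin n → ℤ) (M : (Fin n → ℤ) → V) : ℝ :=
  ∑ ξ ∈ Finset.Icc α β,
    ‖diffIter α (Finset.univ.filter fun j => ξ j ≠ α j) ((Set.Icc α β).indicator M) ξ‖

/-- The block of the coarse decomposition of `ℤⁿ` with level `r` and direction `l`. -/
def coarseBlock (r : ℕ) (l : Fin n) : Set (Fin n → ℤ) :=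
  {k | (∀ i, i < l → |k i| < 2 ^ (r + 1)) ∧ (2 ^ r ≤ |k l| ∧ |k l| < 2 ^ (r + 1)) ∧
    ∀ i, l < i → |k i| < 2 ^ r}

/-- Lower corner of the half of a coarse block where `k_l > 0` (`pos = true`) or `k_l < 0`. -/
def blockLower (pos : Bool) (r : ℕ) (l : Fin n) (i : Fin n) : ℤ :=
  if i < l then 1 - 2 ^ (r + 1)
  else if i = l then (if pos then 2 ^ r else 1 - 2 ^ (r + 1))
  else 1 - 2 ^ r

/-- Upper corner of the half of a coarse block where `k_l > 0` (`pos = true`) or `k_l < 0`. -/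
def blockUpper (pos : Bool) (r : ℕ) (l : Fin n) (i : Fin n) : ℤ :=
  if i < l then 2 ^ (r + 1) - 1
  else if i = l then (if pos then 2 ^ (r + 1) - 1 else -2 ^ r)
  else 2 ^ r - 1

theorem Icc_blockLower_blockUpper (pos : Bool) (r : ℕ) (l : Fin n) :
    Set.Icc (blockLower pos r l) (blockUpper pos r l)
      = {k ∈ coarseBlock r l | if pos then 0 < k l else k l < 0} := by
  have h2 : (0 : ℤ) < 2 ^ r := by positivity
  ext k
  simp only [Set.mem_Icc, Pi.le_def, coarseBlock, Set.mem_ofPred_eq, abs_lt]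
  constructor
  · rintro ⟨h, h'⟩
    have hl := h l
    have hl' := h' l
    simp only [blockLower, blockUpper, lt_irrefl, if_false, if_true] at hl hl'
    refine ⟨⟨fun i hi => ?_, ?_, fun i hi => ?_⟩, ?_⟩
    · have h1 := h i
      have h1' := h' i
      simp only [blockLower, blockUpper, hi, if_true] at h1 h1'
      omega
    · cases pos
      · simp only [Bool.false_eq_true, if_false] at hl hl'
        rw [abs_of_neg (by omega)]
        omega
      · simp only [if_true] at hl hl'
        rw [abs_of_pos (by omega)]
        omega
    · have h1 := h i
      have h1' := h' i
      simp only [blockLower, blockUpper, not_lt_of_gt hi, hi.ne', if_false] at h1 h1'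
      omega
    · cases pos
      · simp only [Bool.false_eq_true, if_false] at hl hl' ⊢
        omega
      · simp only [if_true] at hl hl' ⊢
        omega
  · rintro ⟨⟨ha, hb, hc⟩, hd⟩
    have key : ∀ i, blockLower pos r l i ≤ k i ∧ k i ≤ blockUpper pos r l i := by
      intro i
      rcases lt_trichotomy i l with hi | hi | hi
      · have := ha i hi
        simp only [blockLower, blockUpper, hi, if_true]
        omega
      · subst hi
        simp only [blockLower, blockUpper, lt_irrefl, if_false, if_true]
        cases pos
        · simp only [Bool.false_eq_true, if_false] at hd ⊢
          rw [abs_of_neg hd] at hb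
          omega
        · simp only [if_true] at hd ⊢
          rw [abs_of_pos hd] at hb
          omega
      · have := hc i hi
        simp only [blockLower, blockUpper, not_lt_of_gt hi, hi.ne', if_false]
        omega
    exact ⟨fun i => (key i).1, fun i => (key i).2⟩

/-- The variation of `M` on the block `D_d`. Here `D_0 = {0}`, and a positive index
`d + 1 = n r + l` with `1 ≤ l ≤ n` has `r = d / n` and `l - 1 = d % n`. -/
def coarseVar [NeZero n] (M : (Fin n → ℤ) → V) : ℕ → ℝ
  | 0 => boxVar 0 0 M
  | d + 1 =>
      boxVar (blockLower true (d / n) (Fin.ofNat n d)) (blockUpper true (d / n) (Fin.ofNat n d)) M +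
      boxVar (blockLower false (d / n) (Fin.ofNat n d)) (blockUpper false (d / n) (Fin.ofNat n d)) M

/-- `M` is (uniformly bounded and) of bounded variation with respect to the coarse
decomposition of `ℤⁿ`. -/
def IsCoarseBV [NeZero n] (M : (Fin n → ℤ) → V) : Prop :=
  (∃ B : ℝ, ∀ k, ‖M k‖ ≤ B) ∧ ∃ C : ℝ, ∀ d, coarseVar M d ≤ C

end Variation

end TorusBesov

end

/-! A Besov norm decouples frequencies: it takes the L^p norm of each piece of f cut out by φ_j and
combines these numbers in ℓ^q. A symbol is therefore a multiplier once it is bounded on L^p,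
uniformly in j, for trigonometric polynomials with spectrum in Ω_j. No square function is needed.

UMD implies multiplier. The one-dimensional Riesz projection, modulated and applied in one variable
with the others frozen, gives projections onto the half-spaces {a ≤ k_j} with a bound independent of
a, hence projections onto boxes with a bound independent of the box (`exists_hasLpBound_Icc`).
Summation by parts (`sum_diffIter_eq`) writes M on [α,β] as ∑_η D_η 1_{[η,β]}, where the mixed
differences D_η have norms adding up to the variation; so M is bounded on each box by its variation
times a constant (`torusNorm_boxMultiplier_le`). The number of coarse boxes needed to cover the
lattice points of Ω_j is bounded independently of j (`exists_annulus_multiplier_bound`). The image g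
exists because coefficients of polynomial growth always come from a distribution (`distOfCoeff`).

UMD controls the Riesz projection for one exponent r only, while p is prescribed. The change of
exponent (`exists_isRieszBound`) is a Calderón–Zygmund extrapolation carried out on the cyclic
groups ℤ/2^L, where all sums are finite. Fejér interpolation and Fejér averaging turn the Riesz
projection into convolution with `fejerKernel`, whose symbol is (1 - k/N)^2. This kernel satisfies a
Hörmander condition uniformly in L. A weak-type estimate and the layer cake formula give p < r,
duality gives p > r, and the limit N → ∞ leads back to the circle.

Multiplier implies UMD. This is a gliding hump. If the Riesz projection R is unbounded on L^p, there
are polynomials P_N with ‖P_N‖ ≤ 1 and ‖R P_N‖ ≥ 4^N. Their frequencies are shifted to the centers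
m_N of dyadic shells that are far apart, and f = ∑ 2^{-N} 2^{-s t_N} e_{m_N} P_N. The symbol
`blockSymbol` is, in each shell, the indicator of the orthant above the center; its variation is
bounded because the mixed difference of such an indicator is a point mass. Each φ_j is almost
constant on the spectrum of a hump, so f belongs to the Besov space, whereas some Littlewood–Paley
piece of the image at each hump is of order at least 2^N after weighting. A single f gives the
contradiction, without the closed graph theorem. -/

noncomputable section

namespace TorusBesov

/-! ### Calderón–Zygmund decomposition on a finite filtered set -/

section Stopping

variable {X : Type*} [Fintype X]

/-- The class of `x` at level `l`. -/
def levelClass (c : ℕ → X → ℕ) (l : ℕ) (x : X) : Finset X := Finset.univ.filter fun y => c l y = c l x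

theorem mem_levelClass {c : ℕ → X → ℕ} {l : ℕ} {x y : X} :
    y ∈ levelClass c l x ↔ c l y = c l x := by simp [levelClass]

theorem levelClass_congr {c : ℕ → X → ℕ} {l : ℕ} {x y : X} (h : c l y = c l x) :
    levelClass c l y = levelClass c l x := by
  ext z; simp [mem_levelClass, h]

/-- The stopping level is the largest level at which the class of x has mass above lam · 2^l. By
maximality the next larger class is light, which gives the upper bound with the factor 2. Classes at
level 0 are singletons, so a point that never stops has weight at most lam. -/
theorem exists_stopping (c : ℕ → X → ℕ) (L : ℕ) (hc0 : ∀ x y, c 0 x = c 0 y → x = y)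
    (hcs : ∀ l x y, c l x = c l y → c (l + 1) x = c (l + 1) y)
    (w : X → ℝ) (hw : ∀ x, 0 ≤ w x) (lam : ℝ)
    (hL : ∀ x, ∑ y ∈ levelClass c L x, w y ≤ lam * 2 ^ L) :
    ∃ (Ω : Finset X) (ℓ : X → ℕ),
      (∀ x, x ∉ Ω → w x ≤ lam) ∧
      (∀ x ∈ Ω, ∀ y, c (ℓ x) y = c (ℓ x) x → y ∈ Ω ∧ ℓ y = ℓ x) ∧
      (∀ x ∈ Ω, lam * 2 ^ (ℓ x) < ∑ y ∈ levelClass c (ℓ x) x, w y) ∧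
      (∀ x ∈ Ω, ∑ y ∈ levelClass c (ℓ x) x, w y ≤ 2 * lam * 2 ^ (ℓ x)) ∧
      (∀ x ∈ Ω, ℓ x < L) := by
  classical
  let P : X → ℕ → Prop := fun x l => lam * 2 ^ l < ∑ y ∈ levelClass c l x, w y
  have hcm : ∀ l m x y, l ≤ m → c l x = c l y → c m x = c m y := by
    intro l m x y hlm h
    induction m, hlm using Nat.le_induction with
    | base => exact h
    | succ m _ ih => exact hcs _ _ _ ih
  have hPc : ∀ l x y, c l x = c l y → (P x l ↔ P y l) := by
    intro l x y h
    simp only [P, levelClass_congr h]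
  let Ω : Finset X := Finset.univ.filter fun x => ∃ l ≤ L, P x l
  let ℓ : X → ℕ := fun x => Nat.findGreatest (P x) L
  have hP : ∀ x ∈ Ω, P x (ℓ x) := by
    intro x hx
    obtain ⟨l, hl, h⟩ := (Finset.mem_filter.1 hx).2
    exact Nat.findGreatest_spec hl h
  have hlt : ∀ x ∈ Ω, ℓ x < L := by
    intro x hx
    refine lt_of_le_of_ne (Nat.findGreatest_le L) fun h => ?_
    have := hP x hx
    rw [h] at this
    exact absurd this (not_lt.2 (hL x))
  have hnot : ∀ x l, ℓ x < l → l ≤ L → ¬ P x l := fun x l h1 h2 => Nat.findGreatest_is_greatest h1 h2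
  refine ⟨Ω, ℓ, ?_, ?_, hP, ?_, hlt⟩
  · intro x hx
    by_contra! h
    apply hx
    refine Finset.mem_filter.2 ⟨Finset.mem_univ _, 0, Nat.zero_le _, ?_⟩
    have : levelClass c 0 x = {x} := by
      ext y
      simp only [mem_levelClass, Finset.mem_singleton]
      exact ⟨fun h => hc0 _ _ h, fun h => by rw [h]⟩
    simp only [P, this, Finset.sum_singleton, pow_zero, mul_one]
    exact h
  · intro x hx y hy
    have h1 : P y (ℓ x) := (hPc _ _ _ hy).2 (hP x hx)
    refine ⟨Finset.mem_filter.2 ⟨Finset.mem_univ _, ℓ x, (hlt x hx).le, h1⟩, ?_⟩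
    -- If y stopped at a higher level, its class there would also contain x, against the maximality
    -- of ℓ x.
    refine le_antisymm ?_ (Nat.le_findGreatest (hlt x hx).le h1)
    by_contra! h
    have hy' : P y (ℓ y) := Nat.findGreatest_spec (hlt x hx).le h1
    exact hnot x (ℓ y) h (Nat.findGreatest_le L) ((hPc _ _ _ (hcm _ _ _ _ h.le hy)).1 hy')
  · intro x hx
    have h := hnot x (ℓ x + 1) (Nat.lt_succ_self _) (hlt x hx)
    simp only [P, not_lt] at h
    calc ∑ y ∈ levelClass c (ℓ x) x, w y ≤ ∑ y ∈ levelClass c (ℓ x + 1) x, w y := by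
          refine Finset.sum_le_sum_of_subset_of_nonneg ?_ fun _ _ _ => hw _
          intro y hy
          exact mem_levelClass.2 (hcs _ _ _ (mem_levelClass.1 hy))
      _ ≤ _ := h
      _ = _ := by ring

/-- The average of `h` over the class of `x` at level `ℓ x`. -/
def classAvg (𝕜 : Type*) [Field 𝕜] {V : Type*} [AddCommGroup V] [Module 𝕜 V]
    (c : ℕ → X → ℕ) (ℓ : X → ℕ) (h : X → V) (x : X) : V :=
  ((2 : 𝕜) ^ (ℓ x))⁻¹ • ∑ y ∈ levelClass c (ℓ x) x, h y

/-- Averaging is self-adjoint, and k is constant on the stopping classes. With k = 1 this compares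
masses; with k the convolution kernel frozen at left endpoints it yields the cancellation of the bad
part. -/
theorem sum_smul_classAvg {𝕜 : Type*} [Field 𝕜] [CharZero 𝕜] {V : Type*} [AddCommGroup V]
    [Module 𝕜 V] (c : ℕ → X → ℕ) (ℓ : X → ℕ) (Ω : Finset X)
    (hinv : ∀ x ∈ Ω, ∀ y, c (ℓ x) y = c (ℓ x) x → y ∈ Ω ∧ ℓ y = ℓ x)
    (hcard : ∀ x ∈ Ω, (levelClass c (ℓ x) x).card = 2 ^ (ℓ x))
    (k : X → 𝕜) (hk : ∀ x ∈ Ω, ∀ y, c (ℓ x) y = c (ℓ x) x → k y = k x) (h : X → V) :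
    ∑ x ∈ Ω, k x • classAvg 𝕜 c ℓ h x = ∑ x ∈ Ω, k x • h x := by
  classical
  have h1 : ∀ x ∈ Ω, k x • classAvg 𝕜 c ℓ h x
      = ∑ y ∈ Ω, if c (ℓ x) y = c (ℓ x) x then ((2 : 𝕜) ^ (ℓ y))⁻¹ • k y • h y else 0 := by
    intro x hx
    rw [← Finset.sum_filter, classAvg, Finset.smul_sum, Finset.smul_sum]
    have : levelClass c (ℓ x) x = Ω.filter fun y => c (ℓ x) y = c (ℓ x) x := by
      ext y
      simp only [mem_levelClass, Finset.mem_filter]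
      exact ⟨fun hy => ⟨(hinv x hx y hy).1, hy⟩, fun hy => hy.2⟩
    rw [this]
    refine Finset.sum_congr rfl fun y hy => ?_
    have hy := (Finset.mem_filter.1 hy).2
    rw [hk x hx y hy, (hinv x hx y hy).2, smul_comm]
  rw [Finset.sum_congr rfl h1, Finset.sum_comm]
  refine Finset.sum_congr rfl fun y hy => ?_
  -- Belonging to the same stopping class is symmetric because ℓ is constant on such a class.
  have h2 : ∀ x ∈ Ω, (c (ℓ x) y = c (ℓ x) x ↔ c (ℓ y) x = c (ℓ y) y) := by
    intro x hx
    constructor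
    · intro h; rw [(hinv x hx y h).2, h]
    · intro h; rw [(hinv y hy x h).2, h]
  have h3 : Ω.filter (fun x => c (ℓ x) y = c (ℓ x) x) = levelClass c (ℓ y) y := by
    ext x
    simp only [mem_levelClass, Finset.mem_filter]
    exact ⟨fun hx => (h2 x hx.1).1 hx.2, fun hx => ⟨(hinv y hy x hx).1, (h2 x (hinv y hy x hx).1).2 hx⟩⟩
  rw [← Finset.sum_filter, h3, Finset.sum_const, hcard y hy, ← Nat.cast_smul_eq_nsmul 𝕜, smul_smul]
  simp

end Stopping

/-! ### Extrapolation for convolution operators on `ℤ/2^L` -/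

section Extrapolation

variable {E : Type*} [NormedAddCommGroup E] [NormedSpace ℂ E]

/-- The operator `f ↦ ∑ y, t (x - y) f y` on a finite group. -/
def convOp {G : Type*} [AddCommGroup G] [Fintype G] (t : G → ℂ) (f : G → E) (x : G) : E :=
  ∑ y, t (x - y) • f y

theorem convOp_add {G : Type*} [AddCommGroup G] [Fintype G] (t : G → ℂ) (f g : G → E) (x : G) :
    convOp t (f + g) x = convOp t f x + convOp t g x := by
  simp [convOp, Finset.sum_add_distrib]

/-- The discrete Hörmander condition, with constant `H`, for kernels on `ℤ/2^L`. -/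
def IsHormander (L : ℕ) (t : ZMod (2 ^ L) → ℂ) (H : ℝ) : Prop :=
  ∀ l < L, ∀ v : ℕ, v < 2 ^ l →
    ∑ u ∈ Finset.univ.filter (fun u : ZMod (2 ^ L) => 2 ^ (l + 1) ≤ u.val ∧ u.val + 2 ^ l < 2 ^ L),
      ‖t (u - (v : ZMod (2 ^ L))) - t u‖ ≤ H

/-- Index of the dyadic interval of length `2^l` that contains `x`. -/
def dyadicIndex (L l : ℕ) (x : ZMod (2 ^ L)) : ℕ := x.val / 2 ^ l

instance neZero_two_pow (L : ℕ) : NeZero ((2 : ℕ) ^ L) := ⟨by positivity⟩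

theorem dyadicIndex_zero_inj (L : ℕ) (x y : ZMod (2 ^ L)) (h : dyadicIndex L 0 x = dyadicIndex L 0 y) :
    x = y := by
  simp only [dyadicIndex, pow_zero, Nat.div_one] at h
  exact ZMod.val_injective _ h

theorem dyadicIndex_succ (L l : ℕ) (x y : ZMod (2 ^ L)) (h : dyadicIndex L l x = dyadicIndex L l y) :
    dyadicIndex L (l + 1) x = dyadicIndex L (l + 1) y := by
  simp only [dyadicIndex] at *
  rw [pow_succ, ← Nat.div_div_eq_div_mul, ← Nat.div_div_eq_div_mul, h]

/-- Left endpoint of the dyadic interval of length `2^l` that contains `x`. -/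
def dyadicBase (L l : ℕ) (x : ZMod (2 ^ L)) : ZMod (2 ^ L) := ((dyadicIndex L l x * 2 ^ l : ℕ) : ZMod _)

theorem eq_dyadicBase_add (L l : ℕ) (x : ZMod (2 ^ L)) :
    x = dyadicBase L l x + ((x.val % 2 ^ l : ℕ) : ZMod (2 ^ L)) := by
  rw [dyadicBase, ← Nat.cast_add, dyadicIndex, Nat.div_add_mod', ZMod.natCast_zmod_val]

theorem dyadicIndex_base_add {L l : ℕ} (hl : l ≤ L) (x : ZMod (2 ^ L)) {v : ℕ} (hv : v < 2 ^ l) :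
    (dyadicBase L l x + (v : ZMod (2 ^ L))).val = dyadicIndex L l x * 2 ^ l + v ∧
      dyadicIndex L l (dyadicBase L l x + (v : ZMod (2 ^ L))) = dyadicIndex L l x := by
  have h1 : dyadicIndex L l x * 2 ^ l + v < 2 ^ L := by
    obtain ⟨m, rfl⟩ := Nat.exists_eq_add_of_le hl
    have h2 : dyadicIndex (l + m) l x < 2 ^ m := by
      rw [dyadicIndex, Nat.div_lt_iff_lt_mul (by positivity), ← pow_add, add_comm m l]
      exact ZMod.val_lt x
    rw [pow_add]
    nlinarith
  have h3 : (dyadicBase L l x + (v : ZMod (2 ^ L))).val = dyadicIndex L l x * 2 ^ l + v := by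
    rw [dyadicBase, ← Nat.cast_add, ZMod.val_natCast, Nat.mod_eq_of_lt h1]
  refine ⟨h3, ?_⟩
  rw [dyadicIndex, h3, mul_comm, Nat.mul_add_div (by positivity), Nat.div_eq_of_lt hv, add_zero]

theorem card_levelClass_dyadicIndex {L l : ℕ} (hl : l ≤ L) (x : ZMod (2 ^ L)) :
    (levelClass (dyadicIndex L) l x).card = 2 ^ l := by
  classical
  have : levelClass (dyadicIndex L) l x
      = (Finset.range (2 ^ l)).image fun v : ℕ => dyadicBase L l x + (v : ZMod (2 ^ L)) := by
    ext y
    simp only [mem_levelClass, Finset.mem_image, Finset.mem_range]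
    constructor
    · intro h
      refine ⟨y.val % 2 ^ l, Nat.mod_lt _ (by positivity), ?_⟩
      conv_rhs => rw [eq_dyadicBase_add L l y]
      rw [dyadicBase, dyadicBase, h]
    · rintro ⟨v, hv, rfl⟩
      exact (dyadicIndex_base_add hl x hv).2
  rw [this, Finset.card_image_of_injOn, Finset.card_range]
  intro a ha b hb hab
  simp only [Finset.coe_range, Set.mem_Iio] at ha hb
  have h1 := (dyadicIndex_base_add hl x ha).1
  have h2 := (dyadicIndex_base_add hl x hb).1
  simp only at hab
  rw [hab] at h1
  omega

end Extrapolation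
-- The weak-type estimate
section WeakType

variable {E : Type*} [NormedAddCommGroup E] [NormedSpace ℂ E]

/-- Translate the left endpoint of the interval of y to 0. Avoiding the interval and its two
neighbours then means that the residue of x lies in [2^(l+1), 2^L - 2^l), the range of the Hörmander
sum. -/
theorem sum_norm_sub_le_of_isHormander {L : ℕ} {t : ZMod (2 ^ L) → ℂ} {H : ℝ} (hH : IsHormander L t H)
    {l : ℕ} (hl : l < L) (y : ZMod (2 ^ L)) (S : Finset (ZMod (2 ^ L)))
    (hS : ∀ x ∈ S, ∀ z, dyadicIndex L l z = dyadicIndex L l y →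
      x ≠ z ∧ x ≠ z + ((2 ^ l : ℕ) : ZMod (2 ^ L)) ∧ x ≠ z - ((2 ^ l : ℕ) : ZMod (2 ^ L))) :
    ∑ x ∈ S, ‖t (x - y) - t (x - dyadicBase L l y)‖ ≤ H := by
  classical
  have hv : y.val % 2 ^ l < 2 ^ l := Nat.mod_lt _ (by positivity)
  refine le_trans ?_ (hH l hl (y.val % 2 ^ l) hv)
  have key : ∑ x ∈ S, ‖t (x - y) - t (x - dyadicBase L l y)‖
      = ∑ u ∈ S.image (fun x => x - dyadicBase L l y),
        ‖t (u - ((y.val % 2 ^ l : ℕ) : ZMod (2 ^ L))) - t u‖ := by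
    rw [Finset.sum_image fun a _ b _ h => sub_left_injective h]
    refine Finset.sum_congr rfl fun x _ => ?_
    have := eq_dyadicBase_add L l y
    congr 3
    conv_lhs => rw [this]
    exact (sub_sub _ _ _).symm
  rw [key]
  · refine Finset.sum_le_sum_of_subset_of_nonneg ?_ fun _ _ _ => norm_nonneg _
    intro u hu
    obtain ⟨x, hx, rfl⟩ := Finset.mem_image.1 hu
    have hux : x = dyadicBase L l y + ((x - dyadicBase L l y).val : ZMod (2 ^ L)) := by
      rw [ZMod.natCast_zmod_val]; abel
    generalize (x - dyadicBase L l y) = u at *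
    simp only [Finset.mem_filter, Finset.mem_univ, true_and]
    have hb := fun v (hv : v < 2 ^ l) => hS x hx _ (dyadicIndex_base_add hl.le y hv).2
    have huL := ZMod.val_lt u
    have h0 : 2 ^ l ≤ u.val := by
      by_contra! h
      exact (hb _ h).1 hux
    have h1 : 2 ^ (l + 1) ≤ u.val := by
      by_contra! h
      refine (hb (u.val - 2 ^ l) (by rw [pow_succ] at h; omega)).2.1 ?_
      rw [Nat.cast_sub h0]
      conv_lhs => rw [hux]
      abel
    refine ⟨h1, ?_⟩
    by_contra! h
    -- The left neighbour consists of the residues that wrap around: u + 2^l passes 2^L and falls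
    -- into the interval.
    refine (hb (u.val + 2 ^ l - 2 ^ L) (by omega)).2.2 ?_
    rw [Nat.cast_sub h]
    conv_lhs => rw [hux]
    rw [ZMod.natCast_self]
    push_cast
    abel

/-- Calderón–Zygmund decomposition at height lam. Small values enter with the power r and large
values with the power 1, so that integrating in lam gives the L^p bound directly, with no separate
interpolation step. -/
theorem card_lt_norm_convOp_le {L : ℕ} {t : ZMod (2 ^ L) → ℂ} {r B H : ℝ} (hr : 1 < r) (hB : 0 ≤ B)
    (hT : ∀ f : ZMod (2 ^ L) → E, ∑ x, ‖convOp t f x‖ ^ r ≤ B * ∑ x, ‖f x‖ ^ r)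
    (hH0 : 0 ≤ H) (hH : IsHormander L t H) (f : ZMod (2 ^ L) → E) {lam : ℝ} (hlam : 0 < lam) :
    ((Finset.univ.filter fun x => 2 * lam < ‖convOp t f x‖).card : ℝ) ≤
      B * (lam ^ r)⁻¹ * ∑ x ∈ Finset.univ.filter (fun x => ‖f x‖ ≤ lam), ‖f x‖ ^ r +
      (2 * (2 ^ r * B + 3) + 4 * H) * lam⁻¹ *
        ∑ x ∈ Finset.univ.filter (fun x => lam / 2 < ‖f x‖), ‖f x‖ := by
  classical
  have hBsum : 0 ≤ B * (lam ^ r)⁻¹ * ∑ x ∈ Finset.univ.filter (fun x => ‖f x‖ ≤ lam), ‖f x‖ ^ r := by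
    positivity
  set W := ∑ x ∈ Finset.univ.filter (fun x => lam / 2 < ‖f x‖), ‖f x‖ with hW
  have hW0 : 0 ≤ W := Finset.sum_nonneg fun _ _ => norm_nonneg _
  have h2r : (0 : ℝ) ≤ 2 ^ r := by positivity
  -- splitting a sum at height `lam / 2`
  have hsplit : ∀ S : Finset (ZMod (2 ^ L)), ∑ x ∈ S, ‖f x‖ ≤ W + lam / 2 * S.card := by
    intro S
    rw [← Finset.sum_filter_add_sum_filter_not S (fun x => lam / 2 < ‖f x‖)]
    refine add_le_add ?_ ?_
    · exact Finset.sum_le_sum_of_subset_of_nonneg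
        (Finset.filter_subset_filter _ (Finset.subset_univ _)) fun _ _ _ => norm_nonneg _
    · calc _ ≤ ∑ x ∈ S.filter (fun x => ¬ lam / 2 < ‖f x‖), lam / 2 :=
            Finset.sum_le_sum fun x hx => not_lt.1 (Finset.mem_filter.1 hx).2
        _ = (S.filter (fun x => ¬ lam / 2 < ‖f x‖)).card * (lam / 2) := by simp
        _ ≤ S.card * (lam / 2) := by
            gcongr
            exact Finset.filter_subset _ _
        _ = _ := by ring
  by_cases htop : ∀ x, ∑ y ∈ levelClass (dyadicIndex L) L x, ‖f y‖ ≤ lam * 2 ^ L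
  swap
  -- A class at the top level is already too heavy. Then the right side exceeds the order 2^L of the
  -- group and the estimate is trivial.
  · push Not at htop
    obtain ⟨x, hx⟩ := htop
    have h1 : lam * 2 ^ L ≤ ∑ y, ‖f y‖ := hx.le.trans
      (Finset.sum_le_sum_of_subset_of_nonneg (Finset.subset_univ _) fun _ _ _ => norm_nonneg _)
    have h2 := hsplit Finset.univ
    have hc : ((Finset.univ : Finset (ZMod (2 ^ L))).card : ℝ) = 2 ^ L := by
      simp [ZMod.card]
    rw [hc] at h2
    have h3 : ((Finset.univ.filter fun x => 2 * lam < ‖convOp t f x‖).card : ℝ) ≤ 2 ^ L := by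
      rw [← hc]
      exact_mod_cast Finset.card_le_card (Finset.filter_subset _ _)
    have h4 : (2 : ℝ) ^ L ≤ 2 * lam⁻¹ * W := by
      have : lam * 2 ^ L ≤ 2 * W := by linarith
      rw [show 2 * lam⁻¹ * W = (2 * W) / lam by field_simp, le_div_iff₀ hlam]
      linarith
    have h5 : 2 * lam⁻¹ * W ≤ (2 * (2 ^ r * B + 3) + 4 * H) * lam⁻¹ * W := by
      have : 0 ≤ 2 ^ r * B := by positivity
      gcongr
      linarith
    linarith
  obtain ⟨Ω, ℓ, hoff, hinv, hlow, hup, hlt⟩ := exists_stopping (dyadicIndex L) L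
    (dyadicIndex_zero_inj L) (dyadicIndex_succ L) (fun x => ‖f x‖) (fun _ => norm_nonneg _) lam htop
  have hcard : ∀ x ∈ Ω, (levelClass (dyadicIndex L) (ℓ x) x).card = 2 ^ (ℓ x) := fun x hx =>
    card_levelClass_dyadicIndex (hlt x hx).le x
  have hpow : ∀ x, (0 : ℝ) < 2 ^ (ℓ x) := fun x => by positivity
  have hsum := sum_smul_classAvg (𝕜 := ℝ) (dyadicIndex L) ℓ Ω hinv hcard (fun _ => 1)
    (fun _ _ _ _ => rfl) (fun x => ‖f x‖)
  simp only [one_smul] at hsum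
  -- size of `Ω`
  have hΩ1 : lam * Ω.card ≤ ∑ x ∈ Ω, ‖f x‖ := by
    rw [← hsum]
    calc lam * (Ω.card : ℝ) = ∑ x ∈ Ω, lam := by simp [mul_comm]
      _ ≤ _ := Finset.sum_le_sum fun x hx => by
          rw [classAvg, smul_eq_mul, inv_mul_eq_div, le_div_iff₀ (hpow x)]
          exact (hlow x hx).le
  have hΩ2 := hsplit Ω
  -- Absorption: lam · #Ω is at most the sum over Ω, so values below lam / 2 contribute at most half
  -- of that sum.
  have hΩW : ∑ x ∈ Ω, ‖f x‖ ≤ 2 * W := by linarith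
  have hΩc : (Ω.card : ℝ) ≤ 2 * lam⁻¹ * W := by
    rw [show 2 * lam⁻¹ * W = (2 * W) / lam by field_simp, le_div_iff₀ hlam]
    linarith
  -- the good and the bad part
  set g : ZMod (2 ^ L) → E := fun x =>
    if x ∈ Ω then classAvg ℂ (dyadicIndex L) ℓ f x else f x with hg
  set b : ZMod (2 ^ L) → E := fun x =>
    if x ∈ Ω then f x - classAvg ℂ (dyadicIndex L) ℓ f x else 0 with hb
  have hfg : f = g + b := by
    funext x
    simp only [hg, hb, Pi.add_apply]
    split_ifs <;> abel
  have havg : ∀ x, ‖classAvg ℂ (dyadicIndex L) ℓ f x‖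
      ≤ classAvg ℝ (dyadicIndex L) ℓ (fun x => ‖f x‖) x := by
    intro x
    rw [classAvg, classAvg, norm_smul, smul_eq_mul, norm_inv, norm_pow]
    simp only [RCLike.norm_ofNat]
    gcongr
    exact norm_sum_le _ _
  have hgΩ : ∀ x ∈ Ω, ‖g x‖ ≤ 2 * lam := by
    intro x hx
    simp only [hg, if_pos hx]
    refine (havg x).trans ?_
    rw [classAvg, smul_eq_mul, inv_mul_eq_div, div_le_iff₀ (hpow x)]
    exact hup x hx
  have hgsum : ∑ x, ‖g x‖ ^ r ≤
      ∑ x ∈ Finset.univ.filter (fun x => ‖f x‖ ≤ lam), ‖f x‖ ^ r + (2 * lam) ^ r * Ω.card := by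
    rw [← Finset.sum_filter_add_sum_filter_not Finset.univ (fun x => x ∉ Ω)]
    refine add_le_add ?_ ?_
    · calc _ = ∑ x ∈ Finset.univ.filter (fun x => x ∉ Ω), ‖f x‖ ^ r :=
            Finset.sum_congr rfl fun x hx => by
              simp only [hg, if_neg (Finset.mem_filter.1 hx).2]
        _ ≤ _ := by
            refine Finset.sum_le_sum_of_subset_of_nonneg ?_ fun _ _ _ => by positivity
            intro x hx
            exact Finset.mem_filter.2 ⟨Finset.mem_univ _, hoff x (Finset.mem_filter.1 hx).2⟩
    · calc _ ≤ ∑ x ∈ Finset.univ.filter (fun x => ¬ x ∉ Ω), (2 * lam) ^ r :=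
            Finset.sum_le_sum fun x hx => by
              have := hgΩ x (not_not.1 (Finset.mem_filter.1 hx).2)
              gcongr
        _ = _ := by simp [mul_comm]
  have hgood : ((Finset.univ.filter fun x => lam < ‖convOp t g x‖).card : ℝ) ≤
      B * (lam ^ r)⁻¹ * ∑ x ∈ Finset.univ.filter (fun x => ‖f x‖ ≤ lam), ‖f x‖ ^ r
        + B * 2 ^ r * Ω.card := by
    have h1 : lam ^ r * ((Finset.univ.filter fun x => lam < ‖convOp t g x‖).card : ℝ)
        ≤ ∑ x, ‖convOp t g x‖ ^ r := by
      calc _ = ∑ x ∈ Finset.univ.filter (fun x => lam < ‖convOp t g x‖), lam ^ r := by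
            simp [mul_comm]
        _ ≤ ∑ x ∈ Finset.univ.filter (fun x => lam < ‖convOp t g x‖), ‖convOp t g x‖ ^ r :=
            Finset.sum_le_sum fun x hx => by
              have := (Finset.mem_filter.1 hx).2
              gcongr
        _ ≤ _ := Finset.sum_le_sum_of_subset_of_nonneg (Finset.subset_univ _)
              fun _ _ _ => by positivity
    have h2 := h1.trans ((hT g).trans (mul_le_mul_of_nonneg_left hgsum hB))
    have hlr : 0 < lam ^ r := by positivity
    rw [Real.mul_rpow (by norm_num) hlam.le] at h2
    rw [← mul_le_mul_iff_right₀ hlr]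
    have aux : ∀ q S c d : ℝ, 0 < q → B * (S + d * q * c) = q * (B * q⁻¹ * S + B * d * c) := by
      intro q S c d hq
      field_simp
    exact h2.trans (le_of_eq (aux _ _ _ _ hlr))
  -- the enlarged set
  set Ω' : Finset (ZMod (2 ^ L)) := Ω ∪ Ω.image (fun y => y + ((2 ^ ℓ y : ℕ) : ZMod (2 ^ L))) ∪
    Ω.image (fun y => y - ((2 ^ ℓ y : ℕ) : ZMod (2 ^ L))) with hΩ'
  have hΩ'c : (Ω'.card : ℝ) ≤ 3 * Ω.card := by
    have : Ω'.card ≤ 3 * Ω.card := by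
      refine (Finset.card_union_le _ _).trans ?_
      have h1 := Finset.card_union_le Ω (Ω.image (fun y => y + ((2 ^ ℓ y : ℕ) : ZMod (2 ^ L))))
      have h2 := Finset.card_image_le (s := Ω) (f := fun y => y + ((2 ^ ℓ y : ℕ) : ZMod (2 ^ L)))
      have h3 := Finset.card_image_le (s := Ω) (f := fun y => y - ((2 ^ ℓ y : ℕ) : ZMod (2 ^ L)))
      omega
    exact_mod_cast this
  have hTb : ∀ x, convOp t b x
      = ∑ y ∈ Ω, (t (x - y) - t (x - dyadicBase L (ℓ y) y)) • b y := by
    intro x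
    have h1 : convOp t b x = ∑ y ∈ Ω, t (x - y) • b y := by
      rw [convOp]
      symm
      refine Finset.sum_subset (Finset.subset_univ _) fun y _ hy => ?_
      simp only [hb, if_neg hy, smul_zero]
    -- The bad part has mean zero on each stopping class, and all points of a class share one left
    -- endpoint.
    have h2 : ∑ y ∈ Ω, t (x - dyadicBase L (ℓ y) y) • b y = 0 := by
      have := sum_smul_classAvg (𝕜 := ℂ) (dyadicIndex L) ℓ Ω hinv hcard
        (fun y => t (x - dyadicBase L (ℓ y) y))
        (fun y hy z hz => by
          simp only [(hinv y hy z hz).2, dyadicBase, hz]) f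
      rw [← sub_eq_zero.2 this.symm, ← Finset.sum_sub_distrib]
      refine Finset.sum_congr rfl fun y hy => ?_
      simp only [hb, if_pos hy, smul_sub]
    rw [h1, ← sub_zero (∑ y ∈ Ω, t (x - y) • b y), ← h2, ← Finset.sum_sub_distrib]
    exact Finset.sum_congr rfl fun y _ => (sub_smul _ _ _).symm
  have hbsum : ∑ y ∈ Ω, ‖b y‖ ≤ 2 * ∑ x ∈ Ω, ‖f x‖ := by
    calc ∑ y ∈ Ω, ‖b y‖ ≤ ∑ y ∈ Ω, (‖f y‖ + classAvg ℝ (dyadicIndex L) ℓ (fun x => ‖f x‖) y) :=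
          Finset.sum_le_sum fun y hy => by
            simp only [hb, if_pos hy]
            exact (norm_sub_le _ _).trans (add_le_add le_rfl (havg y))
      _ = _ := by rw [Finset.sum_add_distrib, hsum]; ring
  have hbad1 : ∑ x ∈ Finset.univ.filter (fun x => x ∉ Ω'), ‖convOp t b x‖ ≤ H * (4 * W) := by
    calc _ ≤ ∑ x ∈ Finset.univ.filter (fun x => x ∉ Ω'), ∑ y ∈ Ω,
            ‖t (x - y) - t (x - dyadicBase L (ℓ y) y)‖ * ‖b y‖ :=
          Finset.sum_le_sum fun x _ => by
            rw [hTb x]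
            refine (norm_sum_le _ _).trans (le_of_eq ?_)
            simp only [norm_smul]
      _ = ∑ y ∈ Ω, (∑ x ∈ Finset.univ.filter (fun x => x ∉ Ω'),
            ‖t (x - y) - t (x - dyadicBase L (ℓ y) y)‖) * ‖b y‖ := by
          rw [Finset.sum_comm]
          simp only [Finset.sum_mul]
      _ ≤ ∑ y ∈ Ω, H * ‖b y‖ := Finset.sum_le_sum fun y hy => by
          refine mul_le_mul_of_nonneg_right ?_ (norm_nonneg _)
          refine sum_norm_sub_le_of_isHormander hH (hlt y hy) y _ fun x hx z hz => ?_
          have hx := (Finset.mem_filter.1 hx).2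
          simp only [hΩ', Finset.mem_union, Finset.mem_image, not_or, not_exists, not_and] at hx
          obtain ⟨hzΩ, hzl⟩ := hinv y hy z hz
          refine ⟨fun h => hx.1.1 (h ▸ hzΩ), fun h => hx.1.2 z hzΩ ?_, fun h => hx.2 z hzΩ ?_⟩
          · rw [hzl, h]
          · rw [hzl, h]
      _ = H * ∑ y ∈ Ω, ‖b y‖ := by rw [Finset.mul_sum]
      _ ≤ H * (4 * W) := by gcongr; linarith
  have hbad : ((Finset.univ.filter fun x => x ∉ Ω' ∧ lam < ‖convOp t b x‖).card : ℝ) ≤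
      4 * H * lam⁻¹ * W := by
    have h1 : lam * ((Finset.univ.filter fun x => x ∉ Ω' ∧ lam < ‖convOp t b x‖).card : ℝ)
        ≤ H * (4 * W) := by
      refine le_trans ?_ hbad1
      calc _ = ∑ x ∈ Finset.univ.filter (fun x => x ∉ Ω' ∧ lam < ‖convOp t b x‖), lam := by
            simp [mul_comm]
        _ ≤ ∑ x ∈ Finset.univ.filter (fun x => x ∉ Ω' ∧ lam < ‖convOp t b x‖), ‖convOp t b x‖ :=
            Finset.sum_le_sum fun x hx => (Finset.mem_filter.1 hx).2.2.le
        _ ≤ _ := by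
            refine Finset.sum_le_sum_of_subset_of_nonneg ?_ fun _ _ _ => norm_nonneg _
            intro x hx
            exact Finset.mem_filter.2 ⟨Finset.mem_univ _, (Finset.mem_filter.1 hx).2.1⟩
    rw [show 4 * H * lam⁻¹ * W = (H * (4 * W)) / lam by field_simp, le_div_iff₀ hlam]
    linarith
  have hsub : (Finset.univ.filter fun x => 2 * lam < ‖convOp t f x‖) ⊆
      (Finset.univ.filter fun x => lam < ‖convOp t g x‖) ∪ Ω' ∪
      (Finset.univ.filter fun x => x ∉ Ω' ∧ lam < ‖convOp t b x‖) := by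
    intro x hx
    have hx := (Finset.mem_filter.1 hx).2
    rw [hfg, convOp_add] at hx
    simp only [Finset.mem_union, Finset.mem_filter, Finset.mem_univ, true_and]
    by_contra! hcon
    have h1 := hcon.1.1
    have h2 := hcon.2 hcon.1.2
    have := norm_add_le (convOp t g x) (convOp t b x)
    linarith
  have htot : ((Finset.univ.filter fun x => 2 * lam < ‖convOp t f x‖).card : ℝ) ≤
      (Finset.univ.filter fun x => lam < ‖convOp t g x‖).card + Ω'.card +
      (Finset.univ.filter fun x => x ∉ Ω' ∧ lam < ‖convOp t b x‖).card := by
    have h1 := Finset.card_le_card hsub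
    have h2 := (Finset.card_union_le ((Finset.univ.filter fun x => lam < ‖convOp t g x‖) ∪ Ω')
      (Finset.univ.filter fun x => x ∉ Ω' ∧ lam < ‖convOp t b x‖))
    have h3 := Finset.card_union_le (Finset.univ.filter fun x => lam < ‖convOp t g x‖) Ω'
    exact_mod_cast h1.trans (h2.trans (Nat.add_le_add_right h3 _))
  -- B · 2^r comes from the good part, at most 2 lam on Ω, and 3 from the enlarged set.
  have hfin : (B * 2 ^ r + 3) * (Ω.card : ℝ) ≤ (B * 2 ^ r + 3) * (2 * lam⁻¹ * W) := by gcongr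
  have hring : (2 * (2 ^ r * B + 3) + 4 * H) * lam⁻¹ * W
      = (B * 2 ^ r + 3) * (2 * lam⁻¹ * W) + 4 * H * lam⁻¹ * W := by ring
  rw [hring]
  linarith

end WeakType
-- Integration over levels
section LayerCake
open MeasureTheory Set

theorem lintegral_ite_lt_rpow {p τ : ℝ} (hp : 0 < p) (hτ : 0 ≤ τ) :
    ∫⁻ lam in Ioi (0 : ℝ), (if lam < τ then ENNReal.ofReal (lam ^ (p - 1)) else 0)
      = ENNReal.ofReal (τ ^ p / p) := by
  have h1 : ∫⁻ lam in Ioi (0 : ℝ), (if lam < τ then ENNReal.ofReal (lam ^ (p - 1)) else 0)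
      = ∫⁻ lam in Ioo (0 : ℝ) τ, ENNReal.ofReal (lam ^ (p - 1)) := by
    rw [← lintegral_indicator measurableSet_Ioi, ← lintegral_indicator measurableSet_Ioo]
    congr 1
    ext x
    by_cases h0 : 0 < x <;> by_cases h1 : x < τ <;> simp [h0, h1, indicator]
  have hi : IntervalIntegrable (fun x : ℝ => x ^ (p - 1)) volume 0 τ :=
    intervalIntegral.intervalIntegrable_rpow' (by linarith)
  rw [h1, ← ofReal_integral_eq_lintegral_ofReal]
  · rw [← integral_Ioc_eq_integral_Ioo, ← intervalIntegral.integral_of_le hτ,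
      integral_rpow (Or.inl (by linarith))]
    rw [sub_add_cancel, Real.zero_rpow hp.ne', sub_zero]
  · exact ((intervalIntegrable_iff_integrableOn_Ioo_of_le hτ).1 hi)
  · filter_upwards [ae_restrict_mem measurableSet_Ioo] with x hx
    exact Real.rpow_nonneg hx.1.le _

theorem lintegral_ite_le_rpow {p r w : ℝ} (hp : 0 < p) (hpr : p < r) (hw : 0 ≤ w) :
    ∫⁻ lam in Ioi (0 : ℝ), (if w ≤ lam then ENNReal.ofReal (lam ^ (p - 1 - r) * w ^ r) else 0)
      = ENNReal.ofReal (w ^ p / (r - p)) := by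
  rcases hw.eq_or_lt with rfl | hw
  · simp [Real.zero_rpow hp.ne', Real.zero_rpow (hp.trans hpr).ne']
  have h1 : ∫⁻ lam in Ioi (0 : ℝ), (if w ≤ lam then ENNReal.ofReal (lam ^ (p - 1 - r) * w ^ r) else 0)
      = ∫⁻ lam in Ici w, ENNReal.ofReal (lam ^ (p - 1 - r) * w ^ r) := by
    rw [← lintegral_indicator measurableSet_Ioi, ← lintegral_indicator measurableSet_Ici]
    congr 1
    ext x
    by_cases h1 : w ≤ x
    · simp [h1, indicator, hw.trans_le h1]
    · simp [h1, indicator]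
  rw [h1, setLIntegral_congr Ioi_ae_eq_Ici.symm, ← ofReal_integral_eq_lintegral_ofReal]
  · rw [integral_mul_const, integral_Ioi_rpow_of_lt (by linarith) hw]
    congr 1
    rw [show p - 1 - r + 1 = p - r by ring, Real.rpow_sub hw]
    have : p - r ≠ 0 := by linarith
    have : r - p ≠ 0 := by linarith
    have : w ^ r ≠ 0 := by positivity
    field_simp
    ring
  · exact (integrableOn_Ioi_rpow_of_lt (by linarith) hw).mul_const _
  · filter_upwards [ae_restrict_mem measurableSet_Ioi] with x hx
    have : 0 < x := hw.trans hx
    positivity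

/-- Multiply the level-set inequality by lam^(p-1) and integrate. The part with power r converges at
infinity because p < r, the part with power 1 converges at zero because p > 1. -/
theorem sum_rpow_le_of_card_le {X : Type*} [Fintype X] {p r a b : ℝ} (hp : 1 < p) (hpr : p < r)
    (ha : 0 ≤ a) (hb : 0 ≤ b) (τ w : X → ℝ) (hτ : ∀ x, 0 ≤ τ x) (hw : ∀ x, 0 ≤ w x)
    (h : ∀ lam : ℝ, 0 < lam → ((Finset.univ.filter fun x => lam < τ x).card : ℝ) ≤
      a * (lam ^ r)⁻¹ * ∑ x ∈ Finset.univ.filter (fun x => w x ≤ lam), w x ^ r +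
      b * lam⁻¹ * ∑ x ∈ Finset.univ.filter (fun x => lam / 2 < w x), w x) :
    ∑ x, τ x ^ p ≤ p * (a / (r - p) + b * 2 ^ (p - 1) / (p - 1)) * ∑ x, w x ^ p := by
  have hp0 : 0 < p := by linarith
  have hp1 : 0 < p - 1 := by linarith
  have hrp : 0 < r - p := by linarith
  have key : ∑ x, ENNReal.ofReal (τ x ^ p / p) ≤
      ∑ x, (ENNReal.ofReal a * ENNReal.ofReal (w x ^ p / (r - p)) +
        ENNReal.ofReal (b * w x) * ENNReal.ofReal ((2 * w x) ^ (p - 1) / (p - 1))) := by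
    have e1 : ∀ x, ENNReal.ofReal (τ x ^ p / p) =
        ∫⁻ lam in Ioi (0 : ℝ), (if lam < τ x then ENNReal.ofReal (lam ^ (p - 1)) else 0) :=
      fun x => (lintegral_ite_lt_rpow hp0 (hτ x)).symm
    have e2 : ∀ x, ENNReal.ofReal (w x ^ p / (r - p)) = ∫⁻ lam in Ioi (0 : ℝ),
        (if w x ≤ lam then ENNReal.ofReal (lam ^ (p - 1 - r) * w x ^ r) else 0) :=
      fun x => (lintegral_ite_le_rpow hp0 hpr (hw x)).symm
    have e3 : ∀ x, ENNReal.ofReal ((2 * w x) ^ (p - 1) / (p - 1)) =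
        ∫⁻ lam in Ioi (0 : ℝ), (if lam < 2 * w x then ENNReal.ofReal (lam ^ (p - 1 - 1)) else 0) :=
      fun x => (lintegral_ite_lt_rpow hp1 (by linarith [hw x])).symm
    have m1 : ∀ x, Measurable fun lam : ℝ =>
        (if lam < τ x then ENNReal.ofReal (lam ^ (p - 1)) else 0) := fun x =>
      Measurable.ite measurableSet_Iio (by fun_prop) measurable_const
    have m2 : ∀ x, Measurable fun lam : ℝ =>
        (if w x ≤ lam then ENNReal.ofReal (lam ^ (p - 1 - r) * w x ^ r) else 0) := fun x =>
      Measurable.ite measurableSet_Ici (by fun_prop) measurable_const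
    have m3 : ∀ x, Measurable fun lam : ℝ =>
        (if lam < 2 * w x then ENNReal.ofReal (lam ^ (p - 1 - 1)) else 0) := fun x =>
      Measurable.ite measurableSet_Iio (by fun_prop) measurable_const
    have e4 : ∀ x, ENNReal.ofReal a * ENNReal.ofReal (w x ^ p / (r - p)) +
        ENNReal.ofReal (b * w x) * ENNReal.ofReal ((2 * w x) ^ (p - 1) / (p - 1)) =
        ∫⁻ lam in Ioi (0 : ℝ), (ENNReal.ofReal a *
          (if w x ≤ lam then ENNReal.ofReal (lam ^ (p - 1 - r) * w x ^ r) else 0) +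
          ENNReal.ofReal (b * w x) *
          (if lam < 2 * w x then ENNReal.ofReal (lam ^ (p - 1 - 1)) else 0)) := by
      intro x
      rw [e2, e3, lintegral_add_left ((m2 x).const_mul _), lintegral_const_mul _ (m2 x),
        lintegral_const_mul _ (m3 x)]
    simp only [e4, e1]
    rw [← lintegral_finsetSum _ fun x _ => m1 x]
    have m4 : ∀ x, Measurable fun lam : ℝ => ENNReal.ofReal a *
          (if w x ≤ lam then ENNReal.ofReal (lam ^ (p - 1 - r) * w x ^ r) else 0) +
          ENNReal.ofReal (b * w x) *
          (if lam < 2 * w x then ENNReal.ofReal (lam ^ (p - 1 - 1)) else 0) := fun x =>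
      ((m2 x).const_mul _).add ((m3 x).const_mul _)
    rw [← lintegral_finsetSum _ fun x _ => m4 x]
    refine setLIntegral_mono' measurableSet_Ioi fun lam hlam => ?_
    have hlam : 0 < lam := hlam
    have hl := h lam hlam
    have q1 : ∑ x, (if lam < τ x then ENNReal.ofReal (lam ^ (p - 1)) else 0)
        = ENNReal.ofReal (lam ^ (p - 1) * (Finset.univ.filter fun x => lam < τ x).card) := by
      rw [← Finset.sum_filter, Finset.sum_const, nsmul_eq_mul, mul_comm,
        ENNReal.ofReal_mul (by positivity), ENNReal.ofReal_natCast]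
    have q2 : ∑ x, ENNReal.ofReal a *
        (if w x ≤ lam then ENNReal.ofReal (lam ^ (p - 1 - r) * w x ^ r) else 0)
        = ENNReal.ofReal (a * lam ^ (p - 1 - r) *
          ∑ x ∈ Finset.univ.filter (fun x => w x ≤ lam), w x ^ r) := by
      rw [← Finset.mul_sum, ← Finset.sum_filter, ← ENNReal.ofReal_sum_of_nonneg,
        ← ENNReal.ofReal_mul ha, ← Finset.mul_sum, mul_assoc]
      intro x _
      have := hw x
      positivity
    have q3 : ∑ x, ENNReal.ofReal (b * w x) *
        (if lam < 2 * w x then ENNReal.ofReal (lam ^ (p - 1 - 1)) else 0)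
        = ENNReal.ofReal (b * lam ^ (p - 1 - 1) *
          ∑ x ∈ Finset.univ.filter (fun x => lam / 2 < w x), w x) := by
      have : (Finset.univ.filter fun x => lam / 2 < w x)
          = Finset.univ.filter fun x => lam < 2 * w x := by
        ext x
        simp only [Finset.mem_filter, Finset.mem_univ, true_and]
        constructor <;> intro h <;> linarith
      simp_rw [mul_ite, mul_zero]
      rw [← Finset.sum_filter, this, Finset.mul_sum, ENNReal.ofReal_sum_of_nonneg]
      · refine Finset.sum_congr rfl fun x _ => ?_
        rw [← ENNReal.ofReal_mul (mul_nonneg hb (hw x))]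
        congr 1
        ring
      · intro x _
        have := hw x
        positivity
    rw [q1, Finset.sum_add_distrib, q2, q3, ← ENNReal.ofReal_add]
    · apply ENNReal.ofReal_le_ofReal
      refine (mul_le_mul_of_nonneg_left hl (by positivity)).trans (le_of_eq ?_)
      rw [Real.rpow_sub hlam (p - 1) r, Real.rpow_sub hlam (p - 1) 1, Real.rpow_one]
      ring
    · exact mul_nonneg (by positivity) (Finset.sum_nonneg fun x _ => Real.rpow_nonneg (hw x) _)
    · exact mul_nonneg (by positivity) (Finset.sum_nonneg fun x _ => hw x)
  have key2 : ∑ x, ENNReal.ofReal (τ x ^ p / p) = ENNReal.ofReal ((∑ x, τ x ^ p) / p) := by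
    rw [← ENNReal.ofReal_sum_of_nonneg fun x _ => by have := hτ x; positivity, Finset.sum_div]
  have key3 : ∑ x, (ENNReal.ofReal a * ENNReal.ofReal (w x ^ p / (r - p)) +
        ENNReal.ofReal (b * w x) * ENNReal.ofReal ((2 * w x) ^ (p - 1) / (p - 1)))
      = ENNReal.ofReal ((a / (r - p) + b * 2 ^ (p - 1) / (p - 1)) * ∑ x, w x ^ p) := by
    rw [Finset.mul_sum, ENNReal.ofReal_sum_of_nonneg]
    · refine Finset.sum_congr rfl fun x _ => ?_
      have hx := hw x
      rw [← ENNReal.ofReal_mul ha, ← ENNReal.ofReal_mul (mul_nonneg hb hx),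
        ← ENNReal.ofReal_add (by positivity) (by positivity)]
      congr 1
      have : w x ^ p = w x * w x ^ (p - 1) := by
        rcases hx.eq_or_lt with h0 | h0
        · rw [← h0, Real.zero_rpow hp0.ne', zero_mul]
        · rw [Real.rpow_sub h0, Real.rpow_one]; field_simp
      rw [Real.mul_rpow (by norm_num) hx, this]
      field_simp
    · intro x _
      have := hw x
      positivity
  rw [key2, key3, ENNReal.ofReal_le_ofReal_iff, div_le_iff₀ hp0] at key
  · linarith
  · exact mul_nonneg (by positivity) (Finset.sum_nonneg fun x _ => Real.rpow_nonneg (hw x) _)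

/-- K is chosen before L and t. This uniformity is what survives the passage to the circle. -/
theorem exists_sum_rpow_convOp_le_of_lt {E : Type*} [NormedAddCommGroup E] [NormedSpace ℂ E]
    {p r B H : ℝ} (hp : 1 < p) (hpr : p < r) (hB : 0 ≤ B) (hH0 : 0 ≤ H) :
    ∃ K : ℝ, 0 ≤ K ∧ ∀ (L : ℕ) (t : ZMod (2 ^ L) → ℂ), IsHormander L t H →
      (∀ f : ZMod (2 ^ L) → E, ∑ x, ‖convOp t f x‖ ^ r ≤ B * ∑ x, ‖f x‖ ^ r) →
      ∀ f : ZMod (2 ^ L) → E, ∑ x, ‖convOp t f x‖ ^ p ≤ K * ∑ x, ‖f x‖ ^ p := by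
  have hp1 : 0 < p - 1 := by linarith
  have hrp : 0 < r - p := by linarith
  have hp0 : 0 < p := by linarith
  refine ⟨2 ^ p * (p * (B / (r - p) + (2 * (2 ^ r * B + 3) + 4 * H) * 2 ^ (p - 1) / (p - 1))),
    by positivity, fun L t hH hT f => ?_⟩
  have h := sum_rpow_le_of_card_le hp hpr hB (b := 2 * (2 ^ r * B + 3) + 4 * H) (by positivity)
    -- Halving matches the threshold 2 * lam of the weak-type estimate; the factor 2^p in K undoes
    -- it.
    (fun x => ‖convOp t f x‖ / 2) (fun x => ‖f x‖) (fun x => by positivity) (fun x => norm_nonneg _)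
    (fun lam hlam => by
      have h1 := card_lt_norm_convOp_le (hp.trans hpr) hB hT hH0 hH f hlam
      have h2 : (Finset.univ.filter fun x => lam < ‖convOp t f x‖ / 2)
          = Finset.univ.filter fun x => 2 * lam < ‖convOp t f x‖ := by
        ext x
        simp only [Finset.mem_filter, Finset.mem_univ, true_and]
        constructor <;> intro h <;> linarith
      rw [h2]
      exact h1)
  have h3 : ∑ x, ‖convOp t f x‖ ^ p = 2 ^ p * ∑ x, (‖convOp t f x‖ / 2) ^ p := by
    rw [Finset.mul_sum]
    refine Finset.sum_congr rfl fun x _ => ?_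
    rw [Real.div_rpow (norm_nonneg _) (by norm_num)]
    field_simp
  rw [h3, mul_assoc]
  gcongr

end LayerCake
-- Duality and exponents above r
section Duality

/-- The norm of a functional need not be attained, hence the loss of a factor 2. A rotation makes
the value real. -/
theorem exists_norming_vector {E : Type*} [NormedAddCommGroup E] [NormedSpace ℂ E]
    (Ψ : StrongDual ℂ E) : ∃ e : E, ‖e‖ ≤ 1 ∧ ∃ c : ℝ, Ψ e = c ∧ ‖Ψ‖ / 2 ≤ c := by
  by_cases h : ‖Ψ‖ = 0
  · exact ⟨0, by simp, 0, by simp, by simp [h]⟩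
  have hpos : 0 < ‖Ψ‖ := lt_of_le_of_ne (norm_nonneg _) (Ne.symm h)
  obtain ⟨x, hx, hlt⟩ := Ψ.exists_lt_apply_of_lt_opNorm (half_lt_self hpos)
  have hne : (‖Ψ x‖ : ℂ) ≠ 0 := by
    have : (0 : ℝ) < ‖Ψ x‖ := (half_pos hpos).trans hlt
    exact_mod_cast this.ne'
  have hne' : Ψ x ≠ 0 := by
    intro h0; rw [h0] at hne; simp at hne
  refine ⟨((‖Ψ x‖ : ℂ) / Ψ x) • x, ?_, ‖Ψ x‖, ?_, hlt.le⟩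
  · rw [norm_smul, norm_div, Complex.norm_real, norm_norm,
      div_self (by simpa using hne), one_mul]
    exact hx.le
  · rw [map_smul, smul_eq_mul, div_mul_cancel₀ _ hne']

/-- The transpose of convolution with t is convolution with the reflected kernel. Its output Ψ is
tested on ‖Ψ‖^(r'-1) times almost norming vectors, and Hölder is applied after moving the operator
to the test function. Since all sums are finite, no hypothesis on the dual of E is involved. -/
theorem sum_rpow_convOp_dual_le {G : Type*} [AddCommGroup G] [Fintype G] {E : Type*}
    [NormedAddCommGroup E] [NormedSpace ℂ E] {t : G → ℂ} {r r' B : ℝ} (hr : r.HolderConjugate r')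
    (hB : 0 ≤ B) (hT : ∀ f : G → E, ∑ x, ‖convOp t f x‖ ^ r ≤ B * ∑ x, ‖f x‖ ^ r)
    (ψ : G → StrongDual ℂ E) :
    ∑ x, ‖convOp (fun u => t (-u)) ψ x‖ ^ r' ≤ (2 * B ^ (1 / r)) ^ r' * ∑ x, ‖ψ x‖ ^ r' := by
  have hr0 : 0 < r := hr.pos
  have hr0' : 0 < r' := hr.symm.pos
  set Ψ := convOp (fun u => t (-u)) ψ with hΨ
  choose e he c hc hce using fun x => exists_norming_vector (Ψ x)
  set a : G → E := fun x => ((‖Ψ x‖ ^ (r' - 1) : ℝ) : ℂ) • e x with ha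
  set S := ∑ x, ‖Ψ x‖ ^ r' with hS
  set P := ∑ x, ‖ψ x‖ ^ r' with hP
  have hS0 : 0 ≤ S := Finset.sum_nonneg fun x _ => by positivity
  have hP0 : 0 ≤ P := Finset.sum_nonneg fun x _ => by positivity
  have hpair : ∑ x, Ψ x (a x) = ∑ y, ψ y (convOp t a y) := by
    simp only [hΨ, convOp, sum_apply, map_sum, map_smul]
    rw [Finset.sum_comm]
    refine Finset.sum_congr rfl fun y _ => Finset.sum_congr rfl fun x _ => ?_
    simp
  have hlow : S / 2 ≤ ‖∑ x, Ψ x (a x)‖ := by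
    have h1 : ∑ x, Ψ x (a x) = ((∑ x, ‖Ψ x‖ ^ (r' - 1) * c x : ℝ) : ℂ) := by
      push_cast
      refine Finset.sum_congr rfl fun x _ => ?_
      simp only [ha, map_smul, hc, smul_eq_mul]
    rw [h1, Complex.norm_real, hS, Finset.sum_div]
    refine le_trans (Finset.sum_le_sum fun x _ => ?_) (le_abs_self _)
    calc ‖Ψ x‖ ^ r' / 2 = ‖Ψ x‖ ^ (r' - 1) * (‖Ψ x‖ / 2) := by
          rcases (norm_nonneg (Ψ x)).eq_or_lt with h0 | h0
          · rw [← h0, Real.zero_rpow hr0'.ne']; simp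
          · rw [Real.rpow_sub h0, Real.rpow_one]; field_simp
      _ ≤ _ := mul_le_mul_of_nonneg_left (hce x) (by positivity)
  have haS : ∑ x, ‖a x‖ ^ r ≤ S := by
    refine Finset.sum_le_sum fun x _ => ?_
    have h1 : ‖a x‖ ≤ ‖Ψ x‖ ^ (r' - 1) := by
      rw [ha]
      simp only [norm_smul, Complex.norm_real, Real.norm_eq_abs]
      rw [abs_of_nonneg (by positivity)]
      exact mul_le_of_le_one_right (by positivity) (he x)
    calc ‖a x‖ ^ r ≤ (‖Ψ x‖ ^ (r' - 1)) ^ r := by gcongr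
      _ = ‖Ψ x‖ ^ r' := by rw [← Real.rpow_mul (norm_nonneg _), hr.symm.sub_one_mul_conj]
  have hup : ‖∑ y, ψ y (convOp t a y)‖ ≤ P ^ (1 / r') * (B * S) ^ (1 / r) := by
    calc _ ≤ ∑ y, ‖ψ y‖ * ‖convOp t a y‖ :=
          (norm_sum_le _ _).trans (Finset.sum_le_sum fun y _ => (ψ y).le_opNorm _)
      _ ≤ _ := Real.inner_le_Lp_mul_Lq Finset.univ (fun y => ‖ψ y‖) (fun y => ‖convOp t a y‖) hr.symm
      _ ≤ _ := by
          simp only [abs_norm]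
          have := (hT a).trans (mul_le_mul_of_nonneg_left haS hB)
          gcongr
  have hmain : S / 2 ≤ P ^ (1 / r') * (B * S) ^ (1 / r) := hlow.trans (hpair ▸ hup)
  rcases hS0.eq_or_lt with h0 | h0
  · rw [← h0]; positivity
  have hsplit : S = S ^ (1 / r) * S ^ (1 / r') := by
    rw [← Real.rpow_add h0, one_div, one_div, hr.inv_add_inv_eq_one, Real.rpow_one]
  rw [Real.mul_rpow hB hS0] at hmain
  have h1 : S ^ (1 / r') ≤ 2 * B ^ (1 / r) * P ^ (1 / r') := by
    have hpos : 0 < S ^ (1 / r) := by positivity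
    rw [← mul_le_mul_iff_right₀ hpos, ← hsplit]
    linarith
  calc S = (S ^ (1 / r')) ^ r' := by
        rw [← Real.rpow_mul hS0, one_div_mul_cancel hr0'.ne', Real.rpow_one]
    _ ≤ (2 * B ^ (1 / r) * P ^ (1 / r')) ^ r' := by gcongr
    _ = _ := by
        rw [Real.mul_rpow (by positivity) (by positivity), ← Real.rpow_mul hP0,
          one_div_mul_cancel hr0'.ne', Real.rpow_one]

theorem sum_rpow_convOp_le_of_isometry {G : Type*} [AddCommGroup G] [Fintype G] {E F : Type*}
    [NormedAddCommGroup E] [NormedSpace ℂ E] [NormedAddCommGroup F] [NormedSpace ℂ F] {t : G → ℂ}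
    {p K : ℝ} (J : E →L[ℂ] F) (hJ : ∀ x, ‖J x‖ = ‖x‖)
    (h : ∀ f : G → F, ∑ x, ‖convOp t f x‖ ^ p ≤ K * ∑ x, ‖f x‖ ^ p)
    (f : G → E) : ∑ x, ‖convOp t f x‖ ^ p ≤ K * ∑ x, ‖f x‖ ^ p := by
  have h1 := h fun x => J (f x)
  have h2 : ∀ x, convOp t (fun x => J (f x)) x = J (convOp t f x) := by
    intro x
    simp only [convOp, map_sum, map_smul]
  simpa only [h2, hJ] using h1

/-- For p > r the conjugate exponents satisfy p' < r', so the previous case applies to the reflected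
kernel with values in the dual. Dualizing again gives the bidual, which contains E isometrically. -/
theorem exists_sum_rpow_convOp_le {E : Type*} [NormedAddCommGroup E] [NormedSpace ℂ E]
    {p r B H : ℝ} (hp : 1 < p) (hr : 1 < r) (hB : 0 ≤ B) (hH0 : 0 ≤ H) :
    ∃ K : ℝ, 0 ≤ K ∧ ∀ (L : ℕ) (t : ZMod (2 ^ L) → ℂ), IsHormander L t H →
      IsHormander L (fun u => t (-u)) H →
      (∀ f : ZMod (2 ^ L) → E, ∑ x, ‖convOp t f x‖ ^ r ≤ B * ∑ x, ‖f x‖ ^ r) →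
      ∀ f : ZMod (2 ^ L) → E, ∑ x, ‖convOp t f x‖ ^ p ≤ K * ∑ x, ‖f x‖ ^ p := by
  rcases lt_trichotomy p r with hpr | rfl | hpr
  · obtain ⟨K, hK, h⟩ := exists_sum_rpow_convOp_le_of_lt (E := E) hp hpr hB hH0
    exact ⟨K, hK, fun L t h1 _ hT => h L t h1 hT⟩
  · exact ⟨B, hB, fun L t _ _ hT => hT⟩
  · have hr' := Real.HolderConjugate.conjExponent hr
    have hp' := Real.HolderConjugate.conjExponent hp
    have hlt : p.conjExponent < r.conjExponent := by
      have h1 := hr'.inv_add_inv_eq_one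
      have h2 := hp'.inv_add_inv_eq_one
      have h3 : p⁻¹ < r⁻¹ := inv_strictAnti₀ hr'.pos hpr
      exact (inv_lt_inv₀ hr'.symm.pos hp'.symm.pos).1 (by linarith)
    obtain ⟨K, hK, h⟩ := exists_sum_rpow_convOp_le_of_lt (E := StrongDual ℂ E)
      (B := (2 * B ^ (1 / r)) ^ r.conjExponent) hp'.symm.lt hlt (by positivity) hH0
    refine ⟨(2 * K ^ (1 / p.conjExponent)) ^ p, by positivity, fun L t _ h2 hT => ?_⟩
    refine sum_rpow_convOp_le_of_isometry (F := StrongDual ℂ (StrongDual ℂ E))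
      (NormedSpace.inclusionInDoubleDual ℂ E)
      (fun x => (NormedSpace.inclusionInDoubleDualLi (E := E) ℂ).norm_map x) fun f => ?_
    have h3 := sum_rpow_convOp_dual_le hp'.symm hK
      (h L _ h2 fun ψ => sum_rpow_convOp_dual_le hr' hB hT ψ) f
    simpa only [neg_neg] using h3

end Duality
-- The discrete Riesz kernel and its Hörmander condition
section Kernel

/-- The kernel on `ℤ/N` whose symbol is `(1 - k/N)²` for `0 ≤ k < N`. -/
def fejerKernel (N : ℕ) [NeZero N] (u : ZMod N) : ℂ :=
  (N : ℂ)⁻¹ * ∑ k ∈ Finset.range N, (1 - (k : ℂ) / N) ^ 2 * ZMod.stdAddChar u ^ k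

theorem stdAddChar_pow_card {N : ℕ} [NeZero N] (u : ZMod N) : ZMod.stdAddChar u ^ N = 1 := by
  rw [← AddChar.map_nsmul_eq_pow]
  simp

theorem norm_stdAddChar {N : ℕ} [NeZero N] (u : ZMod N) : ‖ZMod.stdAddChar u‖ = 1 :=
  AddChar.norm_apply _ _

/-- The partial sums up to any M have a closed form, verified by induction; z^N = 1 simplifies it at
M = N. -/
theorem sum_range_sq_mul_pow {N : ℕ} (z : ℂ) (hz : z ^ N = 1) :
    (1 - z) ^ 3 * ∑ k ∈ Finset.range N, ((N : ℂ) - k) ^ 2 * z ^ k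
      = (1 - z) ^ 2 * N ^ 2 - 2 * N * z * (1 - z) := by
  have h : ∀ M : ℕ, (1 - z) ^ 3 * ∑ k ∈ Finset.range M, ((N : ℂ) - k) ^ 2 * z ^ k
      = ((1 - z) ^ 2 * N ^ 2 + z * (1 - z) * (1 - 2 * N) + 2 * z ^ 2)
        - z ^ M * ((1 - z) ^ 2 * (N - M) ^ 2 + z * (1 - z) * (1 - 2 * (N - M)) + 2 * z ^ 2) := by
    intro M
    induction M with
    | zero => simp
    | succ M ih =>
      rw [Finset.sum_range_succ, mul_add, ih]
      push_cast
      ring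
  rw [h N, hz]
  ring

theorem fejerKernel_eq {N : ℕ} [NeZero N] {u : ZMod N} (hu : ZMod.stdAddChar u ≠ (1 : ℂ)) :
    fejerKernel N u = (N : ℂ)⁻¹ * ((1 - ZMod.stdAddChar u)⁻¹
      - 2 / N * (ZMod.stdAddChar u * ((1 - ZMod.stdAddChar u) ^ 2)⁻¹)) := by
  have hN : (N : ℂ) ≠ 0 := Nat.cast_ne_zero.2 (NeZero.ne N)
  have h := sum_range_sq_mul_pow _ (stdAddChar_pow_card u)
  rw [fejerKernel]
  generalize ZMod.stdAddChar u = z at *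
  have h1 : (1 - z) ≠ 0 := sub_ne_zero.2 (Ne.symm hu)
  have h2 : ∑ k ∈ Finset.range N, (1 - (k : ℂ) / N) ^ 2 * z ^ k
      = (N ^ 2 : ℂ)⁻¹ * ∑ k ∈ Finset.range N, ((N : ℂ) - k) ^ 2 * z ^ k := by
    rw [Finset.mul_sum]
    refine Finset.sum_congr rfl fun k _ => ?_
    field_simp
  rw [h2]
  congr 1
  have h3 : ∑ k ∈ Finset.range N, ((N : ℂ) - k) ^ 2 * z ^ k
      = ((1 - z) ^ 2 * N ^ 2 - 2 * N * z * (1 - z)) / (1 - z) ^ 3 := by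
    rw [← h]; field_simp
  rw [h3]
  field_simp

theorem fejerKernel_neg {N : ℕ} [NeZero N] (u : ZMod N) :
    fejerKernel N (-u) = starRingEnd ℂ (fejerKernel N u) := by
  simp only [fejerKernel, map_mul, map_sum, map_pow, map_sub, map_div₀, map_inv₀, map_natCast,
    map_one, AddChar.map_neg_eq_conj]

theorem stdAddChar_eq_exp {N : ℕ} [NeZero N] (u : ZMod N) :
    ZMod.stdAddChar u = Complex.exp (Complex.I * ((2 * Real.pi * u.val / N : ℝ) : ℂ)) := by
  conv_lhs => rw [← ZMod.natCast_zmod_val u]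
  have := ZMod.stdAddChar_coe (N := N) (u.val : ℤ)
  rw [Int.cast_natCast] at this
  rw [this]
  congr 1
  push_cast
  ring

theorem norm_one_sub_stdAddChar_le {N : ℕ} [NeZero N] (v : ℕ) :
    ‖1 - (ZMod.stdAddChar (v : ZMod N) : ℂ)‖ ≤ 2 * Real.pi * v / N := by
  have := ZMod.stdAddChar_coe (N := N) (v : ℤ)
  rw [Int.cast_natCast] at this
  rw [this, norm_sub_rev, show (2 * Real.pi * Complex.I * ((v : ℤ) : ℂ) / N : ℂ)
    = Complex.I * ((2 * Real.pi * v / N : ℝ) : ℂ) by push_cast; ring]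
  refine Real.norm_exp_I_mul_ofReal_sub_one_le.trans (le_of_eq ?_)
  rw [Real.norm_eq_abs, abs_of_nonneg]
  have := Real.pi_pos
  positivity

/-- Jordan's inequality for the sine on [0, π/2], after the reflection x ↦ π - x when u lies in the
second half. -/
theorem le_norm_one_sub_stdAddChar {N : ℕ} [NeZero N] (u : ZMod N) {d : ℝ} (h1 : d ≤ u.val)
    (h2 : d ≤ N - u.val) : 4 * d / N ≤ ‖1 - (ZMod.stdAddChar u : ℂ)‖ := by
  have hN : (0 : ℝ) < N := Nat.cast_pos.2 (NeZero.pos N)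
  have hpi := Real.pi_pos
  have huN : (u.val : ℝ) ≤ N := by exact_mod_cast (ZMod.val_lt u).le
  rw [norm_sub_rev, stdAddChar_eq_exp, Complex.norm_exp_I_mul_ofReal_sub_one,
    show 2 * Real.pi * u.val / N / 2 = Real.pi * u.val / N by ring, Real.norm_eq_abs]
  refine le_trans ?_ (le_abs_self _)
  suffices h : 2 * d / N ≤ Real.sin (Real.pi * u.val / N) by
    rw [show 4 * d / N = 2 * (2 * d / N) by ring]
    linarith
  by_cases hle : (u.val : ℝ) ≤ N / 2
  · have h3 := Real.mul_le_sin (x := Real.pi * u.val / N) (by positivity) (by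
      rw [div_le_div_iff₀ hN (by norm_num)]
      nlinarith)
    refine le_trans ?_ h3
    rw [show 2 / Real.pi * (Real.pi * u.val / N) = 2 * u.val / N by field_simp]
    gcongr
  · have h4 : 0 ≤ (N : ℝ) - u.val := by linarith
    have h3 := Real.mul_le_sin (x := Real.pi * (N - u.val) / N) (by positivity) (by
      rw [div_le_div_iff₀ hN (by norm_num)]
      nlinarith)
    rw [show Real.pi * u.val / N = Real.pi - Real.pi * (N - u.val) / N by field_simp; ring,
      Real.sin_pi_sub]
    refine le_trans ?_ h3
    rw [show 2 / Real.pi * (Real.pi * (N - u.val) / N) = 2 * (N - u.val) / N by field_simp]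
    gcongr

/-- The kernel behaves like 1/(N(1 - z)), of size 1/d at cyclic distance d from 0; a shift by v
changes it by about v/d². -/
theorem norm_fejerKernel_sub_le {N : ℕ} [NeZero N] (u : ZMod N) (v : ℕ) {d : ℝ} (hd : 1 ≤ d)
    (h1 : d ≤ u.val) (h2 : d ≤ N - u.val) (h3 : 2 * v ≤ u.val) :
    ‖fejerKernel N (u - v) - fejerKernel N u‖ ≤ 2 * v * (d ^ 2)⁻¹ := by
  have hN : (0 : ℝ) < N := Nat.cast_pos.2 (NeZero.pos N)
  have hvN : v ≤ u.val := by omega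
  have hval : (u - (v : ZMod N)).val = u.val - v := by
    conv_lhs => rw [← ZMod.natCast_zmod_val u, ← Nat.cast_sub hvN]
    rw [ZMod.val_natCast, Nat.mod_eq_of_lt]
    exact (Nat.sub_le _ _).trans_lt (ZMod.val_lt u)
  have hvr : 2 * (v : ℝ) ≤ u.val := by exact_mod_cast h3
  have hA := le_norm_one_sub_stdAddChar u h1 h2
  -- Since 2v ≤ u, the shifted point keeps at least half of the distance.
  have hB := le_norm_one_sub_stdAddChar (u - (v : ZMod N)) (d := d / 2)
    (by rw [hval, Nat.cast_sub hvN]; linarith) (by rw [hval, Nat.cast_sub hvN]; linarith)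
  have hv := norm_one_sub_stdAddChar_le (N := N) v
  have hApos : 0 < 4 * d / N := by positivity
  have hBpos : 0 < 4 * (d / 2) / N := by positivity
  have hzne : (ZMod.stdAddChar u : ℂ) ≠ 1 := by
    intro h; rw [h, sub_self, norm_zero] at hA; linarith
  have hzne' : (ZMod.stdAddChar (u - (v : ZMod N)) : ℂ) ≠ 1 := by
    intro h; rw [h, sub_self, norm_zero] at hB; linarith
  rw [fejerKernel_eq hzne, fejerKernel_eq hzne']
  have hdiff : ‖(ZMod.stdAddChar (u - (v : ZMod N)) : ℂ) - ZMod.stdAddChar u‖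
      = ‖1 - (ZMod.stdAddChar (v : ZMod N) : ℂ)‖ := by
    have : (ZMod.stdAddChar u : ℂ)
        = ZMod.stdAddChar (u - (v : ZMod N)) * ZMod.stdAddChar (v : ZMod N) := by
      rw [← AddChar.map_add_eq_mul, sub_add_cancel]
    rw [this, ← mul_one_sub, norm_mul, norm_stdAddChar, one_mul]
  rw [← hdiff] at hv
  have hnz := norm_stdAddChar u
  generalize (ZMod.stdAddChar u : ℂ) = z at *
  generalize (ZMod.stdAddChar (u - (v : ZMod N)) : ℂ) = z' at *
  have hz : 1 - z ≠ 0 := sub_ne_zero.2 (Ne.symm hzne)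
  have hz' : 1 - z' ≠ 0 := sub_ne_zero.2 (Ne.symm hzne')
  -- The difference factors through z' - z. The last factor stays bounded because |1 - z|⁻¹ ≤ N/4
  -- and |1 - z'|⁻¹ ≤ N/2.
  have hid : (N : ℂ)⁻¹ * ((1 - z')⁻¹ - 2 / N * (z' * ((1 - z') ^ 2)⁻¹))
      - (N : ℂ)⁻¹ * ((1 - z)⁻¹ - 2 / N * (z * ((1 - z) ^ 2)⁻¹))
      = (N : ℂ)⁻¹ * ((z' - z) * ((1 - z) * (1 - z'))⁻¹) *
        (1 - 2 / N * ((1 - z)⁻¹ * z + (1 - z')⁻¹)) := by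
    field_simp
    ring
  rw [hid]
  have hNn : ‖(N : ℂ)‖ = N := Complex.norm_natCast N
  rw [norm_mul, norm_mul, norm_mul, norm_inv, norm_inv, norm_mul, hNn]
  set a := ‖1 - z‖
  set b := ‖1 - z'‖
  have ha : 0 < a := hApos.trans_le hA
  have hb : 0 < b := hBpos.trans_le hB
  have e1 : ‖1 - 2 / N * ((1 - z)⁻¹ * z + (1 - z')⁻¹)‖ ≤ 5 / 2 := by
    have i1 : a⁻¹ ≤ N / 4 := by
      rw [inv_le_comm₀ ha (by positivity)]
      refine le_trans ?_ hA
      rw [inv_div]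
      gcongr
      linarith
    have i2 : b⁻¹ ≤ N / 2 := by
      rw [inv_le_comm₀ hb (by positivity)]
      refine le_trans ?_ hB
      rw [inv_div]
      gcongr
      linarith
    calc _ ≤ ‖(1 : ℂ)‖ + ‖(2 : ℂ) / N * ((1 - z)⁻¹ * z + (1 - z')⁻¹)‖ := norm_sub_le _ _
      _ ≤ 1 + 2 / N * (a⁻¹ * 1 + b⁻¹) := by
          rw [norm_one, norm_mul, norm_div, hNn, RCLike.norm_ofNat]
          gcongr
          refine (norm_add_le _ _).trans (le_of_eq ?_)
          rw [norm_mul, norm_inv, norm_inv, hnz]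
      _ ≤ 1 + 2 / N * (N / 4 * 1 + N / 2) := by gcongr
      _ = 5 / 2 := by field_simp; norm_num
  calc (N : ℝ)⁻¹ * (‖z' - z‖ * (a * b)⁻¹) * ‖1 - 2 / N * ((1 - z)⁻¹ * z + (1 - z')⁻¹)‖
      ≤ (N : ℝ)⁻¹ * ((2 * Real.pi * v / N) * ((4 * d / N) * (4 * (d / 2) / N))⁻¹) * (5 / 2) := by
        gcongr
    _ = (5 * Real.pi / 8) * v * (d ^ 2)⁻¹ := by
        field_simp
        ring
    _ ≤ 2 * v * (d ^ 2)⁻¹ := by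
        have := Real.pi_lt_d2
        gcongr
        linarith

/-- The inverse square of the distance to 0 is at most the sum of the inverse squares of u and 2^L -
u. Each tail of inverse squares beyond 2^l is at most 2/2^l, so the total is 2 · 2^l · 4/2^l = 8. -/
theorem isHormander_fejerKernel (L : ℕ) : IsHormander L (fejerKernel (2 ^ L)) 8 := by
  classical
  intro l hl v hv
  set S := Finset.univ.filter fun u : ZMod (2 ^ L) => 2 ^ (l + 1) ≤ u.val ∧ u.val + 2 ^ l < 2 ^ L
    with hS
  have hpos : (0 : ℝ) < 2 ^ l := by positivity
  have hmem : ∀ u ∈ S, 2 * 2 ^ l ≤ u.val ∧ u.val + 2 ^ l < 2 ^ L := by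
    intro u hu
    have := (Finset.mem_filter.1 hu).2
    rw [pow_succ] at this
    omega
  have h2l : 1 ≤ 2 ^ l := Nat.one_le_two_pow
  have hpt : ∀ u ∈ S, ‖fejerKernel (2 ^ L) (u - (v : ZMod (2 ^ L))) - fejerKernel (2 ^ L) u‖
      ≤ 2 * 2 ^ l * (((u.val : ℝ) ^ 2)⁻¹ + (((2 ^ L - u.val : ℕ) : ℝ) ^ 2)⁻¹) := by
    intro u hu
    obtain ⟨h1, h2⟩ := hmem u hu
    have hvr : (v : ℝ) ≤ 2 ^ l := by exact_mod_cast hv.le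
    have hle : u.val ≤ 2 ^ L := by omega
    have c1 : (1 : ℝ) ≤ u.val := by exact_mod_cast (by omega : 1 ≤ u.val)
    have c2 : (1 : ℝ) ≤ ((2 ^ L - u.val : ℕ) : ℝ) := by
      exact_mod_cast (by omega : 1 ≤ 2 ^ L - u.val)
    have c3 : ((2 ^ L - u.val : ℕ) : ℝ) = ((2 ^ L : ℕ) : ℝ) - u.val := by rw [Nat.cast_sub hle]
    have key : ∀ d : ℝ, 1 ≤ d → d ≤ u.val → d ≤ ((2 ^ L - u.val : ℕ) : ℝ) →
        ‖fejerKernel (2 ^ L) (u - (v : ZMod (2 ^ L))) - fejerKernel (2 ^ L) u‖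
          ≤ 2 * 2 ^ l * (d ^ 2)⁻¹ := by
      intro d hd1 hd2 hd3
      refine (norm_fejerKernel_sub_le u v hd1 hd2 (c3 ▸ hd3) (by omega)).trans ?_
      gcongr
    have p1 : 0 ≤ ((u.val : ℝ) ^ 2)⁻¹ := by positivity
    have p2 : 0 ≤ (((2 ^ L - u.val : ℕ) : ℝ) ^ 2)⁻¹ := by positivity
    rcases le_total (u.val : ℝ) ((2 ^ L - u.val : ℕ) : ℝ) with h | h
    · refine (key _ c1 le_rfl h).trans ?_
      gcongr
      linarith
    · refine (key _ c2 h le_rfl).trans ?_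
      gcongr
      linarith
  have hsum : ∀ g : ZMod (2 ^ L) → ℕ, Set.InjOn g S →
      (∀ u ∈ S, 2 ^ l < g u ∧ g u < 2 ^ L) → ∑ u ∈ S, ((g u : ℝ) ^ 2)⁻¹ ≤ 2 / 2 ^ l := by
    intro g hg hg2
    calc ∑ u ∈ S, ((g u : ℝ) ^ 2)⁻¹ = ∑ m ∈ S.image g, ((m : ℝ) ^ 2)⁻¹ :=
          (Finset.sum_image (f := fun m : ℕ => ((m : ℝ) ^ 2)⁻¹) hg).symm
      _ ≤ ∑ m ∈ Finset.Ioo ((2 : ℕ) ^ l) (2 ^ L), ((m : ℝ) ^ 2)⁻¹ := by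
          refine Finset.sum_le_sum_of_subset_of_nonneg ?_ fun _ _ _ => by positivity
          intro m hm
          obtain ⟨u, hu, rfl⟩ := Finset.mem_image.1 hm
          exact Finset.mem_Ioo.2 (hg2 u hu)
      _ ≤ 2 / (((2 ^ l : ℕ) : ℝ) + 1) := sum_Ioo_inv_sq_le _ _
      _ ≤ 2 / 2 ^ l := by
          push_cast
          gcongr
          linarith
  have s1 := hsum (fun u => u.val) (fun a _ b _ h => ZMod.val_injective _ h)
    (fun u hu => by have := hmem u hu; constructor <;> omega)
  have s2 := hsum (fun u => 2 ^ L - u.val)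
    (fun a ha b hb h => by
      have h1 := hmem a ha
      have h2 := hmem b hb
      simp only at h
      exact ZMod.val_injective _ (by omega))
    (fun u hu => by have := hmem u hu; constructor <;> omega)
  calc _ ≤ ∑ u ∈ S, 2 * 2 ^ l * (((u.val : ℝ) ^ 2)⁻¹ + (((2 ^ L - u.val : ℕ) : ℝ) ^ 2)⁻¹) :=
        Finset.sum_le_sum hpt
    _ = 2 * 2 ^ l * (∑ u ∈ S, ((u.val : ℝ) ^ 2)⁻¹ + ∑ u ∈ S, (((2 ^ L - u.val : ℕ) : ℝ) ^ 2)⁻¹) := by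
        rw [← Finset.mul_sum, Finset.sum_add_distrib]
    _ ≤ 2 * 2 ^ l * (2 / 2 ^ l + 2 / 2 ^ l) := by gcongr
    _ = 8 := by field_simp; norm_num

theorem isHormander_fejerKernel_neg (L : ℕ) :
    IsHormander L (fun u => fejerKernel (2 ^ L) (-u)) 8 := by
  intro l hl v hv
  refine le_trans (le_of_eq ?_) (isHormander_fejerKernel L l hl v hv)
  refine Finset.sum_congr rfl fun u _ => ?_
  simp only [fejerKernel_neg]
  rw [← map_sub, RCLike.norm_conj]

end Kernel
-- Trigonometric polynomials on the circle
section Circle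

/-- The character `x ↦ e^{ikx}` of the circle. -/
def circChar (k : ℤ) (x : ℝ) : ℂ := Complex.exp (Complex.I * ((k * x : ℝ) : ℂ))

theorem circChar_add_left (k l : ℤ) (x : ℝ) : circChar (k + l) x = circChar k x * circChar l x := by
  rw [circChar, circChar, circChar, ← Complex.exp_add]
  push_cast
  ring_nf

theorem circChar_add_right (k : ℤ) (x y : ℝ) : circChar k (x + y) = circChar k x * circChar k y := by
  rw [circChar, circChar, circChar, ← Complex.exp_add]
  push_cast
  ring_nf

theorem circChar_neg_right (k : ℤ) (x : ℝ) : circChar k (-x) = circChar (-k) x := by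
  rw [circChar, circChar]
  push_cast
  ring_nf

theorem circChar_sub_right (k : ℤ) (x y : ℝ) :
    circChar k (x - y) = circChar k x * circChar (-k) y := by
  rw [sub_eq_add_neg, circChar_add_right, circChar_neg_right]

@[simp] theorem circChar_zero_left (x : ℝ) : circChar 0 x = 1 := by simp [circChar]

@[simp] theorem norm_circChar (k : ℤ) (x : ℝ) : ‖circChar k x‖ = 1 := by
  rw [circChar, mul_comm, Complex.norm_exp_ofReal_mul_I]

@[fun_prop] theorem continuous_circChar (k : ℤ) : Continuous (circChar k) := by
  unfold circChar; fun_prop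

theorem circChar_periodic (k : ℤ) : Function.Periodic (circChar k) (2 * Real.pi) := by
  intro x
  rw [circChar, circChar, Complex.exp_eq_exp_iff_exists_int]
  exact ⟨k, by push_cast; ring⟩

theorem conj_circChar (k : ℤ) (x : ℝ) : starRingEnd ℂ (circChar k x) = circChar (-k) x := by
  rw [circChar, circChar, ← Complex.exp_conj, map_mul, Complex.conj_I, Complex.conj_ofReal]
  push_cast
  ring_nf

theorem integral_circChar (k : ℤ) :
    ∫ x in (0 : ℝ)..2 * Real.pi, circChar k x = if k = 0 then ((2 * Real.pi : ℝ) : ℂ) else 0 := by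
  split_ifs with h
  · subst h; simp
  · have hc : Complex.I * k ≠ 0 := mul_ne_zero Complex.I_ne_zero (by exact_mod_cast h)
    have h1 : ∀ x : ℝ, circChar k x = Complex.exp (Complex.I * k * x) := by
      intro x; rw [circChar]; push_cast; ring_nf
    have h2 : ∀ x : ℝ, Complex.exp (Complex.I * k * x) = circChar k x := fun x => (h1 x).symm
    simp only [h1]
    rw [integral_exp_mul_complex hc, h2, h2]
    have := circChar_periodic k 0
    rw [zero_add] at this
    rw [this, sub_self, zero_div]

/-- The points `2πj/N`. -/
def node {N : ℕ} (j : ZMod N) : ℝ := 2 * Real.pi * j.val / N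

theorem circChar_node {N : ℕ} [NeZero N] (k : ℤ) (j : ZMod N) :
    circChar k (node j) = ZMod.stdAddChar ((k : ZMod N) * j) := by
  conv_rhs => rw [← ZMod.natCast_zmod_val j]
  have := ZMod.stdAddChar_coe (N := N) (k * j.val : ℤ)
  push_cast at this
  rw [this, circChar, node]
  congr 1
  push_cast
  ring

section Poly

variable {E : Type*} [NormedAddCommGroup E] [NormedSpace ℂ E]

/-- The trigonometric polynomial `∑_{k ∈ S} e_k c_k` on the circle. -/
def circPoly (S : Finset ℤ) (c : ℤ → E) (x : ℝ) : E := ∑ k ∈ S, circChar k x • c k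

@[fun_prop] theorem continuous_circPoly (S : Finset ℤ) (c : ℤ → E) : Continuous (circPoly S c) := by
  unfold circPoly
  exact continuous_finsetSum _ fun k _ => (continuous_circChar k).smul continuous_const

theorem circPoly_periodic (S : Finset ℤ) (c : ℤ → E) :
    Function.Periodic (circPoly S c) (2 * Real.pi) := by
  intro x
  simp only [circPoly, circChar_periodic _ x]

variable (E) in
/-- The Riesz projection is bounded on `L^r` of the circle: `‖Pf‖_r^r ≤ A ‖f‖_r^r`. -/
def IsRieszBound (r A : ℝ) : Prop :=
  ∀ (S : Finset ℤ) (c : ℤ → E),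
    ∫ x in (0 : ℝ)..2 * Real.pi, ‖circPoly (S.filter fun k => 0 ≤ k) c x‖ ^ r
      ≤ A * ∫ x in (0 : ℝ)..2 * Real.pi, ‖circPoly S c x‖ ^ r

end Poly

/-! ### Fejér kernels -/

/-- The coefficients of the Fejér kernel. -/
def fejerCoeff (N : ℕ) (m : ℤ) : ℝ := 1 - |(m : ℝ)| / N

/-- The Fejér kernel. -/
def fejerFun (N : ℕ) (x : ℝ) : ℝ := (N : ℝ)⁻¹ * ‖∑ k ∈ Finset.range N, circChar k x‖ ^ 2

theorem fejerFun_nonneg (N : ℕ) (x : ℝ) : 0 ≤ fejerFun N x := by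
  unfold fejerFun; positivity

@[fun_prop] theorem continuous_fejerFun (N : ℕ) : Continuous (fejerFun N) := by
  unfold fejerFun
  fun_prop

theorem fejerFun_neg (N : ℕ) (x : ℝ) : fejerFun N (-x) = fejerFun N x := by
  have : ∑ k ∈ Finset.range N, circChar k (-x)
      = starRingEnd ℂ (∑ k ∈ Finset.range N, circChar k x) := by
    rw [map_sum]
    exact Finset.sum_congr rfl fun k _ => by rw [circChar_neg_right, conj_circChar]
  rw [fejerFun, fejerFun, this, RCLike.norm_conj]

theorem sum_Icc_neg (e : ℤ → ℂ) (M : ℕ) : ∑ m ∈ Finset.Icc (-M : ℤ) M, e m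
    = ∑ l ∈ Finset.range (M + 1), e (M - l) + ∑ k ∈ Finset.range M, e (k - M) := by
  have h1 : ∑ m ∈ Finset.Icc (-M : ℤ) M, e m = ∑ i ∈ Finset.range (M + (M + 1)), e (i - M) := by
    symm
    refine Finset.sum_nbij' (fun i => (i : ℤ) - M) (fun m => (m + M).toNat) ?_ ?_ ?_ ?_ ?_
    · intro i hi; simp only [Finset.mem_range, Finset.mem_Icc] at *; omega
    · intro i hi; simp only [Finset.mem_range, Finset.mem_Icc] at *; omega
    · intro i hi; simp only [Finset.mem_range] at *; omega
    · intro i hi; simp only [Finset.mem_Icc] at *; omega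
    · intro i hi; rfl
  rw [h1, Finset.sum_range_add, add_comm]
  congr 1
  rw [← Finset.sum_range_reflect]
  refine Finset.sum_congr rfl fun i hi => ?_
  congr 1
  have := Finset.mem_range.1 hi
  omega

/-- The weight M - |m| counts the pairs with k - l = m. Passing from M to M + 1 adds one new pair
for each |m| ≤ M. -/
theorem sum_range_mul_sum_range_neg (e : ℤ → ℂ) (he : ∀ k l, e (k + l) = e k * e l) (M : ℕ) :
    (∑ k ∈ Finset.range M, e k) * (∑ l ∈ Finset.range M, e (-l))
      = ∑ m ∈ Finset.Ioo (-M : ℤ) M, ((M : ℂ) - |(m : ℝ)|) * e m := by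
  induction M with
  | zero => simp
  | succ M ih =>
    have h1 : Finset.Ioo (-((M + 1 : ℕ) : ℤ)) ((M + 1 : ℕ) : ℤ) = Finset.Icc (-M : ℤ) M := by
      ext m; simp only [Finset.mem_Ioo, Finset.mem_Icc]; push_cast; omega
    have h2 : ∑ m ∈ Finset.Icc (-M : ℤ) M, ((M : ℂ) - |(m : ℝ)|) * e m
        = ∑ m ∈ Finset.Ioo (-M : ℤ) M, ((M : ℂ) - |(m : ℝ)|) * e m := by
      symm
      refine Finset.sum_subset Finset.Ioo_subset_Icc_self fun m hm hm' => ?_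
      have : |m| = M := by
        simp only [Finset.mem_Ioo, Finset.mem_Icc] at *
        rcases abs_cases m with h | h <;> omega
      have h3 : |(m : ℝ)| = M := by exact_mod_cast this
      rw [h3]; simp
    have h3 : ∑ m ∈ Finset.Icc (-M : ℤ) M, (((M + 1 : ℕ) : ℂ) - |(m : ℝ)|) * e m
        = ∑ m ∈ Finset.Icc (-M : ℤ) M, ((M : ℂ) - |(m : ℝ)|) * e m
          + ∑ m ∈ Finset.Icc (-M : ℤ) M, e m := by
      rw [← Finset.sum_add_distrib]
      refine Finset.sum_congr rfl fun m _ => ?_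
      push_cast; ring
    have h4 : ∑ l ∈ Finset.range (M + 1), e (M - l)
        = e M * ∑ l ∈ Finset.range (M + 1), e (-l) := by
      rw [Finset.mul_sum]
      exact Finset.sum_congr rfl fun l _ => by rw [← he, sub_eq_add_neg]
    have h5 : ∑ k ∈ Finset.range M, e (k - M) = e (-M) * ∑ k ∈ Finset.range M, e k := by
      rw [Finset.mul_sum]
      exact Finset.sum_congr rfl fun l _ => by rw [← he]; congr 1; ring
    rw [h1, h3, h2, ← ih, sum_Icc_neg, h4, h5, Finset.sum_range_succ, Finset.sum_range_succ]
    ring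

theorem fejerFun_eq (N : ℕ) [NeZero N] (x : ℝ) : (fejerFun N x : ℂ)
    = ∑ m ∈ Finset.Ioo (-N : ℤ) N, (fejerCoeff N m : ℂ) * circChar m x := by
  have hN : (N : ℂ) ≠ 0 := Nat.cast_ne_zero.2 (NeZero.ne N)
  have h := sum_range_mul_sum_range_neg (fun k => circChar k x)
    (fun k l => circChar_add_left k l x) N
  have h1 : ∑ l ∈ Finset.range N, circChar (-l) x
      = starRingEnd ℂ (∑ k ∈ Finset.range N, circChar k x) := by
    rw [map_sum]
    exact Finset.sum_congr rfl fun k _ => by rw [conj_circChar]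
  rw [h1, Complex.mul_conj, Complex.normSq_eq_norm_sq] at h
  rw [fejerFun, Complex.ofReal_mul, h, Finset.mul_sum]
  refine Finset.sum_congr rfl fun m _ => ?_
  rw [fejerCoeff]
  push_cast
  field_simp

theorem fejerCoeff_zero (N : ℕ) : fejerCoeff N 0 = 1 := by simp [fejerCoeff]

theorem sum_circChar_node {N : ℕ} [NeZero N] {m : ℤ} (hm : m ∈ Finset.Ioo (-N : ℤ) N) :
    ∑ j : ZMod N, circChar m (node j) = if m = 0 then (N : ℂ) else 0 := by
  classical
  have h := AddChar.sum_mulShift (m : ZMod N) (ZMod.isPrimitive_stdAddChar N)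
  have h2 : ((m : ZMod N) = 0) ↔ m = 0 := by
    rw [ZMod.intCast_zmod_eq_zero_iff_dvd]
    constructor
    · intro hd
      rw [Finset.mem_Ioo] at hm
      exact Int.eq_zero_of_abs_lt_dvd hd (abs_lt.2 ⟨by omega, hm.2⟩)
    · rintro rfl; exact dvd_zero _
  simp only [h2, ZMod.card] at h
  simp only [circChar_node]
  simp_rw [mul_comm (m : ZMod N)]
  rw [h]
  split_ifs <;> simp

/-- Summation over the nodes kills every frequency in (-N, N) except 0. After division by N the
translated Fejér kernels are convex weights. -/
theorem sum_fejerFun_node (N : ℕ) [NeZero N] (x : ℝ) : ∑ j : ZMod N, fejerFun N (node j - x) = N := by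
  have hN : 0 < N := NeZero.pos N
  have h : ∑ j : ZMod N, (fejerFun N (node j - x) : ℂ) = N := by
    simp only [fejerFun_eq, circChar_sub_right]
    rw [Finset.sum_comm, Finset.sum_eq_single 0]
    · simp only [fejerCoeff_zero]
      simp [ZMod.card]
    · intro m hm hm0
      have := sum_circChar_node hm
      rw [if_neg hm0] at this
      rw [← Finset.mul_sum, ← Finset.sum_mul, this]
      simp
    · intro h0; exact absurd (Finset.mem_Ioo.2 ⟨by omega, by omega⟩) h0
  exact_mod_cast h

theorem integral_fejerFun_mul_circChar (N : ℕ) [NeZero N] (x : ℝ) {k : ℤ}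
    (hk : k ∈ Finset.Ioo (-N : ℤ) N) :
    ∫ y in (0 : ℝ)..2 * Real.pi, (fejerFun N (x - y) : ℂ) * circChar k y
      = 2 * Real.pi * (fejerCoeff N k * circChar k x) := by
  have h1 : ∀ y, (fejerFun N (x - y) : ℂ) * circChar k y
      = ∑ m ∈ Finset.Ioo (-N : ℤ) N, (fejerCoeff N m * circChar m x) * circChar (k - m) y := by
    intro y
    rw [fejerFun_eq, Finset.sum_mul]
    refine Finset.sum_congr rfl fun m _ => ?_
    rw [circChar_sub_right, sub_eq_add_neg k m, circChar_add_left]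
    ring
  simp only [h1]
  rw [intervalIntegral.integral_finsetSum fun m _ =>
    ((continuous_circChar _).const_mul _).intervalIntegrable _ _]
  simp only [intervalIntegral.integral_const_mul, integral_circChar]
  rw [Finset.sum_eq_single k]
  · simp; ring
  · intro m _ hm
    rw [if_neg (sub_ne_zero.2 hm.symm), mul_zero]
  · intro h; exact absurd hk h

theorem integral_fejerFun (N : ℕ) [NeZero N] (x : ℝ) :
    ∫ y in (0 : ℝ)..2 * Real.pi, fejerFun N (x - y) = 2 * Real.pi := by
  have hN : 0 < N := NeZero.pos N
  have h := integral_fejerFun_mul_circChar N x (k := 0) (Finset.mem_Ioo.2 ⟨by omega, by omega⟩)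
  simp only [circChar_zero_left, mul_one, fejerCoeff_zero] at h
  rw [intervalIntegral.integral_ofReal, Complex.ofReal_one, mul_one] at h
  exact_mod_cast h

/-- Jensen's inequality for the density F/2π, by integrating the tangent line of u ↦ u^r at the mean
s. The tangent inequality is Bernoulli's. -/
theorem rpow_integral_mul_le {r : ℝ} (hr : 1 ≤ r) {F g : ℝ → ℝ} (hF : Continuous F)
    (hg : Continuous g) (hF0 : ∀ y, 0 ≤ F y) (hg0 : ∀ y, 0 ≤ g y)
    (hF1 : ∫ y in (0 : ℝ)..2 * Real.pi, F y = 2 * Real.pi) :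
    ((2 * Real.pi)⁻¹ * ∫ y in (0 : ℝ)..2 * Real.pi, F y * g y) ^ r
      ≤ (2 * Real.pi)⁻¹ * ∫ y in (0 : ℝ)..2 * Real.pi, F y * g y ^ r := by
  have hpi : (0 : ℝ) < 2 * Real.pi := by have := Real.pi_pos; positivity
  have hgr : Continuous fun y => g y ^ r := hg.rpow_const fun _ => Or.inr (by linarith)
  have hI0 : 0 ≤ ∫ y in (0 : ℝ)..2 * Real.pi, F y * g y :=
    intervalIntegral.integral_nonneg hpi.le fun y _ => mul_nonneg (hF0 y) (hg0 y)
  have hI1 : 0 ≤ ∫ y in (0 : ℝ)..2 * Real.pi, F y * g y ^ r :=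
    intervalIntegral.integral_nonneg hpi.le fun y _ =>
      mul_nonneg (hF0 y) (Real.rpow_nonneg (hg0 y) _)
  set s := (2 * Real.pi)⁻¹ * ∫ y in (0 : ℝ)..2 * Real.pi, F y * g y with hs
  have hs0 : 0 ≤ s := by positivity
  rcases hs0.eq_or_lt with h0 | h0
  · rw [← h0, Real.zero_rpow (by linarith)]; positivity
  have htan : ∀ u, 0 ≤ u → s ^ r * (1 - r) + r * s ^ (r - 1) * u ≤ u ^ r := by
    intro u hu
    have h1 : -1 ≤ u / s - 1 := by
      have : 0 ≤ u / s := by positivity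
      linarith
    have h2 := one_add_mul_self_le_rpow_one_add h1 hr
    rw [add_sub_cancel, Real.div_rpow hu h0.le, le_div_iff₀ (by positivity)] at h2
    refine le_trans (le_of_eq ?_) h2
    rw [Real.rpow_sub h0, Real.rpow_one]
    field_simp
    ring
  have hmono : ∫ y in (0 : ℝ)..2 * Real.pi, (s ^ r * (1 - r) * F y + r * s ^ (r - 1) * (F y * g y))
      ≤ ∫ y in (0 : ℝ)..2 * Real.pi, F y * g y ^ r := by
    refine intervalIntegral.integral_mono_on hpi.le
      (Continuous.intervalIntegrable (by fun_prop) _ _)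
      (Continuous.intervalIntegrable (by fun_prop) _ _) fun y _ => ?_
    have := mul_le_mul_of_nonneg_left (htan (g y) (hg0 y)) (hF0 y)
    linarith
  rw [intervalIntegral.integral_add (Continuous.intervalIntegrable (by fun_prop) _ _)
    (Continuous.intervalIntegrable (by fun_prop) _ _), intervalIntegral.integral_const_mul,
    intervalIntegral.integral_const_mul, hF1] at hmono
  have hint : ∫ y in (0 : ℝ)..2 * Real.pi, F y * g y = 2 * Real.pi * s := by
    rw [hs]; field_simp
  rw [hint] at hmono
  rw [inv_mul_eq_div, le_div_iff₀ hpi]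
  refine le_trans (le_of_eq ?_) hmono
  rw [Real.rpow_sub h0, Real.rpow_one]
  field_simp
  ring

end Circle
-- Transference between the circle and ℤ/N
section Transference

variable {E : Type*} [NormedAddCommGroup E] [NormedSpace ℂ E]

theorem stdAddChar_mul_eq_pow {N : ℕ} [NeZero N] (k : ℕ) (u : ZMod N) :
    (ZMod.stdAddChar (((k : ℤ) : ZMod N) * u) : ℂ) = ZMod.stdAddChar u ^ k := by
  rw [← AddChar.map_nsmul_eq_pow, nsmul_eq_mul, Int.cast_natCast]

theorem circChar_node_sub {N : ℕ} [NeZero N] (k : ℕ) (i j : ZMod N) :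
    (ZMod.stdAddChar (i - j) : ℂ) ^ k = circChar k (node i) * circChar (-k) (node j) := by
  rw [circChar_node, circChar_node, ← AddChar.map_add_eq_mul, ← stdAddChar_mul_eq_pow]
  congr 1
  push_cast
  ring

/-- Interpolate a by Fejér kernels, project, then average against Fejér kernels at the nodes. By
convexity the two outer maps cost only the factors 2π/N and N/2π, which cancel. Each multiplies the
frequency k by 1 - |k|/N, which explains the square in the symbol of `fejerKernel`. -/
theorem sum_rpow_convOp_fejerKernel_le [CompleteSpace E] {r A : ℝ} (hr : 1 ≤ r)
    (h : IsRieszBound E r A) (N : ℕ) [NeZero N] (a : ZMod N → E) :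
    ∑ i, ‖convOp (fejerKernel N) a i‖ ^ r ≤ A * ∑ i, ‖a i‖ ^ r := by
  have hN : (0 : ℝ) < N := Nat.cast_pos.2 (NeZero.pos N)
  have hNc : (N : ℂ) ≠ 0 := Nat.cast_ne_zero.2 (NeZero.ne N)
  have hpi : (0 : ℝ) < 2 * Real.pi := by have := Real.pi_pos; positivity
  have hr0 : 0 ≤ r := by linarith
  set S : Finset ℤ := Finset.Ioo (-N : ℤ) N with hS
  set c : ℤ → E := fun m => ((fejerCoeff N m : ℂ) * (N : ℂ)⁻¹) • ∑ j, circChar (-m) (node j) • a j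
    with hc
  -- the smooth interpolation of `a`
  have hf : ∀ x, circPoly S c x = ∑ j, ((fejerFun N (node j - x) / N : ℝ) : ℂ) • a j := by
    intro x
    have : ∀ j : ZMod N, ((fejerFun N (node j - x) / N : ℝ) : ℂ)
        = ∑ m ∈ S, circChar m x * ((fejerCoeff N m : ℂ) * (N : ℂ)⁻¹) * circChar (-m) (node j) := by
      intro j
      rw [← neg_sub, fejerFun_neg, Complex.ofReal_div, fejerFun_eq, Finset.sum_div]
      refine Finset.sum_congr rfl fun m _ => ?_
      rw [circChar_sub_right, Complex.ofReal_natCast]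
      ring
    simp only [this, Finset.sum_smul, circPoly, hc]
    rw [Finset.sum_comm]
    refine Finset.sum_congr rfl fun m _ => ?_
    rw [Finset.smul_sum, Finset.smul_sum]
    refine Finset.sum_congr rfl fun j _ => ?_
    rw [smul_smul, smul_smul, mul_assoc]
  have hfle : ∀ x, ‖circPoly S c x‖ ^ r ≤ ∑ j, fejerFun N (node j - x) / N * ‖a j‖ ^ r := by
    intro x
    have hw : ∀ j : ZMod N, 0 ≤ fejerFun N (node j - x) / N := fun j =>
      div_nonneg (fejerFun_nonneg _ _) hN.le
    have h1 : ‖circPoly S c x‖ ≤ ∑ j, fejerFun N (node j - x) / N * ‖a j‖ := by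
      rw [hf]
      refine (norm_sum_le _ _).trans (Finset.sum_le_sum fun j _ => ?_)
      rw [norm_smul, Complex.norm_real, Real.norm_of_nonneg (hw j)]
    refine (Real.rpow_le_rpow (norm_nonneg _) h1 hr0).trans ?_
    refine Real.rpow_arith_mean_le_arith_mean_rpow _ _ _ (fun j _ => hw j) ?_
      (fun j _ => norm_nonneg _) hr
    rw [← Finset.sum_div, sum_fejerFun_node, div_self hN.ne']
  have hfint : ∫ x in (0 : ℝ)..2 * Real.pi, ‖circPoly S c x‖ ^ r
      ≤ 2 * Real.pi / N * ∑ j, ‖a j‖ ^ r := by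
    refine (intervalIntegral.integral_mono_on hpi.le
      (Continuous.intervalIntegrable ((continuous_circPoly S c).norm.rpow_const
        fun _ => Or.inr hr0) _ _)
      (Continuous.intervalIntegrable (by fun_prop) _ _) fun x _ => hfle x).trans (le_of_eq ?_)
    rw [intervalIntegral.integral_finsetSum fun j _ =>
      Continuous.intervalIntegrable (by fun_prop) _ _, Finset.mul_sum]
    refine Finset.sum_congr rfl fun j _ => ?_
    rw [intervalIntegral.integral_mul_const, intervalIntegral.integral_div, integral_fejerFun]
  -- averaging the projected function gives the discrete operator
  set g := circPoly (S.filter fun k => 0 ≤ k) c with hg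
  have hgcont : Continuous g := continuous_circPoly _ _
  have hT : ∀ i : ZMod N, (2 * Real.pi : ℂ) • convOp (fejerKernel N) a i
      = ∫ y in (0 : ℝ)..2 * Real.pi, (fejerFun N (node i - y) : ℂ) • g y := by
    intro i
    have h1 : ∀ y, (fejerFun N (node i - y) : ℂ) • g y
        = ∑ k ∈ S.filter (fun k => 0 ≤ k),
          ((fejerFun N (node i - y) : ℂ) * circChar k y) • c k := by
      intro y
      simp only [hg, circPoly, Finset.smul_sum, smul_smul]
    simp only [h1]
    rw [intervalIntegral.integral_finsetSum fun k _ =>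
      Continuous.intervalIntegrable (by fun_prop) _ _]
    simp only [intervalIntegral.integral_smul_const]
    have h2 : ∀ k ∈ S.filter (fun k => 0 ≤ k),
        (∫ y in (0 : ℝ)..2 * Real.pi, (fejerFun N (node i - y) : ℂ) * circChar k y) • c k
        = (2 * Real.pi : ℂ) • (fejerCoeff N k * circChar k (node i)) • c k := by
      intro k hk
      rw [integral_fejerFun_mul_circChar N _ (Finset.mem_filter.1 hk).1]
      exact mul_smul _ _ _
    rw [Finset.sum_congr rfl h2, ← Finset.smul_sum]
    congr 1
    have h3 : ∑ k ∈ S.filter (fun k => 0 ≤ k), ((fejerCoeff N k : ℂ) * circChar k (node i)) • c k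
        = ∑ k ∈ Finset.range N, ((fejerCoeff N k : ℂ) * circChar k (node i)) • c k := by
      refine Finset.sum_nbij' (fun k => k.toNat) (fun k => (k : ℤ)) ?_ ?_ ?_ ?_ ?_
      · intro k hk
        simp only [hS, Finset.mem_filter, Finset.mem_Ioo, Finset.mem_range] at *; omega
      · intro k hk
        simp only [hS, Finset.mem_filter, Finset.mem_Ioo, Finset.mem_range] at *; omega
      · intro k hk
        simp only [hS, Finset.mem_filter, Finset.mem_Ioo] at *; omega
      · intro k hk; simp
      · intro k hk
        have : ((k.toNat : ℕ) : ℤ) = k := by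
          simp only [hS, Finset.mem_filter, Finset.mem_Ioo] at *; omega
        rw [this]
    rw [h3]
    simp only [convOp, fejerKernel, hc, Finset.smul_sum, Finset.mul_sum, Finset.sum_smul]
    rw [Finset.sum_comm]
    refine Finset.sum_congr rfl fun k _ => Finset.sum_congr rfl fun j _ => ?_
    rw [smul_smul, smul_smul, circChar_node_sub, fejerCoeff]
    congr 1
    push_cast
    rw [abs_of_nonneg (by positivity : (0 : ℝ) ≤ (k : ℝ))]
    push_cast
    ring
  have hTle : ∀ i : ZMod N, ‖convOp (fejerKernel N) a i‖ ^ r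
      ≤ (2 * Real.pi)⁻¹ * ∫ y in (0 : ℝ)..2 * Real.pi, fejerFun N (node i - y) * ‖g y‖ ^ r := by
    intro i
    refine le_trans ?_ (rpow_integral_mul_le hr (by fun_prop) hgcont.norm
      (fun y => fejerFun_nonneg N _) (fun y => norm_nonneg _) (integral_fejerFun N (node i)))
    refine Real.rpow_le_rpow (norm_nonneg _) ?_ hr0
    have h1 : ‖(2 * Real.pi : ℂ) • convOp (fejerKernel N) a i‖
        = 2 * Real.pi * ‖convOp (fejerKernel N) a i‖ := by
      rw [norm_smul, norm_mul, Complex.norm_real, RCLike.norm_ofNat,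
        Real.norm_of_nonneg Real.pi_pos.le]
    rw [inv_mul_eq_div, le_div_iff₀ hpi, mul_comm, ← h1, hT]
    refine (intervalIntegral.norm_integral_le_integral_norm hpi.le).trans (le_of_eq ?_)
    congr 1
    ext y
    rw [norm_smul, Complex.norm_real, Real.norm_of_nonneg (fejerFun_nonneg _ _)]
  have hgr : Continuous fun y => ‖g y‖ ^ r := hgcont.norm.rpow_const fun _ => Or.inr hr0
  have hA : ∫ x in (0 : ℝ)..2 * Real.pi, ‖g x‖ ^ r
      ≤ A * ∫ x in (0 : ℝ)..2 * Real.pi, ‖circPoly S c x‖ ^ r := h S c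
  have hsum : ∑ i, ‖convOp (fejerKernel N) a i‖ ^ r
      ≤ (2 * Real.pi)⁻¹ * (N * ∫ x in (0 : ℝ)..2 * Real.pi, ‖g x‖ ^ r) := by
    refine (Finset.sum_le_sum fun i _ => hTle i).trans (le_of_eq ?_)
    rw [← Finset.mul_sum, ← intervalIntegral.integral_finsetSum fun j _ =>
      Continuous.intervalIntegrable (by fun_prop) _ _]
    simp only [← Finset.sum_mul, sum_fejerFun_node, intervalIntegral.integral_const_mul]
  by_cases hA0 : 0 ≤ A
  · calc _ ≤ _ := hsum
      _ ≤ (2 * Real.pi)⁻¹ * (N * (A * (2 * Real.pi / N * ∑ j, ‖a j‖ ^ r))) := by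
          have := hA.trans (mul_le_mul_of_nonneg_left hfint hA0)
          gcongr
      _ = _ := by field_simp
  · -- a negative bound forces the space to be trivial
    have hsub : ∀ v : E, v = 0 := by
      intro v
      by_contra hv
      have h1 := h {0} (fun _ => v)
      simp only [circPoly, Finset.sum_singleton, circChar_zero_left, one_smul] at h1
      rw [show (({0} : Finset ℤ).filter fun k => 0 ≤ k) = {0} by decide] at h1
      simp only [Finset.sum_singleton, circChar_zero_left, one_smul,
        intervalIntegral.integral_const, smul_eq_mul, sub_zero] at h1
      have h2 : 0 < ‖v‖ ^ r := Real.rpow_pos_of_pos (norm_pos_iff.2 hv) _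
      have h3 : 0 < 2 * Real.pi * ‖v‖ ^ r := by positivity
      nlinarith
    have hr1 : r ≠ 0 := by linarith
    have h1 : ∀ i, convOp (fejerKernel N) a i = 0 := fun i => hsub _
    have h2 : ∀ i, a i = 0 := fun i => hsub _
    simp [h1, h2, Real.zero_rpow hr1]

/-- The eigenvalues of convolution with `fejerKernel N`. -/
def fejerEigenvalue (N : ℕ) (k : ℤ) : ℝ :=
  if 0 ≤ k then (1 - (k : ℝ) / N) ^ 2 else ((k : ℝ) / N) ^ 2

/-- Aliasing: on the nodes a negative frequency k equals k + N, where the symbol is (k/N)^2. For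
fixed k the eigenvalues tend to the symbol of the Riesz projection. -/
theorem sum_fejerKernel_mul_circChar {N : ℕ} [NeZero N] {k : ℤ} (hk : k ∈ Finset.Ioo (-N : ℤ) N)
    (i : ZMod N) : ∑ j, fejerKernel N (i - j) * circChar k (node j)
      = fejerEigenvalue N k * circChar k (node i) := by
  classical
  have hN : (N : ℂ) ≠ 0 := Nat.cast_ne_zero.2 (NeZero.ne N)
  rw [Finset.mem_Ioo] at hk
  have h1 : ∑ j, fejerKernel N (i - j) * circChar k (node j)
      = (N : ℂ)⁻¹ * ∑ l ∈ Finset.range N, (1 - (l : ℂ) / N) ^ 2 * circChar l (node i) *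
        ∑ j : ZMod N, circChar (k - l) (node j) := by
    simp only [fejerKernel, Finset.mul_sum, Finset.sum_mul]
    rw [Finset.sum_comm]
    refine Finset.sum_congr rfl fun l _ => Finset.sum_congr rfl fun j _ => ?_
    rw [circChar_node_sub, sub_eq_add_neg k, circChar_add_left]
    ring
  have h2 : ∀ l : ℕ, ∑ j : ZMod N, circChar (k - l) (node j)
      = if (N : ℤ) ∣ k - l then (N : ℂ) else 0 := by
    intro l
    have h := AddChar.sum_mulShift ((k - l : ℤ) : ZMod N) (ZMod.isPrimitive_stdAddChar N)
    simp only [ZMod.intCast_zmod_eq_zero_iff_dvd, ZMod.card] at h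
    simp only [circChar_node]
    simp_rw [mul_comm ((k - l : ℤ) : ZMod N)]
    rw [h]
    split_ifs <;> simp
  rw [h1]
  simp only [h2]
  by_cases h0 : 0 ≤ k
  · rw [Finset.sum_eq_single k.toNat]
    · have hk0 : ((k.toNat : ℕ) : ℤ) = k := by omega
      have hk1 : ((k.toNat : ℕ) : ℂ) = k := by
        have : (((k.toNat : ℕ) : ℤ) : ℂ) = (k : ℂ) := by rw [hk0]
        rwa [Int.cast_natCast] at this
      rw [hk0, sub_self, if_pos (dvd_zero _), fejerEigenvalue, if_pos h0, hk1]
      push_cast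
      field_simp
    · intro l hl hne
      rw [Finset.mem_range] at hl
      rw [if_neg, mul_zero]
      intro hd
      have := Int.eq_zero_of_abs_lt_dvd hd (abs_lt.2 ⟨by omega, by omega⟩)
      omega
    · intro h; rw [Finset.mem_range] at h; omega
  · have hk0 : (((k + N).toNat : ℕ) : ℤ) = k + N := by omega
    have hk1 : (((k + N).toNat : ℕ) : ℂ) = k + N := by
      have : ((((k + N).toNat : ℕ) : ℤ) : ℂ) = ((k + N : ℤ) : ℂ) := by rw [hk0]
      push_cast at this
      exact this
    rw [Finset.sum_eq_single (k + N).toNat]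
    · have h3 : circChar (k + N) (node i) = circChar k (node i) := by
        rw [circChar_node, circChar_node]
        push_cast
        rw [ZMod.natCast_self, add_zero]
      rw [hk0, if_pos ⟨-1, by ring⟩, fejerEigenvalue, if_neg h0, hk1, h3]
      push_cast
      field_simp
      ring
    · intro l hl hne
      rw [Finset.mem_range] at hl
      rw [if_neg, mul_zero]
      rintro ⟨q, hq⟩
      have hNpos : 0 < (N : ℤ) := by have := NeZero.pos N; omega
      have q1 : q < 0 := by
        by_contra! hcon
        have := mul_nonneg hNpos.le hcon
        omega
      have q2 : -2 < q := by
        by_contra! hcon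
        have := mul_le_mul_of_nonneg_left hcon hNpos.le
        omega
      have q3 : q = -1 := by omega
      rw [q3] at hq
      omega
    · intro h; rw [Finset.mem_range] at h; omega

theorem abs_fejerEigenvalue_le {N : ℕ} [NeZero N] {k : ℤ} (hk : k ∈ Finset.Ioo (-N : ℤ) N) :
    |fejerEigenvalue N k| ≤ 1 := by
  have hN : (0 : ℝ) < N := Nat.cast_pos.2 (NeZero.pos N)
  rw [Finset.mem_Ioo] at hk
  have h1 : -1 < (k : ℝ) / N := by
    rw [lt_div_iff₀ hN, neg_one_mul]; exact_mod_cast hk.1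
  have h2 : (k : ℝ) / N < 1 := by rw [div_lt_one hN]; exact_mod_cast hk.2
  rw [fejerEigenvalue]
  split_ifs with h
  · have h3 : 0 ≤ (k : ℝ) / N := div_nonneg (by exact_mod_cast h) hN.le
    rw [abs_of_nonneg (by positivity)]
    nlinarith
  · rw [abs_of_nonneg (by positivity)]
    nlinarith

theorem tendsto_fejerEigenvalue (k : ℤ) :
    Filter.Tendsto (fun N : ℕ => fejerEigenvalue N k) Filter.atTop
      (nhds (if 0 ≤ k then 1 else 0)) := by
  have h := tendsto_const_div_atTop_nhds_zero_nat (k : ℝ)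
  simp only [fejerEigenvalue]
  split_ifs with h0
  · simpa using (h.const_sub 1).pow 2
  · simpa using h.pow 2

/-- Apply the discrete bound to the samples of f at the nodes shifted by θ and integrate over θ; by
periodicity each sum becomes N times an integral over the circle. Then N = 2^L tends to infinity by
dominated convergence. -/
theorem isRieszBound_of_convOp {p K : ℝ} (hp : 1 < p)
    (h : ∀ (L : ℕ) (a : ZMod (2 ^ L) → E),
      ∑ i, ‖convOp (fejerKernel (2 ^ L)) a i‖ ^ p ≤ K * ∑ i, ‖a i‖ ^ p) :
    IsRieszBound E p K := by
  intro S c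
  have hpi : (0 : ℝ) < 2 * Real.pi := by have := Real.pi_pos; positivity
  have hp0 : 0 ≤ p := by linarith
  have hcont : ∀ d : ℤ → E, Continuous fun x => ‖circPoly S d x‖ ^ p := fun d =>
    (continuous_circPoly S d).norm.rpow_const fun _ => Or.inr hp0
  have hcont' : ∀ (d : ℤ → E) (y : ℝ), Continuous fun θ => ‖circPoly S d (y + θ)‖ ^ p := fun d y =>
    (hcont d).comp (continuous_const.add continuous_id)
  let G : ℕ → ℝ → E := fun N => circPoly S fun k => (fejerEigenvalue N k : ℂ) • c k
  -- The eigenvalue formula holds only for frequencies in (-N, N).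
  have hev : ∀ᶠ L : ℕ in Filter.atTop, ∀ k ∈ S, k ∈ Finset.Ioo (-(2 ^ L : ℕ) : ℤ) ((2 ^ L : ℕ) : ℤ) := by
    rw [Filter.eventually_all_finset]
    intro k _
    filter_upwards [Filter.eventually_ge_atTop k.natAbs] with L hL
    have : L < 2 ^ L := Nat.lt_two_pow_self
    rw [Finset.mem_Ioo]
    omega
  have hshift : ∀ (N : ℕ) [NeZero N] (d : ℤ → E),
      ∫ θ in (0 : ℝ)..2 * Real.pi, ∑ i : ZMod N, ‖circPoly S d (node i + θ)‖ ^ p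
        = N * ∫ x in (0 : ℝ)..2 * Real.pi, ‖circPoly S d x‖ ^ p := by
    intro N _ d
    have hper : Function.Periodic (fun x => ‖circPoly S d x‖ ^ p) (2 * Real.pi) := by
      intro x
      simp only [circPoly_periodic S d x]
    rw [intervalIntegral.integral_finsetSum fun i _ =>
      (hcont' d (node i)).intervalIntegrable _ _]
    have : ∀ i : ZMod N, ∫ θ in (0 : ℝ)..2 * Real.pi, ‖circPoly S d (node i + θ)‖ ^ p
        = ∫ x in (0 : ℝ)..2 * Real.pi, ‖circPoly S d x‖ ^ p := by
      intro i
      rw [intervalIntegral.integral_comp_add_left (fun x => ‖circPoly S d x‖ ^ p), add_zero]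
      have := hper.intervalIntegral_add_eq (node i) 0
      rw [zero_add] at this
      exact this
    simp [this, ZMod.card]
  have hbound : ∀ᶠ L : ℕ in Filter.atTop,
      ∫ x in (0 : ℝ)..2 * Real.pi, ‖G (2 ^ L) x‖ ^ p
        ≤ K * ∫ x in (0 : ℝ)..2 * Real.pi, ‖circPoly S c x‖ ^ p := by
    filter_upwards [hev] with L hL
    have hN : (0 : ℝ) < ((2 ^ L : ℕ) : ℝ) := by positivity
    have hpt : ∀ θ, ∑ i : ZMod (2 ^ L), ‖G (2 ^ L) (node i + θ)‖ ^ p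
        ≤ K * ∑ i : ZMod (2 ^ L), ‖circPoly S c (node i + θ)‖ ^ p := by
      intro θ
      have h1 := h L fun j => circPoly S c (node j + θ)
      have h2 : ∀ i : ZMod (2 ^ L), convOp (fejerKernel (2 ^ L))
          (fun j => circPoly S c (node j + θ)) i = G (2 ^ L) (node i + θ) := by
        intro i
        simp only [convOp, circPoly, Finset.smul_sum, G]
        rw [Finset.sum_comm]
        refine Finset.sum_congr rfl fun k hk => ?_
        have h3 := sum_fejerKernel_mul_circChar (hL k hk) i
        simp only [circChar_add_right, smul_smul]
        rw [← Finset.sum_smul]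
        simp only [← mul_assoc]
        rw [← Finset.sum_mul, h3]
        congr 1
        ring
      simpa only [h2] using h1
    have hint : ∫ θ in (0 : ℝ)..2 * Real.pi, ∑ i : ZMod (2 ^ L), ‖G (2 ^ L) (node i + θ)‖ ^ p
        ≤ ∫ θ in (0 : ℝ)..2 * Real.pi, K * ∑ i : ZMod (2 ^ L), ‖circPoly S c (node i + θ)‖ ^ p :=
      intervalIntegral.integral_mono_on hpi.le
        (Continuous.intervalIntegrable (continuous_finsetSum _ fun i _ => hcont' _ _) _ _)
        (Continuous.intervalIntegrable (continuous_const.mul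
          (continuous_finsetSum _ fun i _ => hcont' c _)) _ _) fun θ _ => hpt θ
    rw [intervalIntegral.integral_const_mul, hshift (2 ^ L) c, hshift (2 ^ L)] at hint
    rw [← mul_le_mul_iff_right₀ hN]
    refine hint.trans (le_of_eq (by ring))
  refine le_of_tendsto ?_ hbound
  have hb0 : 0 ≤ ∑ k ∈ S, ‖c k‖ := Finset.sum_nonneg fun _ _ => norm_nonneg _
  refine intervalIntegral.tendsto_integral_filter_of_dominated_convergence
    (fun _ => (∑ k ∈ S, ‖c k‖) ^ p) ?_ ?_ intervalIntegrable_const ?_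
  · exact Filter.Eventually.of_forall fun L => (hcont _).aestronglyMeasurable
  · filter_upwards [hev] with L hL
    refine Filter.Eventually.of_forall fun x _ => ?_
    rw [Real.norm_of_nonneg (by positivity)]
    refine Real.rpow_le_rpow (norm_nonneg _) ?_ hp0
    refine (norm_sum_le _ _).trans (Finset.sum_le_sum fun k hk => ?_)
    rw [norm_smul, norm_circChar, one_mul, norm_smul, Complex.norm_real]
    exact mul_le_of_le_one_left (norm_nonneg _) (abs_fejerEigenvalue_le (hL k hk))
  · refine Filter.Eventually.of_forall fun x _ => ?_
    refine Filter.Tendsto.rpow_const ?_ (Or.inr hp0)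
    refine Filter.Tendsto.norm ?_
    simp only [G, circPoly]
    rw [Finset.sum_filter]
    refine tendsto_finsetSum _ fun k _ => ?_
    have h1 := (tendsto_fejerEigenvalue k).comp (tendsto_pow_atTop_atTop_of_one_lt (r := 2) one_lt_two)
    have h2 := ((Complex.continuous_ofReal.tendsto _).comp h1).smul_const (c k)
    have h3 := h2.const_smul (circChar k x)
    split_ifs at h3 ⊢ with h0
    · simpa [Function.comp_def] using h3
    · simpa [Function.comp_def] using h3

theorem exists_isRieszBound [CompleteSpace E] {p r A : ℝ} (hp : 1 < p) (hr : 1 < r) (hA : 0 ≤ A)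
    (h : IsRieszBound E r A) : ∃ K : ℝ, 0 ≤ K ∧ IsRieszBound E p K := by
  obtain ⟨K, hK, h1⟩ := exists_sum_rpow_convOp_le (E := E) (B := A) (H := 8) hp hr hA (by norm_num)
  exact ⟨K, hK, isRieszBound_of_convOp hp fun L => h1 L _ (isHormander_fejerKernel L)
    (isHormander_fejerKernel_neg L) (sum_rpow_convOp_fejerKernel_le hr.le h (2 ^ L))⟩

end Transference
-- From the circle to boxes of frequencies on the torus
section TorusIntegration

open MeasureTheory

/-- Normalized Lebesgue measure on `[0, 2π]`. -/
def circMeasure : Measure ℝ :=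
  (ENNReal.ofReal (2 * Real.pi))⁻¹ • volume.restrict (Set.Icc 0 (2 * Real.pi))

theorem ofReal_two_pi_ne_zero : ENNReal.ofReal (2 * Real.pi) ≠ 0 := by
  have := Real.pi_pos
  simp [this]

instance : IsProbabilityMeasure circMeasure where
  measure_univ := by
    rw [circMeasure, Measure.smul_apply, Measure.restrict_apply_univ, Real.volume_Icc, sub_zero,
      smul_eq_mul, ENNReal.inv_mul_cancel ofReal_two_pi_ne_zero ENNReal.ofReal_ne_top]

theorem torusMeasure_eq_pi (n : ℕ) : torusMeasure n = Measure.pi fun _ => circMeasure := by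
  symm
  refine Measure.pi_eq fun s hs => ?_
  have h1 : Set.Icc (0 : Fin n → ℝ) (fun _ => 2 * Real.pi)
      = Set.pi Set.univ fun _ => Set.Icc (0 : ℝ) (2 * Real.pi) := by
    rw [← Set.pi_univ_Icc]; rfl
  rw [torusMeasure, Measure.smul_apply, Measure.restrict_apply (MeasurableSet.univ_pi hs), h1,
    ← Set.pi_inter_distrib, volume_pi_pi, smul_eq_mul]
  simp only [circMeasure, Measure.smul_apply, smul_eq_mul, Measure.restrict_apply (hs _)]
  rw [Finset.prod_mul_distrib, Finset.prod_const, Finset.card_univ, Fintype.card_fin,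
    ENNReal.ofReal_pow (by have := Real.pi_pos; positivity), ENNReal.inv_pow]

instance (n : ℕ) : IsProbabilityMeasure (torusMeasure n) := by
  rw [torusMeasure_eq_pi]; infer_instance

/-- Fubini in a form that leaves the index set intact: integrating out one variable of a probability
product does not change the total integral. -/
theorem lintegral_torus_update {n : ℕ} (j : Fin n) {F : (Fin n → ℝ) → ℝ≥0∞} (hF : Measurable F) :
    ∫⁻ x, F x ∂torusMeasure n
      = ∫⁻ x, ∫⁻ t, F (Function.update x j t) ∂circMeasure ∂torusMeasure n := by
  rw [torusMeasure_eq_pi]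
  refine lintegral_eq_of_lmarginal_eq {j} hF ?_ ?_
  · have := hF.lmarginal (μ := fun _ : Fin n => circMeasure) (s := {j})
    convert this using 1
    ext x
    rw [lmarginal_singleton]
  · ext x
    rw [lmarginal_singleton, lmarginal_singleton]
    simp

theorem lintegral_circ_eq {f : ℝ → ℝ} (hf : Continuous f) (hf0 : ∀ x, 0 ≤ f x) :
    ∫⁻ t, ENNReal.ofReal (f t) ∂circMeasure
      = (ENNReal.ofReal (2 * Real.pi))⁻¹ * ENNReal.ofReal (∫ t in (0 : ℝ)..2 * Real.pi, f t) := by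
  have hpi : (0 : ℝ) ≤ 2 * Real.pi := by have := Real.pi_pos; positivity
  rw [circMeasure, lintegral_smul_measure, smul_eq_mul, intervalIntegral.integral_of_le hpi,
    ← integral_Icc_eq_integral_Ioc, ofReal_integral_eq_lintegral_ofReal]
  · exact hf.continuousOn.integrableOn_compact isCompact_Icc
  · exact Filter.Eventually.of_forall hf0

variable {n : ℕ} {E : Type*} [NormedAddCommGroup E] [NormedSpace ℂ E]

theorem enorm_rpow_eq_ofReal (v : E) {r : ℝ} (hr : 0 ≤ r) :
    ‖v‖ₑ ^ r = ENNReal.ofReal (‖v‖ ^ r) := by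
  rw [← ofReal_norm, ENNReal.ofReal_rpow_of_nonneg (norm_nonneg _) hr]

theorem torusNorm_le_iff {m : ℕ} {p : ℝ≥0∞} (hp : 1 < p) (hp' : p < ∞) (f : (Fin m → ℝ) → E)
    (g : (Fin n → ℝ) → E) (C : ℝ≥0) :
    torusNorm p f ≤ C * torusNorm p g ↔
      ∫⁻ x, ‖f x‖ₑ ^ p.toReal ∂torusMeasure m
        ≤ C ^ p.toReal * ∫⁻ x, ‖g x‖ₑ ^ p.toReal ∂torusMeasure n := by
  have hp0 : p ≠ 0 := (zero_lt_one.trans hp).ne'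
  have hpr : 0 < p.toReal := ENNReal.toReal_pos hp0 hp'.ne
  rw [torusNorm, torusNorm, eLpNorm_eq_lintegral_rpow_enorm_toReal hp0 hp'.ne,
    eLpNorm_eq_lintegral_rpow_enorm_toReal hp0 hp'.ne, ← ENNReal.rpow_le_rpow_iff hpr,
    ENNReal.mul_rpow_of_nonneg _ _ hpr.le, ← ENNReal.rpow_mul, ← ENNReal.rpow_mul,
    one_div_mul_cancel hpr.ne', ENNReal.rpow_one, ENNReal.rpow_one]

@[fun_prop] theorem continuous_expChar (k : Fin n → ℤ) : Continuous (expChar k) := by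
  unfold expChar; fun_prop

@[simp] theorem norm_expChar (k : Fin n → ℤ) (x : Fin n → ℝ) : ‖expChar k x‖ = 1 := by
  rw [expChar, mul_comm, Complex.norm_exp_ofReal_mul_I]

theorem expChar_update (k : Fin n → ℤ) (x : Fin n → ℝ) (j : Fin n) (t : ℝ) :
    expChar k (Function.update x j t) = circChar (k j) t * expChar k (Function.update x j 0) := by
  rw [expChar, expChar, circChar, ← Complex.exp_add, ← mul_add, ← Complex.ofReal_add]
  congr 3
  rw [← Finset.add_sum_erase _ _ (Finset.mem_univ j),
    ← Finset.add_sum_erase (a := j) _ (fun i => (k i : ℝ) * Function.update x j 0 i)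
      (Finset.mem_univ j)]
  simp only [Function.update_self, mul_zero, zero_add]
  congr 1
  refine Finset.sum_congr rfl fun i hi => ?_
  rw [Function.update_of_ne (Finset.ne_of_mem_erase hi),
    Function.update_of_ne (Finset.ne_of_mem_erase hi)]

theorem trigPoly_apply (c : (Fin n → ℤ) →₀ E) (x : Fin n → ℝ) :
    trigPoly c x = ∑ k ∈ c.support, expChar k x • c k := rfl

theorem continuous_trigPoly (c : (Fin n → ℤ) →₀ E) : Continuous (trigPoly c) := by
  unfold trigPoly Finsupp.sum
  exact continuous_finsetSum _ fun k _ => (continuous_expChar k).smul continuous_const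

theorem trigPoly_add (c d : (Fin n → ℤ) →₀ E) : trigPoly (c + d) = trigPoly c + trigPoly d := by
  ext x
  exact Finsupp.sum_add_index' (by simp) (by simp)

theorem trigPoly_neg (c : (Fin n → ℤ) →₀ E) : trigPoly (-c) = -trigPoly c := by
  ext x
  simp only [trigPoly, Pi.neg_apply]
  rw [Finsupp.sum_neg_index (by simp), Finsupp.sum, Finsupp.sum, ← Finset.sum_neg_distrib]
  simp

/-! ### From the torus to the circle -/

/-- Use polynomials in the first variable alone. On frequencies (k, 0, …, 0) the componentwise
condition k ≥ 0 is the one-dimensional one. -/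
theorem exists_isRieszBound_of_isUMD [NeZero n] (h : IsUMD n E) :
    ∃ r A : ℝ, 1 < r ∧ 0 ≤ A ∧ IsRieszBound E r A := by
  classical
  obtain ⟨p, hp, hp', -, C, hC⟩ := h
  have hp0 : p ≠ 0 := (zero_lt_one.trans hp).ne'
  have hpr : 0 < p.toReal := ENNReal.toReal_pos hp0 hp'.ne
  have hpr1 : 1 < p.toReal := by
    rw [← ENNReal.toReal_one]
    exact (ENNReal.toReal_lt_toReal ENNReal.one_ne_top hp'.ne).2 hp
  refine ⟨p.toReal, (C : ℝ) ^ p.toReal, hpr1, by positivity, fun S c => ?_⟩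
  let d : (Fin n → ℤ) →₀ E := ∑ k ∈ S, Finsupp.single (Pi.single 0 k) (c k)
  have hchar : ∀ (k : ℤ) (x : Fin n → ℝ), expChar (Pi.single 0 k : Fin n → ℤ) x = circChar k (x 0) := by
    intro k x
    rw [expChar, circChar]
    congr 3
    rw [Finset.sum_eq_single 0]
    · simp
    · intro i _ hi; simp [hi]
    · intro h; exact absurd (Finset.mem_univ _) h
  have h1 : ∀ M : (Fin n → ℤ) → (E →L[ℂ] E), ∀ x, multiplierPoly M d x
      = ∑ k ∈ S, circChar k (x 0) • M (Pi.single 0 k) (c k) := by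
    intro M x
    simp only [multiplierPoly, d]
    rw [← Finsupp.sum_finsetSum_index (by simp) (by simp)]
    refine Finset.sum_congr rfl fun k _ => ?_
    rw [Finsupp.sum_single_index (by simp), hchar]
  have h2 : ∀ x, trigPoly d x = circPoly S c (x 0) := by
    intro x
    simp only [trigPoly, d]
    rw [← Finsupp.sum_finsetSum_index (by simp) (by simp)]
    refine Finset.sum_congr rfl fun k _ => ?_
    rw [Finsupp.sum_single_index (by simp), hchar]
  have h3 : ∀ x, multiplierPoly (rieszSymbol n E) d x
      = circPoly (S.filter fun k => 0 ≤ k) c (x 0) := by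
    intro x
    rw [h1, circPoly, Finset.sum_filter]
    refine Finset.sum_congr rfl fun k _ => ?_
    have : (0 : Fin n → ℤ) ≤ Pi.single 0 k ↔ 0 ≤ k := by
      constructor
      · intro h; simpa using h 0
      · intro h i
        by_cases hi : i = 0
        · subst hi; simpa using h
        · simp [hi]
    simp only [rieszSymbol, this]
    split_ifs <;> simp
  have h4 := (torusNorm_le_iff hp hp' _ _ C).1 (hC d)
  simp only [h2, h3] at h4
  have h5 : ∀ f : ℝ → E, Continuous f → ∫⁻ x, ‖f (x 0)‖ₑ ^ p.toReal ∂torusMeasure n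
      = (ENNReal.ofReal (2 * Real.pi))⁻¹ *
        ENNReal.ofReal (∫ t in (0 : ℝ)..2 * Real.pi, ‖f t‖ ^ p.toReal) := by
    intro f hf
    rw [← lintegral_circ_eq (hf.norm.rpow_const fun _ => Or.inr hpr.le) fun x => by positivity,
      torusMeasure_eq_pi]
    simp only [enorm_rpow_eq_ofReal _ hpr.le]
    exact (measurePreserving_eval (fun _ : Fin n => circMeasure) 0).lintegral_comp
      (f := fun t => ENNReal.ofReal (‖f t‖ ^ p.toReal))
      (hf.norm.rpow_const fun _ => Or.inr hpr.le).measurable.ennreal_ofReal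
  rw [h5 _ (continuous_circPoly _ _), h5 _ (continuous_circPoly _ _), mul_left_comm,
    ENNReal.mul_le_mul_iff_right (ENNReal.inv_ne_zero.2 ENNReal.ofReal_ne_top)
      (ENNReal.inv_ne_top.2 ofReal_two_pi_ne_zero), ← ENNReal.coe_rpow_of_nonneg _ hpr.le,
    ← ENNReal.ofReal_coe_nnreal, ← ENNReal.ofReal_mul (by positivity),
    ENNReal.ofReal_le_ofReal_iff] at h4
  · simpa using h4
  · refine mul_nonneg (by positivity) (intervalIntegral.integral_nonneg ?_ fun y _ => by positivity)
    have := Real.pi_pos; positivity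

/-- Multiplication by the unimodular character e_{-a} moves the threshold from a to 0 and preserves
norms. -/
theorem IsRieszBound.shift {r A : ℝ} (h : IsRieszBound E r A) (a : ℤ) (S : Finset ℤ) (c : ℤ → E) :
    ∫ x in (0 : ℝ)..2 * Real.pi, ‖circPoly (S.filter fun k => a ≤ k) c x‖ ^ r
      ≤ A * ∫ x in (0 : ℝ)..2 * Real.pi, ‖circPoly S c x‖ ^ r := by
  classical
  have h1 : ∀ (T : Finset ℤ) x,
      ‖circPoly (T.map (Equiv.subRight a).toEmbedding) (fun k => c (k + a)) x‖ = ‖circPoly T c x‖ := by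
    intro T x
    have : circPoly (T.map (Equiv.subRight a).toEmbedding) (fun k => c (k + a)) x
        = circChar (-a) x • circPoly T c x := by
      simp only [circPoly, Finset.sum_map, Finset.smul_sum, smul_smul, ← circChar_add_left]
      refine Finset.sum_congr rfl fun k _ => ?_
      simp [sub_eq_neg_add]
    rw [this, norm_smul, norm_circChar, one_mul]
  have h2 : (S.map (Equiv.subRight a).toEmbedding).filter (fun k => 0 ≤ k)
      = (S.filter fun k => a ≤ k).map (Equiv.subRight a).toEmbedding := by
    rw [Finset.filter_map]
    congr 1
    ext k
    simp
  have := h (S.map (Equiv.subRight a).toEmbedding) (fun k => c (k + a))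
  rw [h2] at this
  simpa only [h1] using this

/-! ### Bounded projections onto sets of frequencies -/

/-- The coefficients in `S`, the others being replaced by zero. -/
def restrictFreq (S : Set (Fin n → ℤ)) (c : (Fin n → ℤ) →₀ E) : (Fin n → ℤ) →₀ E :=
  open Classical in c.filter (· ∈ S)

theorem restrictFreq_apply (S : Set (Fin n → ℤ)) (c : (Fin n → ℤ) →₀ E) (k : Fin n → ℤ) :
    restrictFreq S c k = S.indicator c k := by
  classical
  rw [restrictFreq, Finsupp.filter_apply, Set.indicator_apply]

/-- The projection onto the frequencies in `S` has norm at most `C` on `L^p`. -/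
def HasLpBound (E : Type*) [NormedAddCommGroup E] [NormedSpace ℂ E] (p : ℝ≥0∞)
    (S : Set (Fin n → ℤ)) (C : ℝ≥0) : Prop :=
  ∀ c : (Fin n → ℤ) →₀ E, torusNorm p (trigPoly (restrictFreq S c)) ≤ C * torusNorm p (trigPoly c)

theorem HasLpBound.inter {p : ℝ≥0∞} {S T : Set (Fin n → ℤ)} {C D : ℝ≥0} (hS : HasLpBound E p S C)
    (hT : HasLpBound E p T D) : HasLpBound E p (S ∩ T) (C * D) := by
  intro c
  have : restrictFreq (S ∩ T) c = restrictFreq S (restrictFreq T c) := by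
    ext k
    by_cases h1 : k ∈ S <;> by_cases h2 : k ∈ T <;> simp [restrictFreq_apply, h1, h2]
  have h1 := (hS (restrictFreq T c)).trans (mul_le_mul_right (hT c) _)
  rw [← mul_assoc] at h1
  rwa [ENNReal.coe_mul, this]

theorem HasLpBound.compl {p : ℝ≥0∞} (hp : 1 ≤ p) {S : Set (Fin n → ℤ)} {C : ℝ≥0}
    (hS : HasLpBound E p S C) : HasLpBound E p Sᶜ (1 + C) := by
  intro c
  have : restrictFreq Sᶜ c = c + -restrictFreq S c := by
    ext k
    by_cases h1 : k ∈ S <;> simp [restrictFreq_apply, h1]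
  have h1 : torusNorm p (trigPoly (restrictFreq Sᶜ c))
      ≤ torusNorm p (trigPoly c) + torusNorm p (trigPoly (restrictFreq S c)) := by
    rw [this, trigPoly_add, trigPoly_neg]
    refine (eLpNorm_add_le (continuous_trigPoly _).aestronglyMeasurable
      (continuous_trigPoly _).neg.aestronglyMeasurable hp).trans ?_
    rw [eLpNorm_neg]
    rfl
  rw [ENNReal.coe_add, add_mul, ENNReal.coe_one, one_mul]
  exact h1.trans (add_le_add le_rfl (hS c))

theorem HasLpBound.univ {p : ℝ≥0∞} : HasLpBound (n := n) E p Set.univ 1 := by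
  intro c
  have : restrictFreq Set.univ c = c := by
    ext k; simp [restrictFreq_apply]
  rw [ENNReal.coe_one, one_mul, this]

/-- Freeze all variables but the j-th, apply the circle bound there, and integrate over the others.
-/
theorem IsRieszBound.hasLpBound {p : ℝ≥0∞} (hp : 1 < p) (hp' : p < ∞) {K : ℝ} (hK : 0 ≤ K)
    (h : IsRieszBound E p.toReal K) (j : Fin n) (a : ℤ) :
    HasLpBound E p {k : Fin n → ℤ | a ≤ k j} (Real.toNNReal K ^ (1 / p.toReal)) := by
  classical
  intro c
  have hp0 : p ≠ 0 := (zero_lt_one.trans hp).ne'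
  have hpr : 0 < p.toReal := ENNReal.toReal_pos hp0 hp'.ne
  rw [torusNorm_le_iff hp hp', ← ENNReal.coe_rpow_of_nonneg _ hpr.le, ← NNReal.rpow_mul,
    one_div_mul_cancel hpr.ne', NNReal.rpow_one]
  have hm : ∀ d : (Fin n → ℤ) →₀ E, Measurable fun x => ‖trigPoly d x‖ₑ ^ p.toReal := fun d =>
    (continuous_trigPoly d).enorm.measurable.pow_const _
  -- In the j-th variable the polynomial has coefficients that collect all frequencies with the same
  -- k_j. A general P covers both the projected and the full polynomial.
  have key : ∀ (P : ℤ → Prop) [DecidablePred P] (x : Fin n → ℝ) (t : ℝ),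
      trigPoly (restrictFreq {k | P (k j)} c) (Function.update x j t)
      = circPoly ((c.support.image fun k => k j).filter P)
        (fun l => ∑ k ∈ c.support.filter (fun k => k j = l),
          expChar k (Function.update x j 0) • c k) t := by
    intro P _ x t
    have e1 : restrictFreq {k : Fin n → ℤ | P (k j)} c = c.filter fun k => P (k j) := by
      ext k
      rw [restrictFreq_apply, Finsupp.filter_apply, Set.indicator_apply]
      rfl
    rw [e1, trigPoly_apply, Finsupp.support_filter, circPoly]
    have : ∀ k ∈ c.support.filter (fun k => P (k j)),
        k j ∈ (c.support.image fun k => k j).filter P := by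
      intro k hk
      obtain ⟨h1, h2⟩ := Finset.mem_filter.1 hk
      exact Finset.mem_filter.2 ⟨Finset.mem_image_of_mem _ h1, h2⟩
    rw [← Finset.sum_fiberwise_of_maps_to this]
    refine Finset.sum_congr rfl fun l hl => ?_
    rw [Finset.smul_sum]
    have h2 : (c.support.filter fun k => P (k j)).filter (fun k => k j = l)
        = c.support.filter fun k => k j = l := by
      ext k
      simp only [Finset.mem_filter]
      constructor
      · rintro ⟨⟨h1, -⟩, h2⟩; exact ⟨h1, h2⟩
      · rintro ⟨h1, h2⟩; exact ⟨⟨h1, h2 ▸ (Finset.mem_filter.1 hl).2⟩, h2⟩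
    rw [h2]
    refine Finset.sum_congr rfl fun k hk => ?_
    obtain ⟨hk1, hk2⟩ := Finset.mem_filter.1 hk
    rw [Finsupp.filter_apply_pos _ _ (hk2 ▸ (Finset.mem_filter.1 hl).2), expChar_update, hk2,
      smul_smul]
  rw [lintegral_torus_update j (hm _), lintegral_torus_update j (hm _), ← lintegral_const_mul' _ _ ENNReal.coe_ne_top]
  · refine lintegral_mono fun x => ?_
    have k1 := key (fun l => a ≤ l) x
    have k2 := key (fun _ => True) x
    have hT : restrictFreq {k : Fin n → ℤ | (fun _ => True) (k j)} c = c := by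
      ext k; simp [restrictFreq_apply]
    rw [hT] at k2
    simp only [Finset.filter_true] at k2
    simp only [k1, k2, enorm_rpow_eq_ofReal _ hpr.le]
    rw [lintegral_circ_eq ((continuous_circPoly _ _).norm.rpow_const fun _ => Or.inr hpr.le)
      fun x => by positivity,
      lintegral_circ_eq ((continuous_circPoly _ _).norm.rpow_const fun _ => Or.inr hpr.le)
      fun x => by positivity, mul_left_comm]
    refine mul_le_mul_right ?_ _
    rw [show ((Real.toNNReal K : ℝ≥0) : ℝ≥0∞) = ENNReal.ofReal K from rfl, ← ENNReal.ofReal_mul hK]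
    exact ENNReal.ofReal_le_ofReal (h.shift a _ _)

theorem HasLpBound.finset_inter {ι : Type*} {p : ℝ≥0∞} {S : ι → Set (Fin n → ℤ)} {C : ℝ≥0}
    (s : Finset ι) (h : ∀ i ∈ s, HasLpBound E p (S i) C) :
    HasLpBound E p {k | ∀ i ∈ s, k ∈ S i} (C ^ s.card) := by
  classical
  induction s using Finset.induction_on with
  | empty => simpa using HasLpBound.univ
  | insert i s hi ih =>
    have h1 := (h i (Finset.mem_insert_self _ _)).inter
      (ih fun i' hi' => h i' (Finset.mem_insert_of_mem hi'))
    have h2 : S i ∩ {k | ∀ i ∈ s, k ∈ S i} = {k | ∀ i' ∈ insert i s, k ∈ S i'} := by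
      ext k; simp
    rw [h2] at h1
    rwa [Finset.card_insert_of_notMem hi, pow_succ']

/-- In each direction the slab is the half-space from α_j intersected with the complement of the one
from β_j + 1. The bound does not see the thresholds, hence not the box. -/
theorem exists_hasLpBound_Icc [NeZero n] [CompleteSpace E] (h : IsUMD n E) {p : ℝ≥0∞} (hp : 1 < p)
    (hp' : p < ∞) : ∃ C : ℝ≥0, ∀ α β : Fin n → ℤ, HasLpBound E p (Set.Icc α β) C := by
  obtain ⟨r, A, hr, hA, hrA⟩ := exists_isRieszBound_of_isUMD h
  have hpr1 : 1 < p.toReal := by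
    rw [← ENNReal.toReal_one]
    exact (ENNReal.toReal_lt_toReal ENNReal.one_ne_top hp'.ne).2 hp
  obtain ⟨K, hK, hpK⟩ := exists_isRieszBound hpr1 hr hA hrA
  set C := Real.toNNReal K ^ (1 / p.toReal) with hC
  refine ⟨(C * (1 + C)) ^ n, fun α β => ?_⟩
  have h1 : ∀ j : Fin n, HasLpBound E p {k : Fin n → ℤ | α j ≤ k j ∧ k j ≤ β j} (C * (1 + C)) := by
    intro j
    have h2 := (hpK.hasLpBound hp hp' hK j (α j)).inter
      ((hpK.hasLpBound hp hp' hK j (β j + 1)).compl hp.le)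
    convert h2 using 1
    ext k
    simp only [Set.mem_inter_iff, Set.mem_ofPred_eq, Set.mem_compl_iff]
    omega
  have h3 := HasLpBound.finset_inter Finset.univ fun j _ => h1 j
  rw [Finset.card_univ, Fintype.card_fin] at h3
  convert h3 using 1
  ext k
  simp only [Set.mem_Icc, Pi.le_def, Finset.mem_univ, true_implies, Set.mem_ofPred_eq]
  exact forall_and.symm

end TorusIntegration
-- Summation by parts on a box
section VariationIdentity

variable {n : ℕ} {V : Type*} [NormedAddCommGroup V]

/-- The difference in direction `j`, with the value itself on the face `x j = α j`. -/
def faceDiff (α : Fin n → ℤ) (j : Fin n) (g : (Fin n → ℤ) → V) (x : Fin n → ℤ) : V :=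
  if x j = α j then g x else g x - g (x - Pi.single j 1)

/-- The default value 0 of `diffOp` on a face is never reached: only directions with x j ≠ α j are
differenced, and a shift in direction j leaves the other coordinates unchanged. -/
theorem foldr_diffOp_eq (α : Fin n → ℤ) (γ : Finset (Fin n)) (g : (Fin n → ℤ) → V)
    (l : List (Fin n)) (hl : l.Nodup) (x : Fin n → ℤ) (hx : ∀ i ∈ l, (i ∈ γ ↔ x i ≠ α i)) :
    l.foldr (fun j h => if j ∈ γ then diffOp α j h else h) g x = l.foldr (faceDiff α) g x := by
  induction l generalizing x with
  | nil => rfl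
  | cons j l ih =>
    rw [List.nodup_cons] at hl
    have h1 := ih hl.2 x fun i hi => hx i (List.mem_cons_of_mem _ hi)
    have hj := hx j List.mem_cons_self
    simp only [List.foldr_cons, faceDiff]
    by_cases h : x j = α j
    · rw [if_neg (by simpa [h] using hj), if_pos h, h1]
    · rw [if_pos (hj.2 h), if_neg h, diffOp, if_neg h, h1]
      congr 1
      refine ih hl.2 _ fun i hi => ?_
      have hij : i ≠ j := fun e => hl.1 (e ▸ hi)
      simpa [hij] using hx i (List.mem_cons_of_mem _ hi)

theorem diffIter_eq_foldr (α ξ : Fin n → ℤ) (g : (Fin n → ℤ) → V) :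
    diffIter α (Finset.univ.filter fun j => ξ j ≠ α j) g ξ
      = (List.finRange n).foldr (faceDiff α) g ξ :=
  foldr_diffOp_eq α _ g _ (List.nodup_finRange n) ξ fun i _ => by simp

/-- Summation in direction `j`, starting from the face `x j = α j`. -/
def faceSum (α : Fin n → ℤ) (h : (Fin n → ℤ) → V) (j : Fin n) (x : Fin n → ℤ) : V :=
  ∑ t ∈ Finset.Icc (α j) (x j), h (Function.update x j t)

theorem sum_Icc_telescope (G : ℤ → V) {a b : ℤ} (hab : a ≤ b) :
    ∑ t ∈ Finset.Icc a b, (if t = a then G t else G t - G (t - 1)) = G b := by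
  induction b, hab using Int.leInduction with
  | base => simp
  | succ b hb ih =>
    have : Finset.Icc a (b + 1) = insert (b + 1) (Finset.Icc a b) := by
      ext t; simp only [Finset.mem_Icc, Finset.mem_insert]; omega
    rw [this, Finset.sum_insert (by simp), ih, if_neg (by omega), add_sub_cancel_right]
    abel

theorem faceSum_faceDiff (α : Fin n → ℤ) (j : Fin n) (g : (Fin n → ℤ) → V) (x : Fin n → ℤ)
    (hx : α j ≤ x j) : faceSum α (faceDiff α j g) j x = g x := by
  have h := sum_Icc_telescope (fun t => g (Function.update x j t)) hx
  rw [Function.update_eq_self] at h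
  rw [faceSum, ← h]
  refine Finset.sum_congr rfl fun t _ => ?_
  have : Function.update x j t - Pi.single j 1 = Function.update x j (t - 1) := by
    ext i
    by_cases hi : i = j
    · subst hi; simp
    · simp [hi]
  simp only [faceDiff, Function.update_self, this]

theorem foldl_faceSum_congr (α : Fin n → ℤ) (l : List (Fin n)) (h h' : (Fin n → ℤ) → V)
    (hh : ∀ y, α ≤ y → h y = h' y) (x : Fin n → ℤ) (hx : α ≤ x) :
    l.foldl (faceSum α) h x = l.foldl (faceSum α) h' x := by
  induction l generalizing h h' with
  | nil => exact hh x hx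
  | cons j l ih =>
    refine ih _ _ fun y hy => ?_
    refine Finset.sum_congr rfl fun t ht => hh _ ?_
    intro i
    by_cases hi : i = j
    · subst hi; simpa using (Finset.mem_Icc.1 ht).1
    · simpa [hi] using hy i

/-- The outermost difference is telescoped by the first summation, so `foldl` undoes `foldr`. The
cancellation holds only at points above α, but the remaining sums evaluate nothing else. -/
theorem foldl_faceSum_foldr_faceDiff (α : Fin n → ℤ) (l : List (Fin n)) (g : (Fin n → ℤ) → V)
    (x : Fin n → ℤ) (hx : α ≤ x) : l.foldl (faceSum α) (l.foldr (faceDiff α) g) x = g x := by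
  induction l with
  | nil => rfl
  | cons j l ih =>
    rw [List.foldl_cons, List.foldr_cons, ← ih]
    exact foldl_faceSum_congr α l _ _ (fun y hy => faceSum_faceDiff α j _ y (hy j)) x hx

theorem foldl_faceSum_eq_sum (α : Fin n → ℤ) (l : List (Fin n)) (hl : l.Nodup)
    (h : (Fin n → ℤ) → V) (x : Fin n → ℤ) :
    l.foldl (faceSum α) h x
      = ∑ η ∈ Fintype.piFinset (fun i => if i ∈ l then Finset.Icc (α i) (x i) else {x i}), h η := by
  induction l generalizing h with
  | nil =>
    have : Fintype.piFinset (fun i => if i ∈ ([] : List (Fin n)) then Finset.Icc (α i) (x i)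
        else {x i}) = {x} := by
      ext η; simp [funext_iff]
    rw [this]; simp
  | cons j l ih =>
    rw [List.nodup_cons] at hl
    rw [List.foldl_cons, ih hl.2]
    have hjx : ∀ η ∈ Fintype.piFinset (fun i => if i ∈ l then Finset.Icc (α i) (x i) else {x i}),
        η j = x j := by
      intro η hη
      have := Fintype.mem_piFinset.1 hη j
      simpa [hl.1] using this
    have h1 : ∀ η ∈ Fintype.piFinset (fun i => if i ∈ l then Finset.Icc (α i) (x i) else {x i}),
        faceSum α h j η = ∑ t ∈ Finset.Icc (α j) (x j), h (Function.update η j t) := by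
      intro η hη
      rw [faceSum, hjx η hη]
    rw [Finset.sum_congr rfl h1, ← Finset.sum_product']
    refine Finset.sum_nbij' (fun q => Function.update q.1 j q.2)
      (fun ζ => (Function.update ζ j (x j), ζ j)) ?_ ?_ ?_ ?_ ?_
    · rintro ⟨η, t⟩ hq
      rw [Finset.mem_product] at hq
      rw [Fintype.mem_piFinset]
      intro i
      by_cases hi : i = j
      · subst hi; simpa using hq.2
      · simpa [hi] using Fintype.mem_piFinset.1 hq.1 i
    · intro ζ hζ
      rw [Fintype.mem_piFinset] at hζ
      rw [Finset.mem_product, Fintype.mem_piFinset]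
      refine ⟨fun i => ?_, by simpa using hζ j⟩
      by_cases hi : i = j
      · subst hi; simp [hl.1]
      · simpa [hi] using hζ i
    · rintro ⟨η, t⟩ hq
      rw [Finset.mem_product] at hq
      have := hjx η hq.1
      simp [← this]
    · intro ζ _; simp
    · intro q _; rfl

/-- A discrete fundamental theorem of calculus: the summands are exactly the terms of the variation,
so M becomes a superposition of box indicators whose weights have summable norm. -/
theorem sum_diffIter_eq (α x : Fin n → ℤ) (hx : α ≤ x) (g : (Fin n → ℤ) → V) :
    ∑ η ∈ Finset.Icc α x, diffIter α (Finset.univ.filter fun j => η j ≠ α j) g η = g x := by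
  simp only [diffIter_eq_foldr]
  rw [← foldl_faceSum_foldr_faceDiff α (List.finRange n) g x hx,
    foldl_faceSum_eq_sum α _ (List.nodup_finRange n)]
  simp only [List.mem_finRange, if_true]
  rfl

theorem boxVar_nonneg (α β : Fin n → ℤ) (M : (Fin n → ℤ) → V) : 0 ≤ boxVar α β M :=
  Finset.sum_nonneg fun _ _ => norm_nonneg _

theorem boxVar_le_coarseVar [NeZero n] (M : (Fin n → ℤ) → V) (pos : Bool) (r : ℕ) (l : Fin n) :
    boxVar (blockLower pos r l) (blockUpper pos r l) M ≤ coarseVar M (n * r + l + 1) := by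
  have h1 : (n * r + (l : ℕ)) / n = r := by
    rw [Nat.mul_add_div (NeZero.pos n), Nat.div_eq_of_lt l.2, add_zero]
  have h2 : Fin.ofNat n (n * r + l) = l := by
    ext
    simp [Fin.ofNat, Nat.mod_eq_of_lt l.2]
  rw [coarseVar, h1, h2]
  have := boxVar_nonneg (blockLower true r l) (blockUpper true r l) M
  have := boxVar_nonneg (blockLower false r l) (blockUpper false r l) M
  cases pos <;> linarith

end VariationIdentity

/-! ### Multipliers of bounded variation on boxes and annuli -/

section BoxMultiplier

open MeasureTheory

variable {n : ℕ} {E : Type*} [NormedAddCommGroup E] [NormedSpace ℂ E]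

theorem multiplierPoly_apply (M : (Fin n → ℤ) → (E →L[ℂ] E)) (c : (Fin n → ℤ) →₀ E)
    (x : Fin n → ℝ) : multiplierPoly M c x = ∑ k ∈ c.support, expChar k x • M k (c k) := rfl

theorem continuous_multiplierPoly (M : (Fin n → ℤ) → (E →L[ℂ] E)) (c : (Fin n → ℤ) →₀ E) :
    Continuous (multiplierPoly M c) := by
  unfold multiplierPoly Finsupp.sum
  exact continuous_finsetSum _ fun k _ => (continuous_expChar k).smul continuous_const

theorem trigPoly_restrictFreq (S : Set (Fin n → ℤ)) (c : (Fin n → ℤ) →₀ E) (x : Fin n → ℝ) :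
    trigPoly (restrictFreq S c) x = ∑ k ∈ c.support, expChar k x • S.indicator c k := by
  rw [trigPoly_apply]
  simp only [← restrictFreq_apply]
  refine Finset.sum_subset ?_ fun k _ hk => ?_
  · intro k hk
    rw [Finsupp.mem_support_iff, restrictFreq_apply] at hk
    rw [Finsupp.mem_support_iff]
    intro h
    apply hk
    simp [h]
  · rw [Finsupp.notMem_support_iff.1 hk, smul_zero]

/-- On the box, M = ∑_η D_η 1_{[η,β]}, since η contributes at k exactly when η ≤ k. The triangle
inequality then needs only a bound for box projections that does not depend on the box. -/
theorem torusNorm_boxMultiplier_le {p : ℝ≥0∞} (hp : 1 ≤ p) {C : ℝ≥0}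
    (hC : ∀ α β : Fin n → ℤ, HasLpBound E p (Set.Icc α β) C) (α β : Fin n → ℤ)
    (M : (Fin n → ℤ) → (E →L[ℂ] E)) (c : (Fin n → ℤ) →₀ E) :
    torusNorm p (multiplierPoly ((Set.Icc α β).indicator M) c)
      ≤ ENNReal.ofReal (boxVar α β M) * C * torusNorm p (trigPoly c) := by
  set D : (Fin n → ℤ) → (E →L[ℂ] E) := fun η =>
    diffIter α (Finset.univ.filter fun j => η j ≠ α j) ((Set.Icc α β).indicator M) η with hD
  have h1 : multiplierPoly ((Set.Icc α β).indicator M) c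
      = ∑ η ∈ Finset.Icc α β, fun x => D η (trigPoly (restrictFreq (Set.Icc η β) c) x) := by
    ext x
    rw [Finset.sum_apply]
    simp only [trigPoly_restrictFreq, map_sum, map_smul, multiplierPoly_apply]
    rw [Finset.sum_comm]
    refine Finset.sum_congr rfl fun k _ => ?_
    rw [← Finset.smul_sum]
    congr 1
    by_cases hk : k ∈ Set.Icc α β
    · rw [← sum_diffIter_eq α k hk.1 ((Set.Icc α β).indicator M), sum_apply]
      refine Finset.sum_subset_zero_on_sdiff (Finset.Icc_subset_Icc_right hk.2) ?_ ?_
      · intro η hη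
        rw [Finset.mem_sdiff, Finset.mem_Icc, Finset.mem_Icc] at hη
        rw [Set.indicator_of_notMem, map_zero]
        exact fun h => hη.2 ⟨hη.1.1, h.1⟩
      · intro η hη
        rw [Set.indicator_of_mem (show k ∈ Set.Icc η β from ⟨(Finset.mem_Icc.1 hη).2, hk.2⟩)]
    · rw [Set.indicator_of_notMem hk, zero_apply]
      refine (Finset.sum_eq_zero fun η hη => ?_).symm
      rw [Set.indicator_of_notMem, map_zero]
      exact fun h => hk ⟨(Finset.mem_Icc.1 hη).1.trans h.1, h.2⟩
  have hcont : ∀ η, Continuous fun x => D η (trigPoly (restrictFreq (Set.Icc η β) c) x) := fun η =>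
    (D η).continuous.comp (continuous_trigPoly _)
  have h2 : ∀ η, torusNorm p (fun x => D η (trigPoly (restrictFreq (Set.Icc η β) c) x))
      ≤ ENNReal.ofReal ‖D η‖ * (C * torusNorm p (trigPoly c)) := by
    intro η
    refine le_trans ?_ (mul_le_mul_right (hC η β c) _)
    have := eLpNorm_le_nnreal_smul_eLpNorm_of_ae_le_mul (μ := torusMeasure n) (c := ‖D η‖₊)
      (f := fun x => D η (trigPoly (restrictFreq (Set.Icc η β) c) x))
      (g := trigPoly (restrictFreq (Set.Icc η β) c))
      (Filter.Eventually.of_forall fun x => (D η).le_opNNNorm _) p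
    rw [ENNReal.smul_def, smul_eq_mul] at this
    rw [ofReal_norm]
    exact this
  calc torusNorm p (multiplierPoly ((Set.Icc α β).indicator M) c)
      ≤ ∑ η ∈ Finset.Icc α β, torusNorm p
          (fun x => D η (trigPoly (restrictFreq (Set.Icc η β) c) x)) := by
        rw [h1]
        exact eLpNorm_sum_le (fun η _ => (hcont η).aestronglyMeasurable) hp
    _ ≤ ∑ η ∈ Finset.Icc α β, ENNReal.ofReal ‖D η‖ * (C * torusNorm p (trigPoly c)) :=
        Finset.sum_le_sum fun η _ => h2 η
    _ = _ := by
        rw [← Finset.sum_mul, ← ENNReal.ofReal_sum_of_nonneg fun _ _ => norm_nonneg _, mul_assoc]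
        rfl

/-! ### Coarse blocks and annuli -/

/-- The boxes of the coarse decomposition; `none` stands for `{0}`. -/
def coarseBox : Option (Bool × ℕ × Fin n) → Set (Fin n → ℤ)
  | none => Set.Icc 0 0
  | some (pos, r, l) => Set.Icc (blockLower pos r l) (blockUpper pos r l)

theorem mem_coarseBox_some {pos : Bool} {r : ℕ} {l : Fin n} {k : Fin n → ℤ} :
    k ∈ coarseBox (some (pos, r, l)) ↔
      k ∈ coarseBlock r l ∧ if pos then 0 < k l else k l < 0 := by
  rw [coarseBox, Icc_blockLower_blockUpper]; rfl

/-- A nonzero k determines its box: 2^r ≤ max |k_i| < 2^(r+1) fixes r, l is the last coordinate that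
reaches 2^r, and the sign of k_l fixes the half. -/
theorem coarseBox_disjoint {b b' : Option (Bool × ℕ × Fin n)} {k : Fin n → ℤ}
    (h : k ∈ coarseBox b) (h' : k ∈ coarseBox b') : b = b' := by
  have hzero : ∀ q : Bool × ℕ × Fin n, k ∈ coarseBox (some q) → k ≠ 0 := by
    rintro ⟨pos, r, l⟩ hk rfl
    have := (mem_coarseBox_some.1 hk).2
    cases pos <;> simp at this
  have hnone : k ∈ coarseBox none → k = 0 := fun hk => le_antisymm hk.2 hk.1
  rcases b with _ | ⟨pos, r, l⟩ <;> rcases b' with _ | ⟨pos', r', l'⟩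
  · rfl
  · exact absurd (hnone h) (hzero _ h')
  · exact absurd (hnone h') (hzero _ h)
  · obtain ⟨⟨h1, ⟨h2, h2'⟩, h3⟩, h4⟩ := mem_coarseBox_some.1 h
    obtain ⟨⟨g1, ⟨g2, g2'⟩, g3⟩, g4⟩ := mem_coarseBox_some.1 h'
    have hub : ∀ i, |k i| < 2 ^ (r + 1) := by
      intro i
      rcases lt_trichotomy i l with hi | rfl | hi
      · exact h1 i hi
      · exact h2'
      · exact (h3 i hi).trans (pow_lt_pow_right₀ (by norm_num) (Nat.lt_succ_self r))
    have gub : ∀ i, |k i| < 2 ^ (r' + 1) := by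
      intro i
      rcases lt_trichotomy i l' with hi | rfl | hi
      · exact g1 i hi
      · exact g2'
      · exact (g3 i hi).trans (pow_lt_pow_right₀ (by norm_num) (Nat.lt_succ_self r'))
    have hr : r = r' := by
      refine le_antisymm ?_ ?_
      · have := (pow_lt_pow_iff_right₀ (by norm_num : (1 : ℤ) < 2)).1 (h2.trans_lt (gub l))
        omega
      · have := (pow_lt_pow_iff_right₀ (by norm_num : (1 : ℤ) < 2)).1 (g2.trans_lt (hub l'))
        omega
    subst hr
    have hl : l = l' := by
      refine le_antisymm ?_ ?_
      · by_contra! hlt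
        exact absurd (g3 l hlt) (not_lt.2 h2)
      · by_contra! hlt
        exact absurd (h3 l' hlt) (not_lt.2 g2)
    subst hl
    cases pos <;> cases pos' <;> simp at h4 g4 ⊢ <;> omega

theorem exists_mem_coarseBox {k : Fin n → ℤ} (hk : k ≠ 0) :
    ∃ (pos : Bool) (r : ℕ) (l : Fin n), k ∈ coarseBox (some (pos, r, l)) := by
  classical
  obtain ⟨i0, hi0⟩ := Function.ne_iff.1 hk
  obtain ⟨m, -, hm⟩ := Finset.exists_max_image Finset.univ (fun i => (k i).natAbs) ⟨i0, Finset.mem_univ _⟩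
  have hm0 : (k m).natAbs ≠ 0 := by
    have h1 := hm i0 (Finset.mem_univ _)
    have h2 : (k i0).natAbs ≠ 0 := by simpa using hi0
    omega
  set r := Nat.log 2 (k m).natAbs with hr
  have hlow : 2 ^ r ≤ (k m).natAbs := Nat.pow_log_le_self 2 hm0
  have hup : ∀ i, (k i).natAbs < 2 ^ (r + 1) := fun i =>
    (hm i (Finset.mem_univ _)).trans_lt (Nat.lt_pow_succ_log_self (by norm_num) _)
  obtain ⟨l, hl, hlmax⟩ := Finset.exists_max_image
    (Finset.univ.filter fun i => 2 ^ r ≤ (k i).natAbs) id ⟨m, by simpa using hlow⟩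
  have hl' : 2 ^ r ≤ (k l).natAbs := (Finset.mem_filter.1 hl).2
  have habs : ∀ i, |k i| = ((k i).natAbs : ℤ) := fun i => Int.abs_eq_natAbs _
  refine ⟨decide (0 < k l), r, l, mem_coarseBox_some.2 ⟨⟨fun i _ => ?_, ⟨?_, ?_⟩, fun i hi => ?_⟩, ?_⟩⟩
  · rw [habs]; exact_mod_cast hup i
  · rw [habs]; exact_mod_cast hl'
  · rw [habs]; exact_mod_cast hup l
  · rw [habs]
    by_contra! hcon
    have : i ∈ Finset.univ.filter fun i => 2 ^ r ≤ (k i).natAbs := by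
      simp only [Finset.mem_filter, Finset.mem_univ, true_and]
      exact_mod_cast hcon
    exact absurd (hlmax i this) (not_le.2 hi)
  · have hpos : 0 < 2 ^ r := by positivity
    have : k l ≠ 0 := by
      intro h0; rw [h0] at hl'; simp at hl'
    simp only [decide_eq_true_eq]
    split_ifs <;> omega

theorem abs_le_norm_latticePoint (k : Fin n → ℤ) (i : Fin n) : |(k i : ℝ)| ≤ ‖latticePoint k‖ :=
  PiLp.norm_apply_le (latticePoint k) i

theorem norm_latticePoint_le (k : Fin n → ℤ) {R : ℝ} (hR : 0 ≤ R) (h : ∀ i, |(k i : ℝ)| ≤ R) :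
    ‖latticePoint k‖ ≤ n * R := by
  rw [EuclideanSpace.norm_eq]
  refine Real.sqrt_le_iff.2 ⟨by positivity, ?_⟩
  calc ∑ i, ‖latticePoint k i‖ ^ 2 ≤ ∑ _i : Fin n, R ^ 2 :=
        Finset.sum_le_sum fun i _ => by
          have := h i
          exact pow_le_pow_left₀ (norm_nonneg _) this 2
    _ = n * R ^ 2 := by simp
    _ ≤ (n * R) ^ 2 := by
        rw [mul_pow]
        have : (n : ℝ) ≤ (n : ℝ) ^ 2 := by
          exact_mod_cast Nat.le_self_pow (by norm_num) n
        gcongr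

/-- The boxes of the coarse decomposition that may meet the annulus `Ω_j`. -/
def annulusBoxes (n : ℕ) (j : ℕ) : Finset (Option (Bool × ℕ × Fin n)) :=
  insert none ((Finset.univ ×ˢ Finset.Icc (j - (n + 1)) (j + 1) ×ˢ Finset.univ).map
    Function.Embedding.some)

theorem card_annulusBoxes_le (n j : ℕ) : (annulusBoxes n j).card ≤ 2 * ((n + 3) * n) + 1 := by
  classical
  refine (Finset.card_insert_le _ _).trans ?_
  rw [Finset.card_map, Finset.card_product, Finset.card_product, Nat.card_Icc]
  simp only [Finset.card_univ, Fintype.card_bool, Fintype.card_fin]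
  gcongr
  omega

/-- In a box of level r the Euclidean norm lies between 2^r and n · 2^(r+1) < 2^(n+r+1). Comparison
with the radii of Ω_j confines r to j - (n+1), …, j + 1. -/
theorem exists_mem_annulusBoxes {j : ℕ} {k : Fin n → ℤ} (hk : latticePoint k ∈ annulus n j) :
    ∃ b ∈ annulusBoxes n j, k ∈ coarseBox b := by
  classical
  by_cases h0 : k = 0
  · exact ⟨none, Finset.mem_insert_self _ _, by simp [coarseBox, h0]⟩
  obtain ⟨pos, r, l, hb⟩ := exists_mem_coarseBox h0
  refine ⟨_, Finset.mem_insert_of_mem (Finset.mem_map_of_mem _ ?_), hb⟩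
  obtain ⟨⟨h1, ⟨h2, h2'⟩, h3⟩, -⟩ := mem_coarseBox_some.1 hb
  have hub : ∀ i, |k i| < 2 ^ (r + 1) := by
    intro i
    rcases lt_trichotomy i l with hi | rfl | hi
    · exact h1 i hi
    · exact h2'
    · exact (h3 i hi).trans (pow_lt_pow_right₀ (by norm_num) (Nat.lt_succ_self r))
  have hlow : (2 : ℝ) ^ r ≤ ‖latticePoint k‖ := by
    refine le_trans ?_ (abs_le_norm_latticePoint k l)
    exact_mod_cast h2
  have hup : ‖latticePoint k‖ < 2 ^ (n + (r + 1)) := by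
    have h4 := norm_latticePoint_le k (R := 2 ^ (r + 1)) (by positivity) fun i => by
      exact_mod_cast (hub i).le
    refine h4.trans_lt ?_
    rw [pow_add _ n]
    have : (n : ℝ) < 2 ^ n := by exact_mod_cast Nat.lt_two_pow_self
    have h5 : (0 : ℝ) < 2 ^ (r + 1) := by positivity
    exact mul_lt_mul_of_pos_right this h5
  simp only [Finset.mem_product, Finset.mem_univ, true_and, and_true, Finset.mem_Icc]
  have hanU : ‖latticePoint k‖ ≤ 2 ^ (j + 1) := by
    cases j with
    | zero => simpa [annulus] using hk
    | succ j => exact hk.2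
  constructor
  · cases j with
    | zero => simp
    | succ j =>
      have := (pow_lt_pow_iff_right₀ (by norm_num : (1 : ℝ) < 2)).1 (hk.1.trans_lt hup)
      omega
  · exact (pow_le_pow_iff_right₀ (by norm_num : (1 : ℝ) < 2)).1 (hlow.trans hanU)

theorem exists_annulus_multiplier_bound [NeZero n] {p : ℝ≥0∞} (hp : 1 ≤ p) {C : ℝ≥0}
    (hC : ∀ α β : Fin n → ℤ, HasLpBound E p (Set.Icc α β) C) {M : (Fin n → ℤ) → (E →L[ℂ] E)}
    (hM : IsCoarseBV M) : ∃ K : ℝ≥0, ∀ (j : ℕ) (c : (Fin n → ℤ) →₀ E),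
      (∀ k ∈ c.support, latticePoint k ∈ annulus n j) →
      torusNorm p (multiplierPoly M c) ≤ K * torusNorm p (trigPoly c) := by
  classical
  obtain ⟨-, V, hV⟩ := hM
  refine ⟨(2 * ((n + 3) * n) + 1 : ℕ) * (Real.toNNReal V * C), fun j c hc => ?_⟩
  have h1 : multiplierPoly M c
      = ∑ b ∈ annulusBoxes n j, multiplierPoly ((coarseBox b).indicator M) c := by
    ext x
    rw [Finset.sum_apply]
    simp only [multiplierPoly_apply]
    rw [Finset.sum_comm]
    refine Finset.sum_congr rfl fun k hk => ?_
    rw [← Finset.smul_sum]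
    congr 1
    obtain ⟨b, hb, hkb⟩ := exists_mem_annulusBoxes (hc k hk)
    rw [Finset.sum_eq_single b]
    · rw [Set.indicator_of_mem hkb]
    · intro b' _ hne
      rw [Set.indicator_of_notMem fun h => hne (coarseBox_disjoint h hkb), zero_apply]
    · intro h; exact absurd hb h
  have h2 : ∀ b, torusNorm p (multiplierPoly ((coarseBox b).indicator M) c)
      ≤ ((Real.toNNReal V * C : ℝ≥0) : ℝ≥0∞) * torusNorm p (trigPoly c) := by
    intro b
    have key : ∀ α β : Fin n → ℤ, boxVar α β M ≤ V →
        torusNorm p (multiplierPoly ((Set.Icc α β).indicator M) c)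
        ≤ ((Real.toNNReal V * C : ℝ≥0) : ℝ≥0∞) * torusNorm p (trigPoly c) := by
      intro α β hle
      refine (torusNorm_boxMultiplier_le hp hC α β M c).trans ?_
      rw [ENNReal.coe_mul]
      gcongr
      exact ENNReal.ofReal_le_ofReal hle
    rcases b with _ | ⟨pos, r, l⟩
    · exact key 0 0 (hV 0)
    · exact key _ _ ((boxVar_le_coarseVar M pos r l).trans (hV _))
  calc torusNorm p (multiplierPoly M c)
      ≤ ∑ b ∈ annulusBoxes n j, torusNorm p (multiplierPoly ((coarseBox b).indicator M) c) := by
        rw [h1]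
        exact eLpNorm_sum_le (fun b _ => (continuous_multiplierPoly _ c).aestronglyMeasurable) hp
    _ ≤ ∑ b ∈ annulusBoxes n j, ((Real.toNNReal V * C : ℝ≥0) : ℝ≥0∞) * torusNorm p (trigPoly c) :=
        Finset.sum_le_sum fun b _ => h2 b
    _ = (annulusBoxes n j).card * (((Real.toNNReal V * C : ℝ≥0) : ℝ≥0∞) * torusNorm p (trigPoly c)) := by
        rw [Finset.sum_const, nsmul_eq_mul]
    _ ≤ _ := by
        rw [← mul_assoc, ENNReal.coe_mul _ (Real.toNNReal V * C)]
        refine mul_le_mul' (mul_le_mul' ?_ le_rfl) le_rfl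
        exact_mod_cast card_annulusBoxes_le n j

end BoxMultiplier
-- Fourier coefficients of test functions and distributions
section Fourier

open MeasureTheory

variable {n : ℕ}

/-! ### Integration over the torus, one coordinate at a time -/

theorem measurePreserving_update (j : Fin n) :
    MeasurePreserving (fun q : (Fin n → ℝ) × ℝ => Function.update q.1 j q.2)
      ((torusMeasure n).prod circMeasure) (torusMeasure n) := by
  have hm : Measurable (fun q : (Fin n → ℝ) × ℝ => Function.update q.1 j q.2) := measurable_update'
  refine ⟨hm, ?_⟩
  ext s hs
  rw [Measure.map_apply hm hs, Measure.prod_apply (hm hs), ← lintegral_indicator_one hs,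
    lintegral_torus_update j (measurable_one.indicator hs)]
  refine lintegral_congr fun x => ?_
  rw [← lintegral_indicator_one]
  · rfl
  · exact (hm.comp measurable_prodMk_left) hs

theorem integral_torus_update (j : Fin n) {F : (Fin n → ℝ) → ℂ} (hF : Continuous F) {B : ℝ}
    (hB : ∀ x, ‖F x‖ ≤ B) : ∫ x, F x ∂torusMeasure n
      = ∫ x, ∫ t, F (Function.update x j t) ∂circMeasure ∂torusMeasure n := by
  have hmp := measurePreserving_update j
  rw [← hmp.map_eq, integral_map hmp.measurable.aemeasurable hF.aestronglyMeasurable,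
    hmp.map_eq, integral_prod]
  refine Integrable.of_bound (C := B) ?_ (Filter.Eventually.of_forall fun q => hB _)
  exact (hF.measurable.comp hmp.measurable).aestronglyMeasurable

theorem integral_circ_eq (f : ℝ → ℂ) :
    ∫ t, f t ∂circMeasure = ((2 * Real.pi : ℝ) : ℂ)⁻¹ * ∫ t in (0 : ℝ)..2 * Real.pi, f t := by
  have hpi : (0 : ℝ) ≤ 2 * Real.pi := by have := Real.pi_pos; positivity
  rw [circMeasure, integral_smul_measure, intervalIntegral.integral_of_le hpi,
    integral_Icc_eq_integral_Ioc, ENNReal.toReal_inv, ENNReal.toReal_ofReal hpi, Complex.real_smul]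
  push_cast
  rfl

theorem integral_expChar (k : Fin n → ℤ) :
    ∫ x, expChar k x ∂torusMeasure n = if k = 0 then 1 else 0 := by
  split_ifs with h
  · subst h; simp [expChar]
  · obtain ⟨j, hj⟩ := Function.ne_iff.1 h
    rw [integral_torus_update j (continuous_expChar k) fun x => (norm_expChar k x).le]
    have h1 : ∀ x : Fin n → ℝ, ∫ t, expChar k (Function.update x j t) ∂circMeasure = 0 := by
      intro x
      rw [integral_congr_ae (Filter.Eventually.of_forall fun t => expChar_update k x j t),
        integral_mul_const, integral_circ_eq, integral_circChar, if_neg (by simpa using hj)]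
      simp
    simp only [h1, integral_zero]

theorem expChar_add (k l : Fin n → ℤ) (x : Fin n → ℝ) :
    expChar (k + l) x = expChar k x * expChar l x := by
  rw [expChar, expChar, expChar, ← Complex.exp_add, ← mul_add, ← Complex.ofReal_add,
    ← Finset.sum_add_distrib]
  congr 3
  refine Finset.sum_congr rfl fun i _ => ?_
  rw [Pi.add_apply]; push_cast; ring

theorem integral_expChar_mul (k l : Fin n → ℤ) :
    ∫ x, expChar k x * expChar (-l) x ∂torusMeasure n = if k = l then 1 else 0 := by
  simp only [← expChar_add, integral_expChar, ← sub_eq_add_neg, sub_eq_zero]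

/-! ### Decay of the Fourier coefficients of smooth functions -/

theorem hasDerivAt_circChar (m : ℤ) (t : ℝ) :
    HasDerivAt (circChar m) (Complex.I * m * circChar m t) t := by
  have h : HasDerivAt (fun t : ℝ => Complex.I * ((m * t : ℝ) : ℂ)) (Complex.I * m) t := by
    have h1 : HasDerivAt (fun t : ℝ => (m * t : ℝ)) (m : ℝ) t := by
      simpa using (hasDerivAt_id t).const_mul (m : ℝ)
    simpa using (h1.ofReal_comp).const_mul Complex.I
  have := h.cexp
  rw [mul_comm] at this
  exact this

/-- Integrate by parts N times; periodicity cancels the boundary terms. -/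
theorem norm_integral_mul_circChar_le (N : ℕ) (m : ℤ) {g : ℝ → ℂ}
    (hg : ContDiff ℝ ((⊤ : ℕ∞) : WithTop ℕ∞) g) (hper : Function.Periodic g (2 * Real.pi)) {B : ℝ}
    (hB : ∀ t, ‖iteratedDeriv N g t‖ ≤ B) :
    |(m : ℝ)| ^ N * ‖∫ t in (0 : ℝ)..2 * Real.pi, g t * circChar m t‖ ≤ 2 * Real.pi * B := by
  have hpi : (0 : ℝ) ≤ 2 * Real.pi := by have := Real.pi_pos; positivity
  induction N generalizing g with
  | zero =>
    have h1 : ∀ t ∈ Set.uIoc 0 (2 * Real.pi), ‖g t * circChar m t‖ ≤ B := by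
      intro t _
      simpa using hB t
    have h2 := intervalIntegral.norm_integral_le_of_norm_le_const h1
    rw [sub_zero, abs_of_nonneg hpi] at h2
    rw [pow_zero, one_mul]
    linarith
  | succ N ih =>
    have hg1 : ContDiff ℝ ((⊤ : ℕ∞) : WithTop ℕ∞) (deriv g) :=
      ((contDiff_infty_iff_deriv).1 hg).2
    have hdiff : Differentiable ℝ g := ((contDiff_infty_iff_deriv).1 hg).1
    have hper1 : Function.Periodic (deriv g) (2 * Real.pi) := by
      intro t
      rw [← deriv_comp_add_const]
      congr 1
      ext s
      exact hper s
    have h1 := ih hg1 hper1 (fun t => by rw [← iteratedDeriv_succ']; exact hB t)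
    have h2 := intervalIntegral.integral_deriv_mul_eq_sub (a := 0) (b := 2 * Real.pi)
      (u := g) (v := circChar m) (fun t _ => (hdiff t).hasDerivAt)
      (fun t _ => hasDerivAt_circChar m t) (hg1.continuous.intervalIntegrable _ _)
      ((continuous_const.mul (continuous_circChar m)).intervalIntegrable _ _)
    have e1 := hper 0
    have e2 := circChar_periodic m 0
    rw [zero_add] at e1 e2
    have h5 := intervalIntegral.integral_add (μ := volume) (a := 0) (b := 2 * Real.pi)
      (f := fun t => deriv g t * circChar m t) (g := fun t => g t * (Complex.I * m * circChar m t))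
      ((hg1.continuous.mul (continuous_circChar m)).intervalIntegrable _ _)
      ((hg.continuous.mul (continuous_const.mul (continuous_circChar m))).intervalIntegrable _ _)
    rw [e1, e2, sub_self, h5] at h2
    have h3 : ∫ t in (0 : ℝ)..2 * Real.pi, g t * (Complex.I * m * circChar m t)
        = Complex.I * m * ∫ t in (0 : ℝ)..2 * Real.pi, g t * circChar m t := by
      rw [← intervalIntegral.integral_const_mul]
      congr 1; ext t; ring
    rw [h3] at h2
    have h4 : ‖∫ t in (0 : ℝ)..2 * Real.pi, deriv g t * circChar m t‖
        = |(m : ℝ)| * ‖∫ t in (0 : ℝ)..2 * Real.pi, g t * circChar m t‖ := by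
      rw [eq_neg_of_add_eq_zero_left h2, norm_neg, norm_mul, norm_mul, Complex.norm_I, one_mul,
        Complex.norm_intCast]
    rw [h4] at h1
    rw [pow_succ, mul_assoc]
    exact h1

/-- Moving along a coordinate line is composition with a linear map of norm at most 1 and a
translation. -/
theorem norm_iteratedDeriv_update_le {ψ : (Fin n → ℝ) → ℂ}
    (hψ : ContDiff ℝ ((⊤ : ℕ∞) : WithTop ℕ∞) ψ) (N : ℕ) {B : ℝ}
    (hB : ∀ x, ‖iteratedFDeriv ℝ N ψ x‖ ≤ B) (x : Fin n → ℝ) (j : Fin n) :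
    ContDiff ℝ ((⊤ : ℕ∞) : WithTop ℕ∞) (fun t => ψ (Function.update x j t)) ∧
      ∀ t, ‖iteratedDeriv N (fun t => ψ (Function.update x j t)) t‖ ≤ B := by
  set Lj := ContinuousLinearMap.single ℝ (fun _ : Fin n => ℝ) j with hLj
  set y := Function.update x j 0 with hy
  have h0 : (fun t => ψ (Function.update x j t)) = (fun z => ψ (y + z)) ∘ Lj := by
    ext t
    simp only [Function.comp_apply]
    congr 1
    ext i
    by_cases hi : i = j
    · subst hi; simp [hy, hLj]
    · simp [hy, hLj, hi]
  have h1 : ContDiff ℝ ((⊤ : ℕ∞) : WithTop ℕ∞) (fun z => ψ (y + z)) :=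
    hψ.comp (contDiff_const.add contDiff_id)
  rw [h0]
  refine ⟨h1.comp Lj.contDiff, fun t => ?_⟩
  rw [← norm_iteratedFDeriv_eq_norm_iteratedDeriv,
    ContinuousLinearMap.iteratedFDeriv_comp_right Lj h1 t (i := N) (by exact_mod_cast le_top),
    iteratedFDeriv_comp_add_left]
  refine (ContinuousMultilinearMap.norm_compContinuousLinearMap_le _ _).trans ?_
  rw [Finset.prod_const]
  have h2 : ‖Lj‖ ≤ 1 := ContinuousLinearMap.norm_single_le_one ℝ (fun _ : Fin n => ℝ) j
  have h3 : ‖Lj‖ ^ (Finset.univ : Finset (Fin N)).card ≤ 1 := pow_le_one₀ (norm_nonneg _) h2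
  exact (mul_le_of_le_one_right (norm_nonneg _) h3).trans (hB _)

theorem testFunction_update_periodic (ψ : TestFunction n) (x : Fin n → ℝ) (j : Fin n) :
    Function.Periodic (fun t => (ψ : (Fin n → ℝ) → ℂ) (Function.update x j t)) (2 * Real.pi) := by
  intro t
  have h := ψ.2.2 (Function.update x j t) j
  have : Function.update x j t + Pi.single j (2 * Real.pi) = Function.update x j (t + 2 * Real.pi) := by
    ext i
    by_cases hi : i = j
    · subst hi; simp
    · simp [hi]
  rw [this] at h
  exact h

/-- The integral of `ψ e_k` over the torus. -/
def testCoeff (k : Fin n → ℤ) (ψ : TestFunction n) : ℂ :=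
  ∫ x, (ψ : (Fin n → ℝ) → ℂ) x * expChar k x ∂torusMeasure n

theorem abs_pow_mul_norm_testCoeff_le (ψ : TestFunction n) (k : Fin n → ℤ) (j : Fin n) (N : ℕ)
    {B B0 : ℝ} (hB0 : ∀ x, ‖(ψ : (Fin n → ℝ) → ℂ) x‖ ≤ B0)
    (hB : ∀ x, ‖iteratedFDeriv ℝ N (ψ : (Fin n → ℝ) → ℂ) x‖ ≤ B) :
    |(k j : ℝ)| ^ N * ‖testCoeff k ψ‖ ≤ B := by
  have hpi : (0 : ℝ) < 2 * Real.pi := by have := Real.pi_pos; positivity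
  have hcont : Continuous fun x => (ψ : (Fin n → ℝ) → ℂ) x * expChar k x :=
    ψ.2.1.continuous.mul (continuous_expChar k)
  have hin : ∀ x, |(k j : ℝ)| ^ N * ‖∫ t, (ψ : (Fin n → ℝ) → ℂ) (Function.update x j t) *
      expChar k (Function.update x j t) ∂circMeasure‖ ≤ B := by
    intro x
    obtain ⟨h1, h2⟩ := norm_iteratedDeriv_update_le ψ.2.1 N hB x j
    have h3 := norm_integral_mul_circChar_le N (k j) h1 (testFunction_update_periodic ψ x j) h2
    have h4 : ∀ t, (ψ : (Fin n → ℝ) → ℂ) (Function.update x j t) * expChar k (Function.update x j t)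
        = ((ψ : (Fin n → ℝ) → ℂ) (Function.update x j t) * circChar (k j) t) *
          expChar k (Function.update x j 0) := by
      intro t; rw [expChar_update, mul_assoc]
    simp only [h4, integral_mul_const, integral_circ_eq]
    rw [norm_mul, norm_expChar, mul_one, norm_mul, norm_inv, Complex.norm_real,
      Real.norm_of_nonneg hpi.le]
    rw [mul_left_comm, inv_mul_eq_div, div_le_iff₀ hpi]
    linarith
  have hB' : ∀ x, ‖(ψ : (Fin n → ℝ) → ℂ) x * expChar k x‖ ≤ B0 := fun x => by
    rw [norm_mul, norm_expChar, mul_one]; exact hB0 x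
  rw [testCoeff, integral_torus_update j hcont hB']
  have h5 : ‖(|(k j : ℝ)| ^ N : ℂ) * ∫ x, ∫ t, (ψ : (Fin n → ℝ) → ℂ) (Function.update x j t) *
      expChar k (Function.update x j t) ∂circMeasure ∂torusMeasure n‖ ≤ B := by
    rw [← integral_const_mul]
    refine (norm_integral_le_of_norm_le_const (C := B) (Filter.Eventually.of_forall fun x => ?_)).trans ?_
    · rw [norm_mul, norm_pow, Complex.norm_real, norm_abs_eq_norm, Real.norm_eq_abs]
      exact hin x
    · simp
  rwa [norm_mul, norm_pow, Complex.norm_real, norm_abs_eq_norm, Real.norm_eq_abs] at h5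

/-- Integrate by parts in the coordinate where |k_j| is largest, that is, equal to ‖k‖. The factor
2^N absorbs 1 + ‖k‖ ≤ 2‖k‖. -/
theorem norm_testCoeff_mul_le (ψ : TestFunction n) (k : Fin n → ℤ) (N : ℕ) {B : ℝ}
    (hB : ∀ m ≤ N, ∀ x, ‖iteratedFDeriv ℝ m (ψ : (Fin n → ℝ) → ℂ) x‖ ≤ B) :
    (1 + ‖k‖) ^ N * ‖testCoeff k ψ‖ ≤ 2 ^ N * B := by
  have hB0 : ∀ x, ‖(ψ : (Fin n → ℝ) → ℂ) x‖ ≤ B := fun x => by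
    have := hB 0 (Nat.zero_le _) x
    rwa [norm_iteratedFDeriv_zero] at this
  have hBnn : 0 ≤ B := (norm_nonneg _).trans (hB0 0)
  have h0 : ‖testCoeff k ψ‖ ≤ B := by
    refine (norm_integral_le_of_norm_le_const (C := B) (Filter.Eventually.of_forall fun x => ?_)).trans ?_
    · rw [norm_mul, norm_expChar, mul_one]; exact hB0 x
    · simp
  by_cases hk : ‖k‖ ≤ 1
  · calc (1 + ‖k‖) ^ N * ‖testCoeff k ψ‖ ≤ (1 + 1) ^ N * B := by gcongr
      _ = _ := by norm_num
  · push Not at hk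
    have hne : Nonempty (Fin n) := by
      by_contra hemp
      rw [not_nonempty_iff] at hemp
      have : k = 0 := Subsingleton.elim _ _
      rw [this, norm_zero] at hk
      linarith
    obtain ⟨j, -, hj'⟩ := Finset.exists_max_image Finset.univ (fun i => ‖k i‖) Finset.univ_nonempty
    have hj : ‖k j‖ = ‖k‖ := le_antisymm (norm_le_pi_norm k j)
      ((pi_norm_le_iff_of_nonneg (norm_nonneg _)).2 fun i => hj' i (Finset.mem_univ i))
    have h1 := abs_pow_mul_norm_testCoeff_le ψ k j N hB0 (hB N le_rfl)
    have h2 : |(k j : ℝ)| = ‖k‖ := by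
      rw [← hj, Int.norm_eq_abs]
    rw [h2] at h1
    calc (1 + ‖k‖) ^ N * ‖testCoeff k ψ‖ ≤ (2 * ‖k‖) ^ N * ‖testCoeff k ψ‖ := by
          gcongr; linarith
      _ = 2 ^ N * (‖k‖ ^ N * ‖testCoeff k ψ‖) := by ring
      _ ≤ _ := by gcongr

theorem exists_forall_norm_le_of_periodic {F : Type*} [NormedAddCommGroup F] {f : (Fin n → ℝ) → F}
    (hf : Continuous f) (hper : ∀ x j, f (x + Pi.single j (2 * Real.pi)) = f x) :
    ∃ B, ∀ x, ‖f x‖ ≤ B := by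
  classical
  have hpi : (0 : ℝ) < 2 * Real.pi := by have := Real.pi_pos; positivity
  obtain ⟨B, hB⟩ := (isCompact_Icc (a := (0 : Fin n → ℝ)) (b := fun _ => 2 * Real.pi)).exists_bound_of_continuousOn
    hf.continuousOn
  have h1 : ∀ (s : Finset (Fin n)) (x : Fin n → ℝ), ∃ y, f y = f x ∧
      (∀ i ∈ s, y i ∈ Set.Icc 0 (2 * Real.pi)) := by
    intro s x
    induction s using Finset.induction_on with
    | empty => exact ⟨x, rfl, by simp⟩
    | insert j s hj ih =>
      obtain ⟨y, hy, hys⟩ := ih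
      have hp : Function.Periodic (fun t => f (Function.update y j t)) (2 * Real.pi) := by
        intro t
        have h := hper (Function.update y j t) j
        have : Function.update y j t + Pi.single j (2 * Real.pi)
            = Function.update y j (t + 2 * Real.pi) := by
          ext i
          by_cases hi : i = j
          · subst hi; simp
          · simp [hi]
        rw [this] at h
        exact h
      refine ⟨Function.update y j (toIcoMod hpi 0 (y j)), ?_, ?_⟩
      · have := hp.sub_zsmul_eq (x := y j) (toIcoDiv hpi 0 (y j))
        simp only [Function.update_eq_self] at this
        rw [← hy, ← this]
        rfl
      · intro i hi
        have hmem := toIcoMod_mem_Ico hpi 0 (y j)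
        rw [zero_add] at hmem
        by_cases hij : i = j
        · subst hij; simpa using ⟨hmem.1, hmem.2.le⟩
        · rw [Function.update_of_ne hij]
          exact hys i ((Finset.mem_insert.1 hi).resolve_left hij)
  refine ⟨B, fun x => ?_⟩
  obtain ⟨y, hy, hyI⟩ := h1 Finset.univ x
  rw [← hy]
  exact hB y ⟨fun i => (hyI i (Finset.mem_univ _)).1, fun i => (hyI i (Finset.mem_univ _)).2⟩

theorem testSeminorm_lt_top (N : ℕ) (ψ : TestFunction n) : testSeminorm N ψ < ∞ := by
  have h : ∀ m : ℕ, ∃ B : ℝ, ∀ x, ‖iteratedFDeriv ℝ m (ψ : (Fin n → ℝ) → ℂ) x‖ ≤ B := by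
    intro m
    refine exists_forall_norm_le_of_periodic
      (ψ.2.1.continuous_iteratedFDeriv (by exact_mod_cast le_top)) fun x j => ?_
    rw [← iteratedFDeriv_comp_add_right]
    congr 1
    ext y
    exact ψ.2.2 y j
  choose B hB using h
  refine lt_of_le_of_lt (b := ∑ m ∈ Finset.range (N + 1), ENNReal.ofReal (B m)) ?_ ?_
  · refine iSup_le fun m => iSup_le fun hm => iSup_le fun x => ?_
    refine le_trans ?_ (Finset.single_le_sum (f := fun m => ENNReal.ofReal (B m))
      (fun _ _ => zero_le) (Finset.mem_range.2 (Nat.lt_succ_of_le hm)))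
    rw [← ofReal_norm]
    exact ENNReal.ofReal_le_ofReal (hB m x)
  · exact ENNReal.sum_lt_top.2 fun _ _ => ENNReal.ofReal_lt_top

theorem norm_iteratedFDeriv_le_testSeminorm {N m : ℕ} (hm : m ≤ N) (ψ : TestFunction n)
    (x : Fin n → ℝ) :
    ‖iteratedFDeriv ℝ m (ψ : (Fin n → ℝ) → ℂ) x‖ ≤ (testSeminorm N ψ).toReal := by
  rw [← ENNReal.ofReal_le_iff_le_toReal (testSeminorm_lt_top N ψ).ne, ofReal_norm]
  exact le_iSup_of_le m (le_iSup_of_le hm (le_iSup_of_le x le_rfl))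

/-! ### Distributions with prescribed Fourier coefficients -/

/-- In the supremum norm, (1 + ‖k‖)^(-2n) is at most ∏ (1 + |k_i|)^(-2), and the latter sum factors.
-/
theorem summable_one_add_norm_inv (n : ℕ) :
    Summable fun k : Fin n → ℤ => ((1 + ‖k‖) ^ (2 * n))⁻¹ := by
  classical
  have h1 : Summable fun m : ℤ => ((1 + |(m : ℝ)|) ^ 2)⁻¹ := by
    have h2 : Summable fun m : ℕ => ((1 + (m : ℝ)) ^ 2)⁻¹ := by
      have := (summable_nat_add_iff 1).2 (Real.summable_nat_pow_inv.2 (by norm_num : 1 < 2))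
      refine this.congr fun m => ?_
      push_cast
      rw [add_comm]
    refine Summable.of_nat_of_neg ?_ ?_ <;>
    · refine h2.congr fun m => ?_
      simp
  refine summable_of_sum_le (c := (∑' m : ℤ, ((1 + |(m : ℝ)|) ^ 2)⁻¹) ^ n)
    (fun k => by positivity) fun u => ?_
  have hpt : ∀ k : Fin n → ℤ, ((1 + ‖k‖) ^ (2 * n))⁻¹ ≤ ∏ i, ((1 + |(k i : ℝ)|) ^ 2)⁻¹ := by
    intro k
    rw [Finset.prod_inv_distrib]
    refine inv_anti₀ (Finset.prod_pos fun i _ => by positivity) ?_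
    calc ∏ i, (1 + |(k i : ℝ)|) ^ 2 ≤ ∏ _i : Fin n, (1 + ‖k‖) ^ 2 := by
          refine Finset.prod_le_prod (fun i _ => by positivity) fun i _ => ?_
          have := norm_le_pi_norm k i
          rw [Int.norm_eq_abs] at this
          gcongr
      _ = _ := by rw [Finset.prod_const, Finset.card_univ, Fintype.card_fin, ← pow_mul]
  set T : Finset ℤ := u.biUnion fun k => Finset.univ.image k with hT
  have hsub : u ⊆ Fintype.piFinset fun _ => T := by
    intro k hk
    rw [Fintype.mem_piFinset]
    intro i
    exact Finset.mem_biUnion.2 ⟨k, hk, Finset.mem_image_of_mem _ (Finset.mem_univ _)⟩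
  calc ∑ k ∈ u, ((1 + ‖k‖) ^ (2 * n))⁻¹ ≤ ∑ k ∈ u, ∏ i, ((1 + |(k i : ℝ)|) ^ 2)⁻¹ :=
        Finset.sum_le_sum fun k _ => hpt k
    _ ≤ ∑ k ∈ Fintype.piFinset fun _ => T, ∏ i, ((1 + |(k i : ℝ)|) ^ 2)⁻¹ :=
        Finset.sum_le_sum_of_subset_of_nonneg hsub fun k _ _ =>
          Finset.prod_nonneg fun i _ => by positivity
    _ = ∏ _i : Fin n, ∑ m ∈ T, ((1 + |(m : ℝ)|) ^ 2)⁻¹ :=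
        (Finset.prod_univ_sum (fun _ => T) fun _ m => ((1 + |(m : ℝ)|) ^ 2)⁻¹).symm
    _ = (∑ m ∈ T, ((1 + |(m : ℝ)|) ^ 2)⁻¹) ^ n := by simp
    _ ≤ _ := by
        refine pow_le_pow_left₀ (Finset.sum_nonneg fun _ _ => by positivity) ?_ n
        exact h1.sum_le_tsum T fun _ _ => by positivity

variable {E : Type*} [NormedAddCommGroup E] [NormedSpace ℂ E]

/-- Polynomial growth of a family of coefficients. -/
def IsTempered (a : (Fin n → ℤ) → E) : Prop :=
  ∃ (C : ℝ) (m : ℕ), ∀ k, ‖a k‖ ≤ C * (1 + ‖k‖) ^ m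

/-- Of the m + 2n orders of decay, m compensate the growth of a and 2n make the series summable. -/
theorem norm_testCoeff_smul_le {a : (Fin n → ℤ) → E} {C : ℝ} {m : ℕ}
    (ha : ∀ k, ‖a k‖ ≤ C * (1 + ‖k‖) ^ m) (ψ : TestFunction n) (k : Fin n → ℤ) :
    ‖testCoeff k ψ • a k‖ ≤ C * 2 ^ (m + 2 * n) * (testSeminorm (m + 2 * n) ψ).toReal *
      ((1 + ‖k‖) ^ (2 * n))⁻¹ := by
  have h1 := norm_testCoeff_mul_le ψ k (m + 2 * n)
    fun i hi x => norm_iteratedFDeriv_le_testSeminorm hi ψ x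
  have hpos : 0 < 1 + ‖k‖ := by positivity
  rw [norm_smul, ← div_eq_mul_inv, le_div_iff₀ (by positivity)]
  have hC : 0 ≤ C := by
    have := (norm_nonneg _).trans (ha 0)
    simpa using this
  calc ‖testCoeff k ψ‖ * ‖a k‖ * (1 + ‖k‖) ^ (2 * n)
      ≤ ‖testCoeff k ψ‖ * (C * (1 + ‖k‖) ^ m) * (1 + ‖k‖) ^ (2 * n) := by gcongr; exact ha k
    _ = C * ((1 + ‖k‖) ^ (m + 2 * n) * ‖testCoeff k ψ‖) := by rw [pow_add]; ring
    _ ≤ C * (2 ^ (m + 2 * n) * (testSeminorm (m + 2 * n) ψ).toReal) := by gcongr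
    _ = _ := by ring

theorem summable_testCoeff_smul [CompleteSpace E] {a : (Fin n → ℤ) → E} (ha : IsTempered a)
    (ψ : TestFunction n) : Summable fun k => testCoeff k ψ • a k := by
  obtain ⟨C, m, hC⟩ := ha
  exact Summable.of_norm_bounded ((summable_one_add_norm_inv n).mul_left _)
    fun k => norm_testCoeff_smul_le hC ψ k

theorem integrable_test_mul (ψ : TestFunction n) (k : Fin n → ℤ) :
    Integrable (fun x => (ψ : (Fin n → ℝ) → ℂ) x * expChar k x) (torusMeasure n) := by
  obtain ⟨B, hB⟩ := exists_forall_norm_le_of_periodic ψ.2.1.continuous ψ.2.2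
  refine Integrable.of_bound (C := B)
    (ψ.2.1.continuous.mul (continuous_expChar k)).aestronglyMeasurable
    (Filter.Eventually.of_forall fun x => ?_)
  rw [norm_mul, norm_expChar, mul_one]
  exact hB x

theorem testCoeff_add (k : Fin n → ℤ) (ψ χ : TestFunction n) :
    testCoeff k (ψ + χ) = testCoeff k ψ + testCoeff k χ := by
  rw [testCoeff, testCoeff, testCoeff, ← integral_add (integrable_test_mul ψ k)
    (integrable_test_mul χ k)]
  simp [add_mul]

theorem testCoeff_smul (k : Fin n → ℤ) (c : ℂ) (ψ : TestFunction n) :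
    testCoeff k (c • ψ) = c * testCoeff k ψ := by
  rw [testCoeff, testCoeff, ← integral_const_mul]
  simp [mul_assoc]

/-- The distribution with Fourier coefficients `a`. -/
def distOfCoeff [CompleteSpace E] (a : (Fin n → ℤ) → E) (ha : IsTempered a) :
    PeriodicDistribution n E where
  toLinearMap :=
    { toFun := fun ψ => ∑' k, testCoeff k ψ • a k
      map_add' := fun ψ χ => by
        simp only [testCoeff_add, add_smul]
        exact (summable_testCoeff_smul ha ψ).tsum_add (summable_testCoeff_smul ha χ)
      map_smul' := fun c ψ => by
        simp only [testCoeff_smul, mul_smul, RingHom.id_apply]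
        exact (summable_testCoeff_smul ha ψ).tsum_const_smul c }
  continuous_bound := by
    obtain ⟨C, m, hC⟩ := ha
    have hC0 : 0 ≤ C := by
      have := (norm_nonneg _).trans (hC 0)
      simpa using this
    have hS0 : 0 ≤ ∑' k : Fin n → ℤ, ((1 + ‖k‖) ^ (2 * n))⁻¹ := tsum_nonneg fun k => by positivity
    refine ⟨m + 2 * n, Real.toNNReal (C * 2 ^ (m + 2 * n) * ∑' k : Fin n → ℤ,
      ((1 + ‖k‖) ^ (2 * n))⁻¹), fun ψ => ?_⟩
    have h1 : ‖∑' k, testCoeff k ψ • a k‖ ≤ C * 2 ^ (m + 2 * n) *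
        (testSeminorm (m + 2 * n) ψ).toReal * ∑' k : Fin n → ℤ, ((1 + ‖k‖) ^ (2 * n))⁻¹ := by
      rw [← tsum_mul_left]
      exact tsum_of_norm_bounded ((summable_one_add_norm_inv n).mul_left _).hasSum
        fun k => norm_testCoeff_smul_le hC ψ k
    calc ‖∑' k, testCoeff k ψ • a k‖ₑ = ENNReal.ofReal ‖∑' k, testCoeff k ψ • a k‖ :=
          (ofReal_norm _).symm
      _ ≤ ENNReal.ofReal ((C * 2 ^ (m + 2 * n) * ∑' k : Fin n → ℤ, ((1 + ‖k‖) ^ (2 * n))⁻¹) *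
          (testSeminorm (m + 2 * n) ψ).toReal) := by
          refine ENNReal.ofReal_le_ofReal (h1.trans (le_of_eq (by ring)))
      _ = _ := by
          rw [ENNReal.ofReal_mul (by positivity),
            ENNReal.ofReal_toReal (testSeminorm_lt_top _ ψ).ne]
          rfl

theorem coeff_distOfCoeff [CompleteSpace E] (a : (Fin n → ℤ) → E) (ha : IsTempered a)
    (k : Fin n → ℤ) : (distOfCoeff a ha).coeff k = a k := by
  have h : ∀ l, testCoeff l (charTest (-k)) = if l = k then 1 else 0 := by
    intro l
    have := integral_expChar_mul l k
    rw [← this, testCoeff]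
    congr 1
    ext x
    rw [mul_comm]
    rfl
  change ∑' l, testCoeff l (charTest (-k)) • a l = a k
  simp only [h]
  rw [tsum_eq_single k]
  · simp
  · intro l hl; simp [hl]

theorem norm_iteratedDeriv_circChar_one (m : ℕ) (t : ℝ) : ‖iteratedDeriv m (circChar 1) t‖ = 1 := by
  have h : iteratedDeriv m (circChar 1) = fun t => Complex.I ^ m * circChar 1 t := by
    induction m with
    | zero => ext t; simp
    | succ m ih =>
      rw [iteratedDeriv_succ, ih]
      ext t
      rw [deriv_const_mul _ (hasDerivAt_circChar 1 t).differentiableAt,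
        (hasDerivAt_circChar 1 t).deriv, pow_succ]
      push_cast
      ring
  rw [h]
  simp

theorem contDiff_circChar (m : ℤ) : ContDiff ℝ ((⊤ : ℕ∞) : WithTop ℕ∞) (circChar m) := by
  unfold circChar
  have h0 : ContDiff ℝ ((⊤ : ℕ∞) : WithTop ℕ∞) (fun x : ℝ => (m * x : ℝ)) :=
    contDiff_const.mul contDiff_id
  exact (contDiff_const.mul (Complex.ofRealCLM.contDiff.comp h0)).cexp

theorem norm_iteratedFDeriv_expChar_le (k : Fin n → ℤ) (m : ℕ) (x : Fin n → ℝ) :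
    ‖iteratedFDeriv ℝ m (expChar k) x‖ ≤ (n * ‖k‖) ^ m := by
  set L : (Fin n → ℝ) →L[ℝ] ℝ := ∑ i, (k i : ℝ) • ContinuousLinearMap.proj i with hL
  have h0 : expChar k = circChar 1 ∘ L := by
    ext y
    simp [expChar, circChar, hL]
  have hLn : ‖L‖ ≤ n * ‖k‖ := by
    refine ContinuousLinearMap.opNorm_le_bound _ (by positivity) fun y => ?_
    have : L y = ∑ i, (k i : ℝ) * y i := by simp [hL]
    rw [this]
    calc ‖∑ i, (k i : ℝ) * y i‖ ≤ ∑ i : Fin n, ‖k‖ * ‖y‖ := by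
          refine (norm_sum_le _ _).trans (Finset.sum_le_sum fun i _ => ?_)
          rw [norm_mul]
          have h1 := norm_le_pi_norm k i
          have h2 := norm_le_pi_norm y i
          rw [Int.norm_eq_abs] at h1
          rw [Real.norm_eq_abs]
          gcongr
      _ = _ := by simp; ring
  rw [h0, ContinuousLinearMap.iteratedFDeriv_comp_right L (contDiff_circChar 1) x (i := m)
    (by exact_mod_cast le_top)]
  refine (ContinuousMultilinearMap.norm_compContinuousLinearMap_le _ _).trans ?_
  rw [norm_iteratedFDeriv_eq_norm_iteratedDeriv, norm_iteratedDeriv_circChar_one, one_mul,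
    Finset.prod_const, Finset.card_univ, Fintype.card_fin]
  gcongr

/-- The seminorm of order N of e_{-k} grows like ‖k‖^N. Hence M(k) f̂(k) is again tempered for
bounded M and defines a distribution. -/
theorem isTempered_coeff (f : PeriodicDistribution n E) : IsTempered f.coeff := by
  obtain ⟨N, C, hC⟩ := f.continuous_bound
  refine ⟨C * (n + 1) ^ N, N, fun k => ?_⟩
  have h1 : testSeminorm N (charTest (-k)) ≤ ENNReal.ofReal (((n + 1) * (1 + ‖k‖)) ^ N) := by
    refine iSup_le fun m => iSup_le fun hm => iSup_le fun x => ?_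
    rw [← ofReal_norm]
    refine ENNReal.ofReal_le_ofReal ((norm_iteratedFDeriv_expChar_le (-k) m x).trans ?_)
    rw [norm_neg]
    have hk := norm_nonneg k
    have hn : (0 : ℝ) ≤ n := by positivity
    calc (n * ‖k‖) ^ m ≤ ((n + 1) * (1 + ‖k‖)) ^ m := by
          gcongr <;> linarith
      _ ≤ _ := pow_le_pow_right₀ (by nlinarith) hm
  have h2 := (hC (charTest (-k))).trans (mul_le_mul_right h1 _)
  rw [← ofReal_norm, ← ENNReal.ofReal_coe_nnreal, ← ENNReal.ofReal_mul (by positivity),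
    ENNReal.ofReal_le_ofReal_iff (by positivity)] at h2
  refine h2.trans (le_of_eq ?_)
  rw [mul_pow]; ring

/-- A coefficient is an integral against a unimodular function, and on a probability space the L^1
norm is at most the L^p norm. -/
theorem enorm_coeff_le_torusNorm [CompleteSpace E] {p : ℝ≥0∞} (hp : 1 ≤ p)
    (c : (Fin n → ℤ) →₀ E) (k : Fin n → ℤ) : ‖c k‖ₑ ≤ torusNorm p (trigPoly c) := by
  classical
  have h1 : c k = ∫ x, expChar (-k) x • trigPoly c x ∂torusMeasure n := by
    have : ∀ x, expChar (-k) x • trigPoly c x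
        = ∑ l ∈ c.support, (expChar l x * expChar (-k) x) • c l := by
      intro x
      rw [trigPoly_apply, Finset.smul_sum]
      refine Finset.sum_congr rfl fun l _ => ?_
      rw [smul_smul, mul_comm]
    simp only [this]
    have hint : ∀ l, Integrable (fun x => expChar l x * expChar (-k) x) (torusMeasure n) := by
      intro l
      refine Integrable.of_bound (C := 1) (Continuous.aestronglyMeasurable (by fun_prop))
        (Filter.Eventually.of_forall fun x => ?_)
      simp
    rw [integral_finsetSum _ fun l _ => (hint l).smul_const _]
    simp only [integral_smul_const, integral_expChar_mul]
    simp only [ite_smul, one_smul, zero_smul, Finset.sum_ite_eq', Finsupp.mem_support_iff]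
    split_ifs with h
    · rfl
    · simpa using h
  calc ‖c k‖ₑ ≤ ∫⁻ x, ‖expChar (-k) x • trigPoly c x‖ₑ ∂torusMeasure n := by
        rw [h1]; exact enorm_integral_le_lintegral_enorm _
    _ = eLpNorm (trigPoly c) 1 (torusMeasure n) := by
        rw [eLpNorm_one_eq_lintegral_enorm]
        refine lintegral_congr fun x => ?_
        rw [enorm_smul, ← ofReal_norm, norm_expChar, ENNReal.ofReal_one, one_mul]
    _ ≤ _ := eLpNorm_le_eLpNorm_of_exponent_le hp (continuous_trigPoly c).aestronglyMeasurable

end Fourier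
-- UMD implies the multiplier property
section Sufficiency

open MeasureTheory

variable {n : ℕ} {E : Type*} [NormedAddCommGroup E] [NormedSpace ℂ E]

/-! ### Littlewood-Paley pieces as trigonometric polynomials -/

theorem norm_le_of_mem_annulus {j : ℕ} {x : EuclideanSpace ℝ (Fin n)} (hx : x ∈ annulus n j) :
    ‖x‖ ≤ 2 ^ (j + 1) := by
  cases j with
  | zero => simpa [annulus] using hx
  | succ j => exact hx.2

theorem IsResolutionOfUnity.mem_annulus {φ : ℕ → 𝓢(EuclideanSpace ℝ (Fin n), ℂ)}
    (hφ : IsResolutionOfUnity φ) {j : ℕ} {x : EuclideanSpace ℝ (Fin n)} (hx : φ j x ≠ 0) :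
    x ∈ annulus n j :=
  hφ.support_subset j (subset_tsupport _ hx)

theorem exists_finsupp_smul {φ : ℕ → 𝓢(EuclideanSpace ℝ (Fin n), ℂ)}
    (hφ : IsResolutionOfUnity φ) (a : (Fin n → ℤ) → E) (j : ℕ) :
    ∃ c : (Fin n → ℤ) →₀ E, (∀ k, c k = φ j (latticePoint k) • a k) ∧
      ∀ k ∈ c.support, latticePoint k ∈ annulus n j := by
  classical
  have hne : ∀ k, φ j (latticePoint k) • a k ≠ 0 → latticePoint k ∈ annulus n j := fun k hk =>
    hφ.mem_annulus (left_ne_zero_of_smul hk)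
  refine ⟨Finsupp.onFinset (Finset.Icc (fun _ => -2 ^ (j + 1)) (fun _ => 2 ^ (j + 1)))
    (fun k => φ j (latticePoint k) • a k) fun k hk => ?_, fun k => rfl, fun k hk => ?_⟩
  · have h1 : ∀ i, |k i| ≤ 2 ^ (j + 1) := fun i => by
      have := (abs_le_norm_latticePoint k i).trans (norm_le_of_mem_annulus (hne k hk))
      exact_mod_cast this
    rw [Finset.mem_Icc]
    exact ⟨fun i => (abs_le.1 (h1 i)).1, fun i => (abs_le.1 (h1 i)).2⟩
  · exact hne k (Finsupp.mem_support_iff.1 hk)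

theorem littlewoodPaley_eq_trigPoly {ψ : 𝓢(EuclideanSpace ℝ (Fin n), ℂ)}
    {f : PeriodicDistribution n E} {c : (Fin n → ℤ) →₀ E}
    (hc : ∀ k, c k = ψ (latticePoint k) • f.coeff k) : littlewoodPaley ψ f = trigPoly c := by
  ext x
  rw [littlewoodPaley, trigPoly_apply, tsum_eq_sum (s := c.support)]
  · exact Finset.sum_congr rfl fun k _ => by rw [hc]
  · intro k hk
    rw [← hc, Finsupp.notMem_support_iff.1 hk, smul_zero]

theorem littlewoodPaley_eq_multiplierPoly {ψ : 𝓢(EuclideanSpace ℝ (Fin n), ℂ)}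
    {f g : PeriodicDistribution n E} {M : (Fin n → ℤ) → (E →L[ℂ] E)}
    (hg : ∀ k, g.coeff k = M k (f.coeff k)) {c : (Fin n → ℤ) →₀ E}
    (hc : ∀ k, c k = ψ (latticePoint k) • f.coeff k) :
    littlewoodPaley ψ g = multiplierPoly M c := by
  ext x
  have h : ∀ k, ψ (latticePoint k) • g.coeff k = M k (c k) := fun k => by
    rw [hg, hc, map_smul]
  rw [littlewoodPaley, multiplierPoly_apply, tsum_eq_sum (s := c.support)]
  · exact Finset.sum_congr rfl fun k _ => by rw [h]
  · intro k hk
    rw [h, Finsupp.notMem_support_iff.1 hk, map_zero, smul_zero]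

theorem besovNorm_le_mul {φ : ℕ → 𝓢(EuclideanSpace ℝ (Fin n), ℂ)} {s : ℝ} {p q : ℝ≥0∞}
    (hq : 1 ≤ q) {f g : PeriodicDistribution n E} {K : ℝ≥0}
    (h : ∀ j, torusNorm p (littlewoodPaley (φ j) g) ≤ K * torusNorm p (littlewoodPaley (φ j) f)) :
    besovNorm φ s p q g ≤ K * besovNorm φ s p q f := by
  have h' : ∀ j : ℕ, ENNReal.ofReal ((2 : ℝ) ^ (s * j)) * torusNorm p (littlewoodPaley (φ j) g)
      ≤ K * (ENNReal.ofReal ((2 : ℝ) ^ (s * j)) * torusNorm p (littlewoodPaley (φ j) f)) := by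
    intro j
    rw [mul_left_comm]
    exact mul_le_mul_right (h j) _
  rw [besovNorm, besovNorm]
  split_ifs with hq'
  · rw [ENNReal.mul_iSup]
    exact iSup_mono h'
  · have hq0 : 0 < q.toReal := ENNReal.toReal_pos (zero_lt_one.trans_le hq).ne' hq'
    have h1 : (K : ℝ≥0∞) = ((K : ℝ≥0∞) ^ q.toReal) ^ (1 / q.toReal) := by
      rw [← ENNReal.rpow_mul, mul_one_div_cancel hq0.ne', ENNReal.rpow_one]
    conv_rhs => rw [h1]
    rw [← ENNReal.mul_rpow_of_nonneg _ _ (by positivity), ← ENNReal.tsum_mul_left]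
    refine ENNReal.rpow_le_rpow (ENNReal.tsum_le_tsum fun j => ?_) (by positivity)
    rw [← ENNReal.mul_rpow_of_nonneg _ _ hq0.le]
    exact ENNReal.rpow_le_rpow (h' j) hq0.le

theorem IsTempered.clm_apply {a : (Fin n → ℤ) → E} (ha : IsTempered a)
    {M : (Fin n → ℤ) → (E →L[ℂ] E)} {B : ℝ} (hM : ∀ k, ‖M k‖ ≤ B) :
    IsTempered fun k => M k (a k) := by
  obtain ⟨C, m, hC⟩ := ha
  refine ⟨B * C, m, fun k => ?_⟩
  have hB : 0 ≤ B := (norm_nonneg _).trans (hM 0)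
  calc ‖M k (a k)‖ ≤ ‖M k‖ * ‖a k‖ := (M k).le_opNorm _
    _ ≤ B * (C * (1 + ‖k‖) ^ m) := by gcongr; exacts [hM k, hC k]
    _ = _ := by ring

/-- Uniform boundedness of M provides the distribution g; bounded variation provides the estimate of
its pieces, with one constant for all j. -/
theorem IsUMD.isBesovMultiplier [NeZero n] [CompleteSpace E] (h : IsUMD n E)
    {φ : ℕ → 𝓢(EuclideanSpace ℝ (Fin n), ℂ)} (hφ : IsResolutionOfUnity φ) {s : ℝ} {p q : ℝ≥0∞}
    (hp : 1 < p) (hp' : p < ∞) (hq : 1 ≤ q) {M : (Fin n → ℤ) → (E →L[ℂ] E)} (hM : IsCoarseBV M) :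
    IsBesovMultiplier φ s p q M := by
  intro f hf
  obtain ⟨C, hC⟩ := exists_hasLpBound_Icc h hp hp'
  obtain ⟨K, hK⟩ := exists_annulus_multiplier_bound hp.le hC hM
  obtain ⟨B, hB⟩ := hM.1
  refine ⟨distOfCoeff (fun k => M k (f.coeff k)) ((isTempered_coeff f).clm_apply hB), ?_,
    coeff_distOfCoeff _ _⟩
  refine lt_of_le_of_lt (besovNorm_le_mul (K := K) hq fun j => ?_)
    (ENNReal.mul_lt_top ENNReal.coe_lt_top hf)
  obtain ⟨c, hc, hcs⟩ := exists_finsupp_smul hφ f.coeff j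
  rw [littlewoodPaley_eq_trigPoly hc,
    littlewoodPaley_eq_multiplierPoly (coeff_distOfCoeff _ _) hc]
  exact hK j c hcs

end Sufficiency
-- A symbol of bounded variation built from orthants
section Indicators

variable {n : ℕ} {V : Type*} [NormedAddCommGroup V]

/-! ### Variation of the indicator of an orthant -/

open Classical in
-- Each difference turns the condition m_j ≤ ξ_j into ξ_j = m_j. On the face ξ_j = α_j, where the
-- value itself is kept, both conditions agree because α ≤ m.
theorem foldr_faceDiff_indicator_Ici {α β m : Fin n → ℤ} (hm : α ≤ m) (v : V)
    {M : (Fin n → ℤ) → V} (hM : ∀ k ∈ Set.Icc α β, M k = if m ≤ k then v else 0)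
    (js : List (Fin n)) (hjs : js.Nodup) {ξ : Fin n → ℤ} (hξ : ξ ∈ Set.Icc α β) :
    js.foldr (faceDiff α) ((Set.Icc α β).indicator M) ξ
      = if ∀ i, if i ∈ js then ξ i = m i else m i ≤ ξ i then v else 0 := by
  induction js generalizing ξ with
  | nil =>
    rw [List.foldr_nil, Set.indicator_of_mem hξ, hM ξ hξ]
    simp [Pi.le_def]
  | cons j js ih =>
    have hj : j ∉ js := (List.nodup_cons.1 hjs).1
    have ih' := fun {ξ} hξ => @ih (List.nodup_cons.1 hjs).2 ξ hξ
    have hξ' : ξ j ≠ α j → ξ - Pi.single j 1 ∈ Set.Icc α β := by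
      intro h
      refine ⟨fun i => ?_, fun i => ?_⟩
      · have h1 : α i ≤ ξ i := hξ.1 i
        by_cases hij : i = j
        · subst hij
          have h2 : (ξ - (Pi.single i 1 : Fin n → ℤ)) i = ξ i - 1 := by simp
          exact (show α i ≤ ξ i - 1 by omega).trans_eq h2.symm
        · simpa [hij] using h1
      · have h1 : ξ i ≤ β i := hξ.2 i
        by_cases hij : i = j
        · subst hij
          have h2 : (ξ - (Pi.single i 1 : Fin n → ℤ)) i = ξ i - 1 := by simp
          exact h2.trans_le (by omega)
        · simpa [hij] using h1
    rw [List.foldr_cons, faceDiff]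
    split_ifs with h1 h2 h2
    · rw [ih' hξ, if_pos]
      intro i
      have := h2 i
      by_cases hij : i = j
      · subst hij; simp at this; simp [hj, this]
      · simpa [hij] using this
    · rw [ih' hξ, if_neg]
      intro h
      refine h2 fun i => ?_
      have := h i
      by_cases hij : i = j
      · subst hij
        simp only [hj, if_false] at this
        simpa using le_antisymm (h1.trans_le (hm i)) this
      · simpa [hij] using this
    · rw [ih' hξ, ih' (hξ' h1), if_pos, if_neg, sub_zero]
      · intro h
        have h3 := h j
        have h4 := h2 j
        simp [hj] at h3 h4
        omega
      · intro i
        have := h2 i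
        by_cases hij : i = j
        · subst hij; simp at this; simp [hj, this]
        · simpa [hij] using this
    · rw [ih' hξ, ih' (hξ' h1), sub_eq_zero]
      refine if_congr ⟨fun h i => ?_, fun h i => ?_⟩ rfl rfl
      · have := h i
        by_cases hij : i = j
        · subst hij
          simp only [hj, if_false] at this ⊢
          have h3 : ξ i ≠ m i := by
            intro h3
            refine h2 fun l => ?_
            have hl := h l
            by_cases hlj : l = i
            · subst hlj; simpa using h3
            · simpa [hlj] using hl
          simp
          omega
        · simpa [hij] using this
      · have := h i
        by_cases hij : i = j
        · subst hij
          simp [hj] at this ⊢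
          omega
        · simpa [hij] using this

/-- After differencing in all directions a point mass at m remains, and m may lie outside the box.
-/
theorem boxVar_le_of_eq_ite {α β m : Fin n → ℤ} (hm : α ≤ m) (v : V) {M : (Fin n → ℤ) → V}
    (hM : ∀ k ∈ Set.Icc α β, M k = open Classical in if m ≤ k then v else 0) :
    boxVar α β M ≤ ‖v‖ := by
  classical
  have h : ∀ ξ ∈ Finset.Icc α β,
      ‖diffIter α (Finset.univ.filter fun j => ξ j ≠ α j) ((Set.Icc α β).indicator M) ξ‖
        = if ξ = m then ‖v‖ else 0 := by
    intro ξ hξ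
    rw [diffIter_eq_foldr, foldr_faceDiff_indicator_Ici hm v
      (fun k hk => (hM k hk).trans (if_congr Iff.rfl rfl rfl)) _ (List.nodup_finRange n)
      (Finset.mem_Icc.1 hξ)]
    simp only [List.mem_finRange, if_true, ← funext_iff]
    split_ifs <;> simp
  rw [boxVar, Finset.sum_congr rfl h, Finset.sum_ite_eq']
  split_ifs
  · exact le_rfl
  · exact norm_nonneg _

theorem boxVar_eq_zero {α β : Fin n → ℤ} {M : (Fin n → ℤ) → V}
    (hM : ∀ k ∈ Set.Icc α β, M k = 0) : boxVar α β M = 0 := by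
  have h := boxVar_le_of_eq_ite (m := α) le_rfl (0 : V) (M := M) (β := β)
    fun k hk => by rw [hM k hk, ite_self]
  rw [norm_zero] at h
  exact le_antisymm h (boxVar_nonneg _ _ _)

variable [NeZero n]

/-! ### A multiplier that carries a translated Riesz projection in every dyadic block -/

variable (n) in
/-- The point `(3 · 2^t, 0, …, 0)`. -/
def blockCenter (t : ℕ) : Fin n → ℤ := Pi.single 0 (3 * 2 ^ t)

/-- The shell `2^{t+1} ≤ k_0 < 2^{t+2}`, `|k_i| < 2^{t+1}`. -/
def InBlock (t : ℕ) (k : Fin n → ℤ) : Prop :=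
  (2 ^ (t + 1) ≤ k 0 ∧ k 0 < 2 ^ (t + 2)) ∧ ∀ i ≠ 0, |k i| < 2 ^ (t + 1)

theorem InBlock.eq {t u : ℕ} {k : Fin n → ℤ} (ht : InBlock t k) (hu : InBlock u k) : t = u := by
  have h1 : (2 : ℤ) ^ (t + 1) < 2 ^ (u + 2) := ht.1.1.trans_lt hu.1.2
  have h2 : (2 : ℤ) ^ (u + 1) < 2 ^ (t + 2) := hu.1.1.trans_lt ht.1.2
  rw [pow_lt_pow_iff_right₀ (by norm_num)] at h1 h2
  omega

open Classical in
/-- The function equal to `v` on the points of each block that dominate its center. -/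
def blockSymbol (v : V) (k : Fin n → ℤ) : V :=
  if ∃ t, InBlock t k ∧ blockCenter n t ≤ k then v else 0

theorem blockSymbol_of_inBlock (v : V) {t : ℕ} {k : Fin n → ℤ} (hk : InBlock t k) :
    blockSymbol v k = open Classical in if blockCenter n t ≤ k then v else 0 := by
  classical
  rw [blockSymbol]
  refine if_congr ⟨?_, fun h => ⟨t, hk, h⟩⟩ rfl rfl
  rintro ⟨u, hu, h⟩
  rwa [hk.eq hu]

theorem blockSymbol_eq_zero (v : V) {k : Fin n → ℤ}
    (h : ∀ t, InBlock t k → 3 * 2 ^ t ≤ k 0 → (∀ i ≠ 0, 0 ≤ k i) → False) :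
    blockSymbol v k = 0 := by
  rw [blockSymbol, if_neg]
  rintro ⟨t, ht, hk⟩
  refine h t ht (by simpa [blockCenter] using hk 0) fun i hi => ?_
  simpa [blockCenter, hi] using hk i

/-- Only the positive boxes in the first direction of level r = t + 1 meet the support, and there
the symbol is the indicator of an orthant. -/
theorem isCoarseBV_blockSymbol (v : V) : IsCoarseBV (blockSymbol (n := n) v) := by
  refine ⟨⟨‖v‖, fun k => ?_⟩, ‖v‖, fun d => ?_⟩
  · rw [blockSymbol]
    split_ifs
    · exact le_rfl
    · simp
  cases d with
  | zero =>
    rw [coarseVar, boxVar_eq_zero]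
    · exact norm_nonneg _
    · intro k hk
      have hk0 : k = 0 := le_antisymm hk.2 hk.1
      refine blockSymbol_eq_zero v fun t _ h _ => ?_
      have : (0 : ℤ) < 2 ^ t := by positivity
      simp [hk0] at h
      omega
  | succ d =>
    rw [coarseVar]
    set l := Fin.ofNat n d
    set r := d / n
    have hneg : boxVar (blockLower false r l) (blockUpper false r l) (blockSymbol (n := n) v) = 0 := by
      refine boxVar_eq_zero fun k hk => ?_
      rw [Icc_blockLower_blockUpper] at hk
      obtain ⟨⟨h1, h2, h3⟩, h4⟩ := hk
      simp only [Bool.false_eq_true, if_false] at h4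
      refine blockSymbol_eq_zero v fun t ht h h' => ?_
      have : (0 : ℤ) < 2 ^ t := by positivity
      by_cases hl : l = 0
      · rw [hl] at h4
        omega
      · exact absurd (h' l hl) (not_le.2 h4)
    rw [hneg, add_zero]
    by_cases hl : l = 0
    -- At level 0 one has k_0 = 1, below the smallest center 3.
    · rcases Nat.eq_zero_or_pos r with hr | hr
      · rw [boxVar_eq_zero]
        · exact norm_nonneg _
        · intro k hk
          rw [Icc_blockLower_blockUpper] at hk
          obtain ⟨⟨h1, h2, h3⟩, h4⟩ := hk
          rw [hl, hr] at h2
          refine blockSymbol_eq_zero v fun t ht h h' => ?_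
          have : (0 : ℤ) < 2 ^ t := by positivity
          have := (abs_lt.1 h2.2).2
          norm_num at this
          omega
      · obtain ⟨t, ht⟩ : ∃ t, r = t + 1 := ⟨r - 1, by omega⟩
        have hpow : (0 : ℤ) < 2 ^ t := by positivity
        rw [hl, ht]
        refine boxVar_le_of_eq_ite (m := blockCenter n t) (fun i => ?_) v fun k hk => ?_
        · by_cases hi : i = 0
          · subst hi
            simp only [blockLower, blockCenter, lt_irrefl, if_false, if_true, Pi.single_eq_same]
            rw [pow_succ]
            omega
          · simp only [blockLower, blockCenter, Fin.not_lt_zero, hi, if_false,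
              Pi.single_eq_of_ne hi]
            rw [pow_succ]
            omega
        · rw [Icc_blockLower_blockUpper] at hk
          obtain ⟨⟨h1, h2, h3⟩, h4⟩ := hk
          simp only [if_true] at h4
          rw [abs_of_pos h4] at h2
          exact blockSymbol_of_inBlock v ⟨h2, fun i hi => h3 i (Fin.pos_iff_ne_zero.2 hi)⟩
    · rw [boxVar_eq_zero]
      · exact norm_nonneg _
      · intro k hk
        rw [Icc_blockLower_blockUpper] at hk
        obtain ⟨⟨h1, h2, h3⟩, h4⟩ := hk
        -- With l ≠ 0, the box forces t < r through k_0 and the shell forces r ≤ t through k_l.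
        refine blockSymbol_eq_zero v fun t ht h h' => ?_
        have h5 := ht.2 l hl
        have h6 := h1 0 (Fin.pos_iff_ne_zero.2 hl)
        have h7 : (2 : ℤ) ^ (t + 1) < 2 ^ (r + 1) := ht.1.1.trans_lt ((le_abs_self _).trans_lt h6)
        have h8 : (2 : ℤ) ^ r < 2 ^ (t + 1) := h2.1.trans_lt h5
        rw [pow_lt_pow_iff_right₀ (by norm_num)] at h7 h8
        omega

end Indicators
-- Localization near block centers
section Humps

open MeasureTheory

variable {n : ℕ} {E : Type*} [NormedAddCommGroup E] [NormedSpace ℂ E]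

/-! ### Perturbing the coefficients of a trigonometric polynomial -/

theorem torusNorm_sum_le (p : ℝ≥0∞) (S : Finset (Fin n → ℤ)) (d : (Fin n → ℤ) → E) :
    torusNorm p (fun x => ∑ k ∈ S, expChar k x • d k) ≤ ENNReal.ofReal (∑ k ∈ S, ‖d k‖) := by
  have h : ∀ x : Fin n → ℝ, ‖∑ k ∈ S, expChar k x • d k‖ ≤ ∑ k ∈ S, ‖d k‖ := fun x =>
    (norm_sum_le _ _).trans_eq (Finset.sum_congr rfl fun k _ => by
      rw [norm_smul, norm_expChar, one_mul])
  refine (eLpNorm_le_of_ae_bound (Filter.Eventually.of_forall h)).trans ?_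
  simp

theorem continuous_sum_expChar_smul (S : Finset (Fin n → ℤ)) (d : (Fin n → ℤ) → E) :
    Continuous fun x => ∑ k ∈ S, expChar k x • d k :=
  continuous_finsetSum _ fun k _ => (continuous_expChar k).smul continuous_const

theorem torusNorm_const_smul (p : ℝ≥0∞) (w : ℂ) (f : (Fin n → ℝ) → E) :
    torusNorm p (fun x => w • f x) = ENNReal.ofReal ‖w‖ * torusNorm p f := by
  rw [ofReal_norm]
  exact eLpNorm_const_smul w f p _

theorem norm_coeff_le_of_torusNorm_le_one [CompleteSpace E] {p : ℝ≥0∞} (hp : 1 ≤ p)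
    {c : (Fin n → ℤ) →₀ E} (hc : torusNorm p (trigPoly c) ≤ 1) (k : Fin n → ℤ) : ‖c k‖ ≤ 1 := by
  have h := (enorm_coeff_le_torusNorm hp c k).trans hc
  rwa [← ofReal_norm, ENNReal.ofReal_le_one] at h

theorem torusNorm_sum_smul_sub_le [CompleteSpace E] {p : ℝ≥0∞} (hp : 1 ≤ p)
    {c : (Fin n → ℤ) →₀ E} (hc : torusNorm p (trigPoly c) ≤ 1) {T : (Fin n → ℤ) → (E →L[ℂ] E)}
    (hT : ∀ k, ‖T k‖ ≤ 1) {w : (Fin n → ℤ) → ℂ} {δ : ℝ}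
    (hw : ∀ k ∈ c.support, ‖w k‖ ≤ δ) (hδ : δ * c.support.card ≤ 1) :
    torusNorm p (fun x => ∑ k ∈ c.support, expChar k x • (w k • T k (c k))) ≤ 1 := by
  refine (torusNorm_sum_le p _ _).trans ?_
  rw [ENNReal.ofReal_le_one]
  refine le_trans (Finset.sum_le_card_nsmul _ _ δ fun k hk => ?_) ?_
  · rw [norm_smul]
    have h1 : ‖T k (c k)‖ ≤ 1 :=
      ((T k).le_opNorm _).trans (mul_le_one₀ (hT k) (norm_nonneg _)
        (norm_coeff_le_of_torusNorm_le_one hp hc k))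
    calc ‖w k‖ * ‖T k (c k)‖ ≤ ‖w k‖ * 1 := by gcongr
      _ ≤ δ := by rw [mul_one]; exact hw k hk
  · rw [nsmul_eq_mul, mul_comm]
    exact hδ

theorem sum_smul_eq_add (c : (Fin n → ℤ) →₀ E) (T : (Fin n → ℤ) → (E →L[ℂ] E))
    (w : (Fin n → ℤ) → ℂ) (w₀ : ℂ) :
    (fun x => ∑ k ∈ c.support, expChar k x • (w k • T k (c k)))
      = (fun x => w₀ • multiplierPoly T c x) +
        fun x => ∑ k ∈ c.support, expChar k x • ((w k - w₀) • T k (c k)) := by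
  ext x
  rw [Pi.add_apply, multiplierPoly_apply, Finset.smul_sum, ← Finset.sum_add_distrib]
  refine Finset.sum_congr rfl fun k _ => ?_
  rw [smul_comm w₀, ← smul_add, ← add_smul, add_sub_cancel]

/-- In the application w k is φ_j at a shifted frequency and w₀ its value at the center. All
coefficients have norm at most 1, so replacing w by w₀ costs at most δ times their number. -/
theorem torusNorm_sum_smul_le [CompleteSpace E] {p : ℝ≥0∞} (hp : 1 ≤ p)
    {c : (Fin n → ℤ) →₀ E} (hc : torusNorm p (trigPoly c) ≤ 1) {T : (Fin n → ℤ) → (E →L[ℂ] E)}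
    (hT : ∀ k, ‖T k‖ ≤ 1) {w : (Fin n → ℤ) → ℂ} {w₀ : ℂ} {δ : ℝ}
    (hw : ∀ k ∈ c.support, ‖w k - w₀‖ ≤ δ) (hδ : δ * c.support.card ≤ 1) :
    torusNorm p (fun x => ∑ k ∈ c.support, expChar k x • (w k • T k (c k)))
      ≤ ENNReal.ofReal ‖w₀‖ * torusNorm p (multiplierPoly T c) + 1 := by
  rw [sum_smul_eq_add c T w w₀, ← torusNorm_const_smul]
  refine (eLpNorm_add_le ((continuous_multiplierPoly T c).const_smul w₀).aestronglyMeasurable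
    (continuous_sum_expChar_smul _ _).aestronglyMeasurable hp).trans ?_
  exact add_le_add le_rfl (torusNorm_sum_smul_sub_le hp hc hT hw hδ)

theorem torusNorm_multiplierPoly_le_sum_smul [CompleteSpace E] {p : ℝ≥0∞} (hp : 1 ≤ p)
    {c : (Fin n → ℤ) →₀ E} (hc : torusNorm p (trigPoly c) ≤ 1) {T : (Fin n → ℤ) → (E →L[ℂ] E)}
    (hT : ∀ k, ‖T k‖ ≤ 1) {w : (Fin n → ℤ) → ℂ} {w₀ : ℂ} {δ : ℝ}
    (hw : ∀ k ∈ c.support, ‖w k - w₀‖ ≤ δ) (hδ : δ * c.support.card ≤ 1) :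
    ENNReal.ofReal ‖w₀‖ * torusNorm p (multiplierPoly T c)
      ≤ torusNorm p (fun x => ∑ k ∈ c.support, expChar k x • (w k • T k (c k))) + 1 := by
  rw [← torusNorm_const_smul]
  have h := sum_smul_eq_add c T w w₀
  rw [← sub_eq_iff_eq_add] at h
  rw [← h]
  refine (eLpNorm_sub_le (continuous_sum_expChar_smul _ _).aestronglyMeasurable
    (continuous_sum_expChar_smul _ _).aestronglyMeasurable hp).trans ?_
  exact add_le_add le_rfl (torusNorm_sum_smul_sub_le hp hc hT hw hδ)

/-- Divide by the norm τ. It is nonzero, since otherwise every coefficient would vanish and the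
inequality would hold. -/
theorem exists_normalized_of_not_bounded [CompleteSpace E] {p : ℝ≥0∞} (hp : 1 ≤ p)
    {T : (Fin n → ℤ) → (E →L[ℂ] E)}
    (h : ¬ ∃ C : ℝ≥0, ∀ c : (Fin n → ℤ) →₀ E,
      torusNorm p (multiplierPoly T c) ≤ C * torusNorm p (trigPoly c)) (A : ℝ≥0) :
    ∃ c : (Fin n → ℤ) →₀ E, torusNorm p (trigPoly c) ≤ 1 ∧ A ≤ torusNorm p (multiplierPoly T c) := by
  push Not at h
  obtain ⟨c, hc⟩ := h A
  set τ := torusNorm p (trigPoly c) with hτ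
  have hτ0 : τ ≠ 0 := by
    intro h0
    have hc0 : c = 0 := by
      ext k
      have := enorm_coeff_le_torusNorm hp c k
      rw [← hτ, h0, nonpos_iff_eq_zero, enorm_eq_zero] at this
      exact this
    have h1 : multiplierPoly T (0 : (Fin n → ℤ) →₀ E) = fun _ => 0 := by
      ext x; simp [multiplierPoly]
    rw [hc0, h1] at hc
    simp [torusNorm] at hc
  have hτt : τ ≠ ∞ := by
    refine ne_top_of_le_ne_top ENNReal.ofReal_ne_top (?_ : τ ≤ ENNReal.ofReal (∑ k ∈ c.support, ‖c k‖))
    rw [hτ]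
    exact torusNorm_sum_le p c.support c
  set a : ℂ := ((τ.toReal⁻¹ : ℝ) : ℂ) with ha
  have hna : ENNReal.ofReal ‖a‖ = τ⁻¹ := by
    rw [ha, Complex.norm_real, Real.norm_of_nonneg (by positivity),
      ENNReal.ofReal_inv_of_pos (ENNReal.toReal_pos hτ0 hτt), ENNReal.ofReal_toReal hτt]
  have e1 : trigPoly (a • c) = fun x => a • trigPoly c x := by
    ext x
    rw [trigPoly, Finsupp.sum_smul_index' (fun _ => smul_zero _), trigPoly, Finsupp.smul_sum]
    exact Finsupp.sum_congr fun k _ => smul_comm _ _ _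
  have e2 : multiplierPoly T (a • c) = fun x => a • multiplierPoly T c x := by
    ext x
    rw [multiplierPoly, Finsupp.sum_smul_index' (fun _ => by simp), multiplierPoly,
      Finsupp.smul_sum]
    exact Finsupp.sum_congr fun k _ => by rw [map_smul, smul_comm]
  refine ⟨a • c, ?_, ?_⟩
  · rw [e1, torusNorm_const_smul, hna, ← hτ, ENNReal.inv_mul_cancel hτ0 hτt]
  · rw [e2, torusNorm_const_smul, hna]
    calc (A : ℝ≥0∞) = τ⁻¹ * (A * τ) := by
          rw [mul_left_comm, ENNReal.inv_mul_cancel hτ0 hτt, mul_one]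
      _ ≤ _ := mul_le_mul_right hc.le _

/-! ### Resolutions of unity near the centers of the blocks -/

theorem latticePoint_add (k l : Fin n → ℤ) :
    latticePoint (k + l) = latticePoint k + latticePoint l := by
  ext i; simp [latticePoint]

section Center

variable [NeZero n]

theorem norm_latticePoint_blockCenter (t : ℕ) : ‖latticePoint (blockCenter n t)‖ = 3 * 2 ^ t := by
  have h : latticePoint (blockCenter n t) = EuclideanSpace.single (0 : Fin n) ((3 * 2 ^ t : ℝ)) := by
    ext i
    by_cases hi : i = 0
    · subst hi; simp [latticePoint, blockCenter]
    · simp [latticePoint, blockCenter, hi]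
  rw [h, EuclideanSpace.norm_single, Real.norm_of_nonneg (by positivity)]

/-- The radius 3 · 2^t is the midpoint between 2^(t+1) and 2^(t+2), so there is room 2^t on either
side. -/
theorem norm_blockCenter_add {t : ℕ} {k : Fin n → ℤ} (hk : ‖latticePoint k‖ < 2 ^ t) :
    2 ^ (t + 1) < ‖latticePoint (blockCenter n t + k)‖ ∧
      ‖latticePoint (blockCenter n t + k)‖ < 2 ^ (t + 2) := by
  have h1 := norm_add_le (latticePoint (blockCenter n t)) (latticePoint k)
  have h2 := norm_sub_le (latticePoint (blockCenter n t) + latticePoint k) (latticePoint k)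
  rw [add_sub_cancel_right] at h2
  rw [norm_latticePoint_blockCenter] at h1 h2
  rw [latticePoint_add, pow_succ, pow_succ (2 : ℝ) (t + 1), pow_succ]
  constructor <;> linarith

theorem inBlock_blockCenter_add {t : ℕ} {k : Fin n → ℤ} (hk : ‖latticePoint k‖ < 2 ^ t) :
    InBlock t (blockCenter n t + k) := by
  have h : ∀ i, |k i| < 2 ^ t := fun i => by
    have := (abs_le_norm_latticePoint k i).trans_lt hk
    exact_mod_cast this
  have hpow : (0 : ℤ) < 2 ^ t := by positivity
  have h1 : (2 : ℤ) ^ (t + 1) = 2 * 2 ^ t := by ring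
  have h2 : (2 : ℤ) ^ (t + 2) = 4 * 2 ^ t := by ring
  refine ⟨?_, fun i hi => ?_⟩
  · have h0 := abs_lt.1 (h 0)
    rw [Pi.add_apply, blockCenter, Pi.single_eq_same]
    omega
  · have h0 := h i
    rw [Pi.add_apply, blockCenter, Pi.single_eq_of_ne hi, zero_add]
    omega

end Center

theorem eq_or_eq_of_mem_annulus {j t : ℕ} {x : EuclideanSpace ℝ (Fin n)} (hx : x ∈ annulus n j)
    (h1 : 2 ^ (t + 1) < ‖x‖) (h2 : ‖x‖ < 2 ^ (t + 2)) : j = t + 1 ∨ j = t + 2 := by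
  have h3 := h1.trans_le (norm_le_of_mem_annulus hx)
  rw [pow_lt_pow_iff_right₀ (by norm_num)] at h3
  cases j with
  | zero => omega
  | succ j =>
    have h4 := hx.1.trans_lt h2
    rw [pow_lt_pow_iff_right₀ (by norm_num)] at h4
    omega

variable {φ : ℕ → 𝓢(EuclideanSpace ℝ (Fin n), ℂ)}

/-- Strictly inside the shell only two members of the resolution can be nonzero, and they add up to
1. -/
theorem IsResolutionOfUnity.exists_half_le (hφ : IsResolutionOfUnity φ) {t : ℕ}
    {x : EuclideanSpace ℝ (Fin n)} (h1 : 2 ^ (t + 1) < ‖x‖) (h2 : ‖x‖ < 2 ^ (t + 2)) :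
    ∃ j, (j = t + 1 ∨ j = t + 2) ∧ 1 / 2 ≤ ‖φ j x‖ := by
  have h3 : HasSum (fun j => φ j x) (∑ j ∈ {t + 1, t + 2}, φ j x) := by
    refine hasSum_sum_of_ne_finset_zero fun j hj => ?_
    by_contra h
    exact hj (by simpa using eq_or_eq_of_mem_annulus (hφ.mem_annulus h) h1 h2)
  have h4 := (hφ.sum_eq_one x).unique h3
  rw [Finset.sum_pair (by omega)] at h4
  by_contra! h
  have h5 := h (t + 1) (Or.inl rfl)
  have h6 := h (t + 2) (Or.inr rfl)
  have h7 := norm_add_le (φ (t + 1) x) (φ (t + 2) x)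
  rw [← h4, norm_one] at h7
  linarith

theorem IsResolutionOfUnity.exists_norm_le (hφ : IsResolutionOfUnity φ) :
    ∃ C : ℝ, 0 < C ∧ ∀ j x, ‖φ j x‖ ≤ C := by
  obtain ⟨C, hC, h⟩ := hφ.deriv_bound 0
  refine ⟨C, hC, fun j x => ?_⟩
  have h1 := h j x
  rw [norm_iteratedFDeriv_zero, mul_zero, pow_zero, inv_one, mul_one] at h1
  refine h1.trans (mul_le_of_le_one_right hC.le ?_)
  exact Set.indicator_le' (fun _ _ => le_rfl) (fun _ _ => zero_le_one) x

theorem IsResolutionOfUnity.exists_norm_sub_le (hφ : IsResolutionOfUnity φ) :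
    ∃ C : ℝ, 0 < C ∧ ∀ j x y, ‖φ j (x + y) - φ j x‖ ≤ C * (2 ^ j)⁻¹ * ‖y‖ := by
  obtain ⟨C, hC, h⟩ := hφ.deriv_bound 1
  refine ⟨C, hC, fun j x y => ?_⟩
  have h1 : ∀ z ∈ (Set.univ : Set (EuclideanSpace ℝ (Fin n))),
      ‖fderiv ℝ (φ j) z‖ ≤ C * (2 ^ j)⁻¹ := by
    intro z _
    have h2 := h j z
    rw [norm_iteratedFDeriv_one, mul_one] at h2
    refine h2.trans (mul_le_of_le_one_right (by positivity) ?_)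
    exact Set.indicator_le' (fun _ _ => le_rfl) (fun _ _ => zero_le_one) z
  have h3 := convex_univ.norm_image_sub_le_of_norm_fderiv_le (f := φ j) (𝕜 := ℝ)
    (fun z _ => (φ j).differentiableAt) h1 (Set.mem_univ x) (Set.mem_univ (x + y))
  rwa [add_sub_cancel_left] at h3

/-! ### Besov norms and single Littlewood-Paley pieces -/

theorem le_besovNorm (s : ℝ) (p : ℝ≥0∞) {q : ℝ≥0∞} (hq : 1 ≤ q) (f : PeriodicDistribution n E)
    (j : ℕ) : ENNReal.ofReal ((2 : ℝ) ^ (s * j)) * torusNorm p (littlewoodPaley (φ j) f)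
      ≤ besovNorm φ s p q f := by
  rw [besovNorm]
  split_ifs with hq'
  · exact le_iSup (fun j : ℕ =>
      ENNReal.ofReal ((2 : ℝ) ^ (s * j)) * torusNorm p (littlewoodPaley (φ j) f)) j
  · have hq0 : 0 < q.toReal := ENNReal.toReal_pos (zero_lt_one.trans_le hq).ne' hq'
    rw [one_div, ENNReal.le_rpow_inv_iff hq0]
    exact ENNReal.le_tsum j

/-- ℓ^1 is contained in ℓ^q, by u_j^q ≤ (∑ u)^(q-1) u_j. A single summable majorant thus serves
every q. -/
theorem memBesov_of_tsum_lt_top {s : ℝ} {p q : ℝ≥0∞} (hq : 1 ≤ q) {f : PeriodicDistribution n E}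
    (h : ∑' j : ℕ, ENNReal.ofReal ((2 : ℝ) ^ (s * j)) * torusNorm p (littlewoodPaley (φ j) f) < ∞) :
    MemBesov φ s p q f := by
  set u : ℕ → ℝ≥0∞ := fun j =>
    ENNReal.ofReal ((2 : ℝ) ^ (s * j)) * torusNorm p (littlewoodPaley (φ j) f) with hu
  rw [MemBesov, besovNorm]
  split_ifs with hq'
  · exact (iSup_le fun j => ENNReal.le_tsum (f := u) j).trans_lt h
  · have hq0 : 0 < q.toReal := ENNReal.toReal_pos (zero_lt_one.trans_le hq).ne' hq'
    have hq1 : 1 ≤ q.toReal := by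
      rw [← ENNReal.toReal_one]
      exact ENNReal.toReal_mono hq' hq
    refine ENNReal.rpow_lt_top_of_nonneg (by positivity) (ne_of_lt ?_)
    refine lt_of_le_of_lt (ENNReal.tsum_le_tsum (g := fun j => (∑' i, u i) ^ (q.toReal - 1) * u j)
      fun j => ?_) ?_
    · change u j ^ q.toReal ≤ _
      calc u j ^ q.toReal = u j ^ (q.toReal - 1) * u j := by
            conv_rhs => rw [← ENNReal.rpow_one (u j), ← ENNReal.rpow_mul, one_mul]
            rw [← ENNReal.rpow_add_of_nonneg _ _ (by linarith) zero_le_one, sub_add_cancel]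
        _ ≤ _ := mul_le_mul_left
            (ENNReal.rpow_le_rpow (ENNReal.le_tsum j) (by linarith)) _
    · rw [ENNReal.tsum_mul_left]
      exact ENNReal.mul_lt_top (ENNReal.rpow_lt_top_of_nonneg (by linarith) h.ne) h

end Humps
-- The gliding hump: the multiplier property implies UMD
section GlidingHump

open MeasureTheory

variable {n : ℕ} [NeZero n] {E : Type*} [NormedAddCommGroup E] [NormedSpace ℂ E]

/-! ### Sums of humps in separate dyadic blocks -/

/-- The coefficients of `∑ b_N e_{m_N} P_N`, where `P_N` has the coefficients `c_N` and `m_N` is the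
center of block `t_N`. -/
def humpSum (b : ℕ → ℝ) (c : ℕ → ((Fin n → ℤ) →₀ E)) (t : ℕ → ℕ) (k : Fin n → ℤ) : E :=
  ∑' N, (b N : ℂ) • c N (k - blockCenter n (t N))

variable {b : ℕ → ℝ} {c : ℕ → ((Fin n → ℤ) →₀ E)} {t : ℕ → ℕ}

theorem exists_ne_zero_of_humpSum {k : Fin n → ℤ} (hk : humpSum b c t k ≠ 0) :
    ∃ N, c N (k - blockCenter n (t N)) ≠ 0 := by
  by_contra! h
  exact hk (by simp [humpSum, h])

theorem norm_mem_of_hump_ne_zero (hc : ∀ N, ∀ k ∈ (c N).support, ‖latticePoint k‖ < 2 ^ t N)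
    {N : ℕ} {k : Fin n → ℤ} (hk : c N (k - blockCenter n (t N)) ≠ 0) :
    2 ^ (t N + 1) < ‖latticePoint k‖ ∧ ‖latticePoint k‖ < 2 ^ (t N + 2) := by
  have h := norm_blockCenter_add (hc N _ (Finsupp.mem_support_iff.2 hk))
  rwa [add_sub_cancel] at h

/-- Hypothesis `ht` says that no two shells coincide or are adjacent, so at most one hump is present
at any frequency. -/
theorem humpSum_eq (hc : ∀ N, ∀ k ∈ (c N).support, ‖latticePoint k‖ < 2 ^ t N)
    (ht : ∀ N N', t N ≤ t N' + 1 → t N' ≤ t N + 1 → N = N') {N : ℕ} {k : Fin n → ℤ}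
    (hk : c N (k - blockCenter n (t N)) ≠ 0) :
    humpSum b c t k = (b N : ℂ) • c N (k - blockCenter n (t N)) := by
  rw [humpSum, tsum_eq_single N]
  intro N' hN'
  by_contra h
  have h1 := norm_mem_of_hump_ne_zero hc hk
  have h2 := norm_mem_of_hump_ne_zero hc (right_ne_zero_of_smul h)
  have h3 := h1.1.trans h2.2
  have h4 := h2.1.trans h1.2
  rw [pow_lt_pow_iff_right₀ (by norm_num)] at h3 h4
  exact hN' (ht N' N (by omega) (by omega))

theorem isTempered_humpSum (hc : ∀ N, ∀ k ∈ (c N).support, ‖latticePoint k‖ < 2 ^ t N)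
    (ht : ∀ N N', t N ≤ t N' + 1 → t N' ≤ t N + 1 → N = N') (hc1 : ∀ N k, ‖c N k‖ ≤ 1) {m : ℕ}
    (hb : ∀ N, |b N| ≤ (2 ^ t N) ^ m) : IsTempered (humpSum b c t) := by
  refine ⟨n ^ m, m, fun k => ?_⟩
  by_cases h0 : humpSum b c t k = 0
  · rw [h0, norm_zero]; positivity
  obtain ⟨N, hN⟩ := exists_ne_zero_of_humpSum h0
  have h1 := (norm_mem_of_hump_ne_zero hc hN).1
  have h2 : ‖latticePoint k‖ ≤ n * ‖k‖ := norm_latticePoint_le k (norm_nonneg _) fun i => by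
    have := norm_le_pi_norm k i
    rwa [Int.norm_eq_abs] at this
  have h3 : (2 : ℝ) ^ t N ≤ 2 ^ (t N + 1) := pow_le_pow_right₀ (by norm_num) (Nat.le_succ _)
  rw [humpSum_eq hc ht hN, norm_smul, Complex.norm_real, Real.norm_eq_abs, ← mul_pow]
  calc |b N| * ‖c N (k - blockCenter n (t N))‖ ≤ (2 ^ t N) ^ m * 1 := by
        gcongr; exacts [hb N, hc1 N _]
    _ = (2 ^ t N) ^ m := mul_one _
    _ ≤ (n * (1 + ‖k‖)) ^ m := by
        gcongr
        have : (0 : ℝ) ≤ n := by positivity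
        nlinarith

variable {φ : ℕ → 𝓢(EuclideanSpace ℝ (Fin n), ℂ)}

/-- φ_j may reach into the shells next to that of hump N. Those carry no hump, so it sees hump N
alone. -/
theorem smul_humpSum_eq (hφ : IsResolutionOfUnity φ)
    (hc : ∀ N, ∀ k ∈ (c N).support, ‖latticePoint k‖ < 2 ^ t N)
    (ht : ∀ N N', t N ≤ t N' + 1 → t N' ≤ t N + 1 → N = N') {N j : ℕ}
    (hj : j = t N + 1 ∨ j = t N + 2) (k : Fin n → ℤ) :
    φ j (latticePoint k) • humpSum b c t k
      = φ j (latticePoint k) • ((b N : ℂ) • c N (k - blockCenter n (t N))) := by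
  by_cases hk : c N (k - blockCenter n (t N)) = 0
  · rw [hk, smul_zero, smul_zero]
    by_contra h
    obtain ⟨N', hN'⟩ := exists_ne_zero_of_humpSum (right_ne_zero_of_smul h)
    have h1 := norm_mem_of_hump_ne_zero hc hN'
    have h2 := eq_or_eq_of_mem_annulus (hφ.mem_annulus (left_ne_zero_of_smul h)) h1.1 h1.2
    have h3 := ht N N' (by omega) (by omega)
    subst h3
    exact hN' hk
  · rw [humpSum_eq hc ht hk]

theorem smul_humpSum_eq_zero (hφ : IsResolutionOfUnity φ)
    (hc : ∀ N, ∀ k ∈ (c N).support, ‖latticePoint k‖ < 2 ^ t N) {j : ℕ}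
    (hj : ∀ N, j ≠ t N + 1 ∧ j ≠ t N + 2) (k : Fin n → ℤ) :
    φ j (latticePoint k) • humpSum b c t k = 0 := by
  by_contra h
  obtain ⟨N, hN⟩ := exists_ne_zero_of_humpSum (right_ne_zero_of_smul h)
  have h1 := norm_mem_of_hump_ne_zero hc hN
  have h2 := eq_or_eq_of_mem_annulus (hφ.mem_annulus (left_ne_zero_of_smul h)) h1.1 h1.2
  have h3 := hj N
  tauto

/-- Shifting frequencies by the center multiplies by a unimodular character and preserves the norm.
With M the identity this treats f, with `blockSymbol` and T the Riesz symbol it treats the image of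
f. -/
theorem torusNorm_littlewoodPaley_humpSum (hφ : IsResolutionOfUnity φ) (p : ℝ≥0∞)
    (hc : ∀ N, ∀ k ∈ (c N).support, ‖latticePoint k‖ < 2 ^ t N)
    (ht : ∀ N N', t N ≤ t N' + 1 → t N' ≤ t N + 1 → N = N') {N j : ℕ}
    (hj : j = t N + 1 ∨ j = t N + 2) {M T : (Fin n → ℤ) → (E →L[ℂ] E)}
    (hM : ∀ k ∈ (c N).support, M (blockCenter n (t N) + k) = T k) {g : PeriodicDistribution n E}
    (hg : ∀ k, g.coeff k = M k (humpSum b c t k)) :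
    torusNorm p (littlewoodPaley (φ j) g) = ENNReal.ofReal |b N| *
      torusNorm p (fun x => ∑ k ∈ (c N).support, expChar k x •
        (φ j (latticePoint (blockCenter n (t N) + k)) • T k (c N k))) := by
  have h1 : ∀ k, φ j (latticePoint (blockCenter n (t N) + k)) •
      g.coeff (blockCenter n (t N) + k) = (b N : ℂ) •
        (φ j (latticePoint (blockCenter n (t N) + k)) • M (blockCenter n (t N) + k) (c N k)) := by
    intro k
    rw [hg, ← map_smul, smul_humpSum_eq hφ hc ht hj, add_sub_cancel_left, map_smul, map_smul,
      smul_comm]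
  have h2 : ∀ x, littlewoodPaley (φ j) g x = expChar (blockCenter n (t N)) x • ((b N : ℂ) •
      ∑ k ∈ (c N).support, expChar k x •
        (φ j (latticePoint (blockCenter n (t N) + k)) • T k (c N k))) := by
    intro x
    rw [littlewoodPaley, ← (Equiv.addLeft (blockCenter n (t N))).tsum_eq]
    simp only [Equiv.coe_addLeft, h1]
    rw [tsum_eq_sum (s := (c N).support)]
    · rw [Finset.smul_sum, Finset.smul_sum]
      refine Finset.sum_congr rfl fun k hk => ?_
      rw [hM k hk, expChar_add, mul_smul, smul_comm (expChar k x)]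
    · intro k hk
      rw [Finsupp.notMem_support_iff.1 hk]
      simp
  have h3 : |b N| = ‖(b N : ℂ)‖ := by rw [Complex.norm_real, Real.norm_eq_abs]
  rw [h3, ← torusNorm_const_smul]
  refine eLpNorm_congr_norm_ae (Filter.Eventually.of_forall fun x => ?_)
  rw [h2, norm_smul, norm_expChar, one_mul]

theorem torusNorm_littlewoodPaley_eq_zero (hφ : IsResolutionOfUnity φ) (p : ℝ≥0∞)
    (hc : ∀ N, ∀ k ∈ (c N).support, ‖latticePoint k‖ < 2 ^ t N) {j : ℕ}
    (hj : ∀ N, j ≠ t N + 1 ∧ j ≠ t N + 2) {f : PeriodicDistribution n E}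
    (hf : ∀ k, f.coeff k = humpSum b c t k) :
    torusNorm p (littlewoodPaley (φ j) f) = 0 := by
  have h : littlewoodPaley (φ j) f = fun _ => 0 := by
    ext x
    simp [littlewoodPaley, hf, smul_humpSum_eq_zero hφ hc hj]
  rw [h]
  exact eLpNorm_zero'

theorem rpow_weight_bounds (s : ℝ) {t j : ℕ} (hj : j = t + 1 ∨ j = t + 2) :
    ((2 : ℝ) ^ (2 * |s|))⁻¹ ≤ 2 ^ (s * j) * 2 ^ (-(s * t)) ∧
      (2 : ℝ) ^ (s * j) * 2 ^ (-(s * t)) ≤ 2 ^ (2 * |s|) := by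
  have h1 : |s * j + -(s * t)| ≤ 2 * |s| := by
    have h2 : s * j + -(s * t) = s * ((j : ℝ) - t) := by ring
    have h3 : |(j : ℝ) - t| ≤ 2 := by
      rcases hj with rfl | rfl <;> · push_cast; norm_num
    rw [h2, abs_mul, mul_comm]
    gcongr
  rw [abs_le] at h1
  rw [← Real.rpow_add two_pos, ← Real.rpow_neg two_pos.le]
  exact ⟨Real.rpow_le_rpow_of_exponent_le one_le_two h1.1,
    Real.rpow_le_rpow_of_exponent_le one_le_two h1.2⟩

/-- Each hump meets only two indices j, so exchanging sums leaves twice a geometric series. -/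
theorem tsum_lt_top_of_two_per_block {u : ℕ → ℝ≥0∞} {K : ℝ}
    (h0 : ∀ j, (∀ N, j ≠ t N + 1 ∧ j ≠ t N + 2) → u j = 0)
    (h1 : ∀ N j, j = t N + 1 ∨ j = t N + 2 → u j ≤ ENNReal.ofReal (K * (1 / 2) ^ N)) :
    ∑' j, u j < ∞ := by
  have h2 : ∀ j, u j ≤ ∑' N, ((if j = t N + 1 then ENNReal.ofReal (K * (1 / 2) ^ N) else 0) +
      if j = t N + 2 then ENNReal.ofReal (K * (1 / 2) ^ N) else 0) := by
    intro j
    by_cases hj : ∀ N, j ≠ t N + 1 ∧ j ≠ t N + 2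
    · rw [h0 j hj]; exact bot_le
    · push Not at hj
      obtain ⟨N, hN⟩ := hj
      have hN' : j = t N + 1 ∨ j = t N + 2 := by tauto
      refine (h1 N j hN').trans (le_trans ?_ (ENNReal.le_tsum N))
      rcases hN' with h | h
      · rw [if_pos h]; exact le_self_add
      · rw [if_pos h]; exact le_add_self
  refine lt_of_le_of_lt (ENNReal.tsum_le_tsum h2) ?_
  rw [ENNReal.tsum_comm]
  have h3 : Summable fun N : ℕ => K * (1 / 2 : ℝ) ^ N := summable_geometric_two.mul_left K
  have h4 := h3.tsum_ofReal_lt_top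
  have h5 : ∀ N, ∑' j, ((if j = t N + 1 then ENNReal.ofReal (K * (1 / 2) ^ N) else 0) +
      if j = t N + 2 then ENNReal.ofReal (K * (1 / 2) ^ N) else 0)
        = ENNReal.ofReal (K * (1 / 2) ^ N) + ENNReal.ofReal (K * (1 / 2) ^ N) := fun N => by
    rw [ENNReal.tsum_add, tsum_ite_eq, tsum_ite_eq]
  rw [tsum_congr h5, ENNReal.tsum_add]
  exact ENNReal.add_lt_top.2 ⟨h4, h4⟩

theorem norm_rieszSymbol_le_one (k : Fin n → ℤ) : ‖rieszSymbol n E k‖ ≤ 1 := by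
  rw [rieszSymbol]
  split_ifs
  · exact ContinuousLinearMap.norm_id_le
  · simp

theorem blockSymbol_blockCenter_add {t : ℕ} {k : Fin n → ℤ} (hk : ‖latticePoint k‖ < 2 ^ t) :
    blockSymbol (ContinuousLinearMap.id ℂ E) (blockCenter n t + k) = rieszSymbol n E k := by
  rw [blockSymbol_of_inBlock _ (inBlock_blockCenter_add hk), rieszSymbol]
  classical
  exact if_congr (le_add_iff_nonneg_right (blockCenter n t)) rfl rfl

theorem isUMD_of_forall_isBesovMultiplier [CompleteSpace E] (hφ : IsResolutionOfUnity φ) {s : ℝ}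
    {p q : ℝ≥0∞} (hp : 1 < p) (hp' : p < ∞) (hq : 1 ≤ q)
    (h : ∀ M : (Fin n → ℤ) → (E →L[ℂ] E), IsCoarseBV M → IsBesovMultiplier φ s p q M) :
    IsUMD n E := by
  refine ⟨p, hp, hp', ⟨1, norm_rieszSymbol_le_one⟩, ?_⟩
  by_contra hbad
  choose c hc1 hcR using fun N : ℕ => exists_normalized_of_not_bounded hp.le hbad (4 ^ N)
  obtain ⟨C₀, hC₀, hφ0⟩ := hφ.exists_norm_le
  obtain ⟨C₁, hC₁, hφ1⟩ := hφ.exists_norm_sub_le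
  have hR : ∀ N, ∃ R : ℝ, 0 ≤ R ∧ ∀ k ∈ (c N).support, ‖latticePoint k‖ ≤ R := fun N =>
    ⟨∑ k ∈ (c N).support, ‖latticePoint k‖, Finset.sum_nonneg fun _ _ => norm_nonneg _,
      fun k hk => Finset.single_le_sum (f := fun k => ‖latticePoint k‖)
        (fun _ _ => norm_nonneg _) hk⟩
  choose R hR0 hR using hR
  -- Two demands on the shell: it must contain the translated spectrum, of radius R N, and be so far
  -- out that φ_j, with gradient at most C₁ 2^(-j), varies there by at most the inverse of the
  -- number of frequencies.
  obtain ⟨u, hu, hX⟩ := Filter.extraction_forall_of_eventually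
    (P := fun N m => R N + C₁ * R N * (c N).support.card < (2 : ℝ) ^ m) fun N =>
      (tendsto_pow_atTop_atTop_of_one_lt one_lt_two).eventually_gt_atTop _
  -- Doubling a strictly increasing sequence leaves gaps of at least 2, so shells are never
  -- adjacent.
  set t : ℕ → ℕ := fun N => 2 * u N with ht_def
  have hut : ∀ N, (2 : ℝ) ^ u N ≤ 2 ^ t N := fun N =>
    pow_le_pow_right₀ one_le_two (by simp only [ht_def]; omega)
  have hcR0 : ∀ N, 0 ≤ C₁ * R N * (c N).support.card := fun N => by
    have := hR0 N
    positivity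
  have hc : ∀ N, ∀ k ∈ (c N).support, ‖latticePoint k‖ < 2 ^ t N := fun N k hk => by
    have h1 := hR N k hk
    have h2 := hcR0 N
    linarith [hX N, hut N]
  have ht : ∀ N N', t N ≤ t N' + 1 → t N' ≤ t N + 1 → N = N' := by
    intro N N' h1 h2
    simp only [ht_def] at h1 h2
    exact hu.injective (by omega)
  -- The second factor cancels the Besov weight up to 2^(±2|s|). The first makes the series converge
  -- yet loses against 4^N.
  set b : ℕ → ℝ := fun N => (1 / 2) ^ N * 2 ^ (-(s * t N)) with hb_def
  have hbpos : ∀ N, 0 ≤ b N := fun N => by positivity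
  have hb : ∀ N, |b N| ≤ (2 ^ t N) ^ ⌈|s|⌉₊ := by
    intro N
    rw [abs_of_nonneg (hbpos N)]
    refine (mul_le_of_le_one_left (by positivity) (pow_le_one₀ (by norm_num) (by norm_num))).trans ?_
    rw [← pow_mul, ← Real.rpow_natCast]
    refine Real.rpow_le_rpow_of_exponent_le one_le_two ?_
    push_cast
    calc -(s * t N) = -s * t N := by ring
      _ ≤ ⌈|s|⌉₊ * t N := by
          gcongr
          exact (neg_le_abs s).trans (Nat.le_ceil _)
      _ = _ := mul_comm _ _
  have htemp := isTempered_humpSum hc ht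
    (fun N k => norm_coeff_le_of_torusNorm_le_one hp.le (hc1 N) k) hb
  set f := distOfCoeff (humpSum b c t) htemp with hf_def
  have hf : ∀ k, f.coeff k = humpSum b c t k := coeff_distOfCoeff _ _
  set δ : ℕ → ℝ := fun N => C₁ * (2 ^ t N)⁻¹ * R N with hδ_def
  have hδ : ∀ N, δ N * (c N).support.card ≤ 1 := by
    intro N
    have h1 : δ N * (c N).support.card = C₁ * R N * (c N).support.card / 2 ^ t N := by
      simp only [hδ_def]; field_simp
    rw [h1, div_le_one (by positivity)]
    linarith [hX N, hut N, hR0 N]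
  have hw : ∀ N j, (j = t N + 1 ∨ j = t N + 2) → ∀ k ∈ (c N).support,
      ‖φ j (latticePoint (blockCenter n (t N) + k)) - φ j (latticePoint (blockCenter n (t N)))‖
        ≤ δ N := by
    intro N j hj k hk
    rw [latticePoint_add]
    refine (hφ1 j _ _).trans ?_
    have h1 : t N ≤ j := by omega
    simp only [hδ_def]
    gcongr
    · exact one_le_two
    · exact hR N k hk
  set W : ℝ := 2 ^ (2 * |s|) with hW
  have hWpos : 0 < W := by positivity
  have hweight : ∀ N j, (j = t N + 1 ∨ j = t N + 2) →
      W⁻¹ * (1 / 2) ^ N ≤ 2 ^ (s * j) * b N ∧ 2 ^ (s * j) * b N ≤ W * (1 / 2) ^ N := by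
    intro N j hj
    obtain ⟨h1, h2⟩ := rpow_weight_bounds s hj
    have h3 : (2 : ℝ) ^ (s * j) * b N = (2 ^ (s * j) * 2 ^ (-(s * t N))) * (1 / 2) ^ N := by
      simp only [hb_def]; ring
    rw [h3]
    exact ⟨mul_le_mul_of_nonneg_right h1 (by positivity),
      mul_le_mul_of_nonneg_right h2 (by positivity)⟩
  have hmem : MemBesov φ s p q f := by
    refine memBesov_of_tsum_lt_top hq (tsum_lt_top_of_two_per_block (t := t) (K := W * (C₀ + 1))
      (fun j hj => ?_) fun N j hj => ?_)
    · rw [torusNorm_littlewoodPaley_eq_zero hφ p hc hj hf, mul_zero]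
    · rw [torusNorm_littlewoodPaley_humpSum hφ p hc ht hj
        (M := fun _ => ContinuousLinearMap.id ℂ E) (T := fun _ => ContinuousLinearMap.id ℂ E)
        (fun _ _ => rfl) hf, ← mul_assoc, ← ENNReal.ofReal_mul (by positivity),
        abs_of_nonneg (hbpos N)]
      have h1 := torusNorm_sum_smul_le hp.le (hc1 N)
        (T := fun _ => ContinuousLinearMap.id ℂ E) (fun _ => ContinuousLinearMap.norm_id_le)
        (hw N j hj) (hδ N)
      have h2 : ENNReal.ofReal ‖φ j (latticePoint (blockCenter n (t N)))‖ *
          torusNorm p (multiplierPoly (fun _ => ContinuousLinearMap.id ℂ E) (c N)) + 1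
            ≤ ENNReal.ofReal (C₀ + 1) := by
        rw [ENNReal.ofReal_add hC₀.le zero_le_one, ENNReal.ofReal_one]
        refine add_le_add ((mul_le_mul' (ENNReal.ofReal_le_ofReal (hφ0 j _))
          (hc1 N : torusNorm p (multiplierPoly (fun _ => ContinuousLinearMap.id ℂ E) (c N)) ≤ 1)).trans_eq
            (mul_one _)) le_rfl
      refine (mul_le_mul' (ENNReal.ofReal_le_ofReal (hweight N j hj).2) (h1.trans h2)).trans_eq ?_
      rw [← ENNReal.ofReal_mul (by positivity)]
      congr 1; ring
  obtain ⟨g, hgmem, hg⟩ := h _ (isCoarseBV_blockSymbol (ContinuousLinearMap.id ℂ E)) f hmem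
  set G := besovNorm φ s p q g with hG
  have hGt : G ≠ ∞ := ne_of_lt hgmem
  -- At an index j with |φ_j| ≥ 1/2 at the center, the piece F of hump N satisfies 4^N/2 ≤ F + 1,
  -- while F ≤ 2^N W G by the finite Besov norm G of the image.
  have hfinal : ∀ N : ℕ, (2 : ℝ) ^ N ≤ 2 * (W * G.toReal + 1) := by
    intro N
    have hcen : 2 ^ (t N + 1) < ‖latticePoint (blockCenter n (t N))‖ ∧
        ‖latticePoint (blockCenter n (t N))‖ < 2 ^ (t N + 2) := by
      rw [norm_latticePoint_blockCenter, pow_succ, pow_succ (2 : ℝ) (t N + 1), pow_succ]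
      have : (0 : ℝ) < 2 ^ t N := by positivity
      constructor <;> linarith
    obtain ⟨j, hj, hhalf⟩ := hφ.exists_half_le hcen.1 hcen.2
    have h1 := torusNorm_multiplierPoly_le_sum_smul hp.le (hc1 N) norm_rieszSymbol_le_one
      (hw N j hj) (hδ N)
    have h2 := le_besovNorm (φ := φ) s p hq g j
    rw [torusNorm_littlewoodPaley_humpSum hφ p hc ht hj
      (fun k hk => blockSymbol_blockCenter_add (hc N k hk)) (fun k => by rw [hg, hf]), ← mul_assoc,
      ← ENNReal.ofReal_mul (by positivity), abs_of_nonneg (hbpos N)] at h2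
    set F := torusNorm p (fun x => ∑ k ∈ (c N).support, expChar k x •
      (φ j (latticePoint (blockCenter n (t N) + k)) • rieszSymbol n E k (c N k))) with hF
    have h3 : ENNReal.ofReal (W⁻¹ * (1 / 2) ^ N) * F ≤ G :=
      (mul_le_mul_left (ENNReal.ofReal_le_ofReal (hweight N j hj).1) _).trans h2
    have h4 : ENNReal.ofReal (1 / 2) * ((4 ^ N : ℝ≥0) : ℝ≥0∞) ≤ F + 1 :=
      (mul_le_mul' (ENNReal.ofReal_le_ofReal hhalf) (hcR N)).trans h1
    have hpos : 0 < W⁻¹ * (1 / 2 : ℝ) ^ N := by positivity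
    have hFt : F ≠ ∞ := by
      intro hF
      rw [hF, ENNReal.mul_top (ENNReal.ofReal_pos.2 hpos).ne'] at h3
      exact hGt (top_le_iff.1 h3)
    have h5 := ENNReal.toReal_mono hGt h3
    rw [ENNReal.toReal_mul, ENNReal.toReal_ofReal hpos.le] at h5
    have h6 := ENNReal.toReal_mono (ENNReal.add_ne_top.2 ⟨hFt, ENNReal.one_ne_top⟩) h4
    rw [ENNReal.toReal_mul, ENNReal.toReal_ofReal (by norm_num), ENNReal.toReal_add hFt
      ENNReal.one_ne_top, ENNReal.toReal_one, ENNReal.coe_toReal] at h6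
    push_cast at h6
    have h7 : F.toReal ≤ 2 ^ N * (W * G.toReal) := by
      have h8 : (2 : ℝ) ^ N * (1 / 2) ^ N = 1 := by rw [← mul_pow]; norm_num
      calc F.toReal = (2 ^ N * W) * (W⁻¹ * (1 / 2) ^ N * F.toReal) := by
            field_simp
            linear_combination (-F.toReal) * h8
        _ ≤ (2 ^ N * W) * G.toReal := by gcongr
        _ = _ := by ring
    have h9 : (4 : ℝ) ^ N = 2 ^ N * 2 ^ N := by rw [← mul_pow]; norm_num
    have h10 : (1 : ℝ) ≤ 2 ^ N := one_le_pow₀ one_le_two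
    have h11 : (2 : ℝ) ^ N * 2 ^ N ≤ 2 ^ N * (2 * (W * G.toReal + 1)) := by
      rw [h9] at h6
      nlinarith
    exact le_of_mul_le_mul_left h11 (by positivity)
  obtain ⟨N, hN⟩ := pow_unbounded_of_one_lt (2 * (W * G.toReal + 1)) (one_lt_two (α := ℝ))
  exact absurd (hfinal N) (not_le.2 hN)

end GlidingHump
end TorusBesov

end

theorem theorem5 {n : ℕ} [NeZero n] {E : Type*} [NormedAddCommGroup E] [NormedSpace ℂ E]
    [CompleteSpace E]
    (φ : ℕ → SchwartzMap (EuclideanSpace ℝ (Fin n)) ℂ) (hφ : TorusBesov.IsResolutionOfUnity φ)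
    (s : ℝ) (p q : ℝ≥0∞) (hp : 1 < p) (hp' : p < ∞) (hq : 1 ≤ q) :
    (∀ M : (Fin n → ℤ) → (E →L[ℂ] E),
        TorusBesov.IsCoarseBV M → TorusBesov.IsBesovMultiplier φ s p q M) ↔
      TorusBesov.IsUMD n E :=
  ⟨TorusBesov.isUMD_of_forall_isBesovMultiplier hφ hp hp' hq,
    fun h _ hM => h.isBesovMultiplier hφ hp hp' hq hM⟩
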